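/- Write $(1^n)$ for $(1,\dots,1)$ ($n$ ones). Let $(\alpha,\beta,\gamma)$ be one of the following triples of compositions of $n$ (Simpson's list): * hypergeometric family: $(1,m-1),(1^m),(1^m)$ with $m\ge 2$, $n=m$; * even family: $(m,m),(1,m-1,m),(1^{2m})$ with $m\ge 2$, $n=2m$; * odd family: $(m+1,m),(1,m,m),(1^{2m+1})$ with $m\ge 2$, $n=2m+1$; * extra case: $(4,2),(2,2,2),(1^6)$, $n=6$. Let $S(\alpha,\beta,\gamma)$ be the set of $(x,y,z)\in(\mathbb C^n)^3$ such that $x$ (resp. $y$, $z$) is constant on each of its successive blocks of lengths given by $\alpha$ (resp. $\beta$, $\gamma$), the values on different blocks are different, and $\sum_i x_i=\sum_i (y_i+z_i)$. Denote by $a_k,b_k,c_k$ the value of $x,y,z$ on its $k$-th block. Empty products are $1$. For $(x,y,z)\in S(\alpha,\beta,\gamma)$ define $n\times n$ matrices $B,C$ (wherever their denominators do not vanish) and expressions $l_1,\dots,l_n$ as follows; entries that are not listed are $0$. **Hypergeometric family.** $B_{ii}=b_i$, $B_{ij}=b_i+c_{m+1-i}-a_2$ for $i<j$; $C_{ii}=c_{m+1-i}$,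 $C_{ij}=b_i+c_{m+1-i}-a_2$ for $i>j$; $$l_i=\frac{\prod_{k=i+1}^m(b_i-b_k)}{\prod_{k=1}^{i-1}(b_i-b_k)}\cdot\frac{\prod_{k=m+2-i}^m(b_i+c_k-a_2)}{\prod_{k=1}^{m+1-i}(b_i+c_k-a_2)}.$$ For the even and odd families put $p_i^{jk}=c_i+b_j-a_k$ and $q_{ij}=c_i+c_j+b_2+b_3-a_1-a_2$. **Even family.** The diagonal of $B$ is $(b_1,b_2,\dots,b_2,b_3,\dots,b_3)$ ($b_2$ repeated $m-1$ times, $b_3$ repeated $m$ times), the diagonal of $C$ is $(c_{2m},c_{2m-1},\dots,c_1)$, and $$B_{1,1+j}=(-1)^{m+1-j}\frac{\prod_{k=j+1}^m q_{k,2m-j}}{\prod_{k=m+1}^{2m-1-j}(c_k-c_{2m-j})}\quad(1\le j\le m-1),$$ $$B_{1,m+j}=(-1)^{m-j}p^{31}_{m+1-j}\frac{\prod_{k=m+j}^{2m-1}q_{m+1-j,k}}{\prod_{k=1}^{m-j}(c_k-c_{m+1-j})}\quad(1\le j\le m),$$ $$B_{1+i,m+j}=(-1)^{m-j}p^{31}_{m+1-j}\frac{\prod_{k=1,\,k\ne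 m+1-j}^{i}q_{k,2m-i}\ \prod_{k=m+j,\,k\ne 2m-i}^{2m-1}q_{m+1-j,k}}{\prod_{k=2m+1-i}^{2m-1}(c_{2m-i}-c_k)\ \prod_{k=1}^{m-j}(c_k-c_{m+1-j})}\quad(1\le i\le m-1,\ 1\le j\le m),$$ $$C_{1+i,1}=-\frac{\prod_{k=1}^i q_{k,2m-i}}{\prod_{k=2m+1-i}^{2m-1}(c_{2m-i}-c_k)}\quad(1\le i\le m-1),$$ $$C_{m+i,1}=-p^{32}_{m+1-i}\frac{\prod_{k=m+1}^{m-1+i}q_{m+1-i,k}}{\prod_{k=m+2-i}^m(c_{m+1-i}-c_k)}\quad(1\le i\le m),$$ $$C_{m+i,1+j}=(-1)^{m+1-j}p^{32}_{m+1-i}\frac{\prod_{k=m+1,\,k\ne 2m-j}^{m-1+i}q_{m+1-i,k}\ \prod_{k=j+1,\,k\ne m+1-i}^{m}q_{k,2m-j}}{\prod_{k=m+2-i}^m(c_{m+1-i}-c_k)\ \prod_{k=m+1}^{2m-1-j}(c_k-c_{2m-j})}\quad(1\le i\le m,\ 1\le j\le m-1);$$ $$l_i=\frac{\prod_{k=i+1}^{2m}(c_i-c_k)}{\prod_{k=1}^{i-1}(c_i-c_k)}\cdot\frac{\prod_{k=2m+1-i,\,k\ne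 i}^{2m}q_{ik}}{\prod_{k=1,\,k\ne i}^{2m-i}q_{ik}}\cdot\begin{cases}p^{31}_i/p^{32}_i,&i\le m,\\ p^{31}_i\,p^{32}_i,&i>m.\end{cases}$$ **Odd family.** The diagonal of $B$ is $(b_1,b_2,\dots,b_2,b_3,\dots,b_3)$ ($b_2$ and $b_3$ repeated $m$ times each), the diagonal of $C$ is $(c_{2m+1},c_{2m},\dots,c_1)$, and for $1\le i,j\le m$ $$B_{1,1+j}=(-1)^{m-j}p^{21}_{2m+1-j}\frac{\prod_{k=j+1}^m q_{k,2m+1-j}}{\prod_{k=m+1}^{2m-j}(c_k-c_{2m+1-j})},\qquad B_{1,m+1+j}=(-1)^{m-j}p^{31}_{m+1-j}\frac{\prod_{k=m+1+j}^{2m}q_{m+1-j,k}}{\prod_{k=1}^{m-j}(c_k-c_{m+1-j})},$$ $$B_{1+i,m+1+j}=(-1)^{m-j}p^{31}_{m+1-j}\frac{\prod_{k=1,\,k\ne m+1-j}^{i}q_{k,2m+1-i}\ \prod_{k=m+1+j,\,k\ne 2m+1-i}^{2m}q_{m+1-j,k}}{\prod_{k=2m+2-i}^{2m}(c_{2m+1-i}-c_k)\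 \prod_{k=1}^{m-j}(c_k-c_{m+1-j})},$$ $$C_{1+i,1}=-\frac{\prod_{k=1}^i q_{k,2m+1-i}}{\prod_{k=2m+2-i}^{2m}(c_{2m+1-i}-c_k)},\qquad C_{m+1+i,1}=-\frac{\prod_{k=m+1}^{m+i}q_{m+1-i,k}}{\prod_{k=m+2-i}^m(c_{m+1-i}-c_k)},$$ $$C_{m+1+i,1+j}=(-1)^{m-j}p^{21}_{2m+1-j}\frac{\prod_{k=m+1,\,k\ne 2m+1-j}^{m+i}q_{m+1-i,k}\ \prod_{k=j+1,\,k\ne m+1-i}^{m}q_{k,2m+1-j}}{\prod_{k=m+2-i}^m(c_{m+1-i}-c_k)\ \prod_{k=m+1}^{2m-j}(c_k-c_{2m+1-j})};$$ $$l_i=\frac{\prod_{k=i+1}^{2m+1}(c_i-c_k)}{\prod_{k=1}^{i-1}(c_i-c_k)}\cdot\frac{\prod_{k=2m+2-i,\,k\ne i}^{2m+1}q_{ik}}{\prod_{k=1,\,k\ne i}^{2m+1-i}q_{ik}}\cdot\begin{cases}p^{31}_i/p^{21}_i,&i\le m,\\ p^{31}_i\,p^{21}_i,&i>m.\end{cases}$$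 **Extra case.** Put $p_{ij}=b_i+c_j-a_1$, $q_{ijk}=c_i+c_j+c_k-\frac12\sum_{l=1}^6c_l$ and $c_{ij}=c_i-c_j$. Then $$B=\begin{pmatrix}b_1&0&-\frac{p_{16}q_{245}}{c_{34}}&p_{16}&\frac{p_{16}q_{245}}{c_{12}}&p_{16}\\0&b_1&\frac{p_{15}q_{235}q_{246}}{c_{34}c_{56}}&-\frac{p_{15}q_{236}}{c_{56}}&-\frac{p_{15}q_{236}q_{246}}{c_{12}c_{56}}&-\frac{p_{15}q_{235}}{c_{56}}\\0&0&b_2&0&-\frac{p_{24}q_{236}}{c_{12}}&p_{24}\\0&0&0&b_2&-\frac{p_{23}q_{245}q_{246}}{c_{12}c_{34}}&\frac{p_{23}q_{235}}{c_{34}}\\0&0&0&0&b_3&0\\0&0&0&0&0&b_3\end{pmatrix},$$ $$C=\begin{pmatrix}c_6&0&0&0&0&0\\0&c_5&0&0&0&0\\-\frac{p_{24}q_{236}}{c_{56}}&-p_{24}&c_4&0&0&0\\-\frac{p_{23}q_{235}q_{246}}{c_{34}c_{56}}&-\frac{p_{23}q_{245}}{c_{34}}&0&c_3&0&0\\-\frac{p_{32}q_{235}}{c_{56}}&-p_{32}&\frac{p_{32}q_{235}}{c_{34}}&-p_{32}&c_2&0\\\frac{p_{31}q_{236}q_{246}}{c_{12}c_{56}}&\frac{p_{31}q_{245}}{c_{12}}&\frac{p_{31}q_{245}q_{246}}{c_{12}c_{34}}&-\frac{p_{31}q_{236}}{c_{12}}&0&c_1\end{pmatrix},$$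 $$l_1=-\frac{c_{12}c_{13}c_{14}c_{15}c_{16}}{p_{11}p_{21}p_{31}},\quad l_2=\frac{c_{23}c_{24}c_{25}c_{26}}{c_{21}p_{12}p_{22}p_{32}}\cdot\frac{q_{134}q_{135}q_{136}q_{145}}{q_{146}q_{156}},\quad l_3=\frac{c_{34}c_{35}c_{36}p_{33}}{c_{31}c_{32}p_{13}p_{23}}\cdot\frac{q_{124}q_{125}q_{126}q_{145}}{q_{146}q_{156}},$$ $$l_4=\frac{c_{45}c_{46}p_{34}}{c_{41}c_{42}c_{43}p_{14}p_{24}}\cdot\frac{q_{123}q_{125}q_{126}q_{135}q_{136}}{q_{156}},\quad l_5=\frac{c_{56}p_{25}p_{35}}{c_{51}c_{52}c_{53}c_{54}p_{15}}\cdot\frac{q_{123}q_{124}q_{126}q_{134}q_{136}}{q_{146}},$$ $$l_6=\frac{p_{26}p_{36}}{c_{61}c_{62}c_{63}c_{64}c_{65}p_{16}}\cdot q_{123}q_{124}q_{125}q_{134}q_{135}q_{145}.$$ In each case let $S'(\alpha,\beta,\gamma)$ be the set of points of $S(\alpha,\beta,\gamma)$ at which no linear form in the denominators of the displayed $l_1,\dots,l_n$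 vanishes, and let $S''(\alpha,\beta,\gamma)$ be the set of points of $S'(\alpha,\beta,\gamma)$ at which no linear form in the numerators vanishes either. **Theorem.** For every $(\alpha,\beta,\gamma)$ in the list and every $(x,y,z)\in S''(\alpha,\beta,\gamma)$, the constructed triple $(A,B,C)$ with $A=B+C$ is irreducible: the only linear subspaces of $\mathbb C^n$ preserved by $A$, $B$ and $C$ are $0$ and $\mathbb C^n$. -/

import Mathlib

namespace Simpson

open Finset

/-- The `k`-th coordinate of a vector, counted from `1` (and `0` if `k` is out of range). -/
noncomputable def coord {n : ℕ} (x : Fin n → ℂ) (k : ℕ) : ℂ :=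
  if h : 0 < k ∧ k ≤ n then x ⟨k - 1, by omega⟩ else 0

/-- The matrix with the entries `f r s`, where rows and columns are counted from `1`. -/
def ofEntries (n : ℕ) (f : ℕ → ℕ → ℂ) : Matrix (Fin n) (Fin n) ℂ :=
  Matrix.of fun r s => f (r + 1) (s + 1)

/-- `x` has the shape `(x₁,…,x₁,x₂,…,x₂,…)` with block lengths given by `α` and with values that
are different for different blocks. -/
def HasShape {n : ℕ} (α : Composition n) (x : Fin n → ℂ) : Prop :=
  ∀ i j, x i = x j ↔ α.index i = α.index j

/-- The value of `x` on the `k`-th block of `α`, with blocks counted from `1`. -/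
noncomputable def blockValue {n : ℕ} (α : Composition n) (x : Fin n → ℂ) (k : ℕ) : ℂ :=
  coord x (α.sizeUpTo (k - 1) + 1)

/-- Triples of vectors of shapes `α`, `β`, `γ` that satisfy the trace condition. -/
def S {n : ℕ} (α β γ : Composition n) : Set ((Fin n → ℂ) × (Fin n → ℂ) × (Fin n → ℂ)) :=
  {p | HasShape α p.1 ∧ HasShape β p.2.1 ∧ HasShape γ p.2.2 ∧
    ∑ i, p.1 i = ∑ i, (p.2.1 i + p.2.2 i)}

/-- No subspace other than `0` and the whole space is preserved by all three matrices. -/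
def IsIrreducibleTriple {n : ℕ} (A B C : Matrix (Fin n) (Fin n) ℂ) : Prop :=
  ∀ W : Submodule ℂ (Fin n → ℂ),
    (∀ w ∈ W, A.mulVec w ∈ W) → (∀ w ∈ W, B.mulVec w ∈ W) → (∀ w ∈ W, C.mulVec w ∈ W) →
      W = ⊥ ∨ W = ⊤

/-! In all that follows, `a k`, `b k`, `c k` are the distinct eigenvalues of the three matrices,
counted from `1`. All index ranges are ranges of natural numbers counted from `1`. -/

/-! ### The hypergeometric family -/

/-- Entries of the upper triangular matrix `B`. -/
noncomputable def hgB (m : ℕ) (a b c : ℕ → ℂ) (i j : ℕ) : ℂ :=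
  if i < j then b i + c (m + 1 - i) - a 2 else if i = j then b i else 0

/-- Entries of the lower triangular matrix `C`. -/
noncomputable def hgC (m : ℕ) (a b c : ℕ → ℂ) (i j : ℕ) : ℂ :=
  if i < j then 0 else if i = j then c (m + 1 - i) else b i + c (m + 1 - i) - a 2

/-- Numerator of the scalar square of the `i`-th eigenvector of `B`. -/
noncomputable def hgNum (m : ℕ) (a b c : ℕ → ℂ) (i : ℕ) : ℂ :=
  (∏ k ∈ Icc (i + 1) m, (b i - b k)) * ∏ k ∈ Icc (m + 2 - i) m, (b i + c k - a 2)

/-- Denominator of the scalar square of the `i`-th eigenvector of `B`. -/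
noncomputable def hgDen (m : ℕ) (a b c : ℕ → ℂ) (i : ℕ) : ℂ :=
  (∏ k ∈ Icc 1 (i - 1), (b i - b k)) * ∏ k ∈ Icc 1 (m + 1 - i), (b i + c k - a 2)

/-! ### The linear forms of the even and odd families -/

/-- The linear form `p_i^{jk} = c_i + b_j - a_k`. -/
noncomputable def p (a b c : ℕ → ℂ) (i j k : ℕ) : ℂ := c i + b j - a k

/-- The linear form `q_{ij} = c_i + c_j + b_2 + b_3 - a_1 - a_2`. -/
noncomputable def q (a b c : ℕ → ℂ) (i j : ℕ) : ℂ := c i + c j + b 2 + b 3 - a 1 - a 2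

/-! ### The even family: blocks of sizes `1`, `m - 1`, `m` -/

/-- `B_{1,1+j}` for `1 ≤ j ≤ m - 1`. -/
noncomputable def evenB12 (m : ℕ) (a b c : ℕ → ℂ) (j : ℕ) : ℂ :=
  (-1) ^ (m + 1 - j) * (∏ k ∈ Icc (j + 1) m, q a b c k (2 * m - j)) /
    ∏ k ∈ Icc (m + 1) (2 * m - 1 - j), (c k - c (2 * m - j))

/-- `B_{1,m+j}` for `1 ≤ j ≤ m`. -/
noncomputable def evenB13 (m : ℕ) (a b c : ℕ → ℂ) (j : ℕ) : ℂ :=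
  (-1) ^ (m - j) * p a b c (m + 1 - j) 3 1 *
    (∏ k ∈ Icc (m + j) (2 * m - 1), q a b c (m + 1 - j) k) /
      ∏ k ∈ Icc 1 (m - j), (c k - c (m + 1 - j))

/-- `B_{1+i,m+j}` for `1 ≤ i ≤ m - 1`, `1 ≤ j ≤ m`. -/
noncomputable def evenB23 (m : ℕ) (a b c : ℕ → ℂ) (i j : ℕ) : ℂ :=
  (-1) ^ (m - j) * p a b c (m + 1 - j) 3 1 *
    ((∏ k ∈ (Icc 1 i).erase (m + 1 - j), q a b c k (2 * m - i)) *
      ∏ k ∈ (Icc (m + j) (2 * m - 1)).erase (2 * m - i), q a b c (m + 1 - j) k) /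
    ((∏ k ∈ Icc (2 * m + 1 - i) (2 * m - 1), (c (2 * m - i) - c k)) *
      ∏ k ∈ Icc 1 (m - j), (c k - c (m + 1 - j)))

/-- Entries of the block upper triangular matrix `B`. -/
noncomputable def evenB (m : ℕ) (a b c : ℕ → ℂ) (r s : ℕ) : ℂ :=
  if r = s then (if r = 1 then b 1 else if r ≤ m then b 2 else b 3)
  else if r = 1 ∧ s ≤ m then evenB12 m a b c (s - 1)
  else if r = 1 then evenB13 m a b c (s - m)
  else if r ≤ m ∧ m < s then evenB23 m a b c (r - 1) (s - m)
  else 0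

/-- `C_{1+i,1}` for `1 ≤ i ≤ m - 1`. -/
noncomputable def evenC21 (m : ℕ) (a b c : ℕ → ℂ) (i : ℕ) : ℂ :=
  -((∏ k ∈ Icc 1 i, q a b c k (2 * m - i)) /
    ∏ k ∈ Icc (2 * m + 1 - i) (2 * m - 1), (c (2 * m - i) - c k))

/-- `C_{m+i,1}` for `1 ≤ i ≤ m`. -/
noncomputable def evenC31 (m : ℕ) (a b c : ℕ → ℂ) (i : ℕ) : ℂ :=
  -p a b c (m + 1 - i) 3 2 *
    ((∏ k ∈ Icc (m + 1) (m - 1 + i), q a b c (m + 1 - i) k) /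
      ∏ k ∈ Icc (m + 2 - i) m, (c (m + 1 - i) - c k))

/-- `C_{m+i,1+j}` for `1 ≤ i ≤ m`, `1 ≤ j ≤ m - 1`. -/
noncomputable def evenC32 (m : ℕ) (a b c : ℕ → ℂ) (i j : ℕ) : ℂ :=
  (-1) ^ (m + 1 - j) * p a b c (m + 1 - i) 3 2 *
    ((∏ k ∈ (Icc (m + 1) (m - 1 + i)).erase (2 * m - j), q a b c (m + 1 - i) k) *
      ∏ k ∈ (Icc (j + 1) m).erase (m + 1 - i), q a b c k (2 * m - j)) /
    ((∏ k ∈ Icc (m + 2 - i) m, (c (m + 1 - i) - c k)) *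
      ∏ k ∈ Icc (m + 1) (2 * m - 1 - j), (c k - c (2 * m - j)))

/-- Entries of the block lower triangular matrix `C`. -/
noncomputable def evenC (m : ℕ) (a b c : ℕ → ℂ) (r s : ℕ) : ℂ :=
  if r = s then c (2 * m + 1 - r)
  else if s = 1 ∧ r ≤ m then evenC21 m a b c (r - 1)
  else if s = 1 then evenC31 m a b c (r - m)
  else if s ≤ m ∧ m < r then evenC32 m a b c (r - m) (s - 1)
  else 0

/-- Numerator of the scalar square of the `i`-th eigenvector of `C`. -/
noncomputable def evenNum (m : ℕ) (a b c : ℕ → ℂ) (i : ℕ) : ℂ :=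
  (∏ k ∈ Icc (i + 1) (2 * m), (c i - c k)) *
    (∏ k ∈ (Icc (2 * m + 1 - i) (2 * m)).erase i, q a b c i k) *
    (if i ≤ m then p a b c i 3 1 else p a b c i 3 1 * p a b c i 3 2)

/-- Denominator of the scalar square of the `i`-th eigenvector of `C`. -/
noncomputable def evenDen (m : ℕ) (a b c : ℕ → ℂ) (i : ℕ) : ℂ :=
  (∏ k ∈ Icc 1 (i - 1), (c i - c k)) *
    (∏ k ∈ (Icc 1 (2 * m - i)).erase i, q a b c i k) *
    (if i ≤ m then p a b c i 3 2 else 1)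

/-! ### The odd family: blocks of sizes `1`, `m`, `m` -/

/-- `B_{1,1+j}` for `1 ≤ j ≤ m`. -/
noncomputable def oddB12 (m : ℕ) (a b c : ℕ → ℂ) (j : ℕ) : ℂ :=
  (-1) ^ (m - j) * p a b c (2 * m + 1 - j) 2 1 *
    (∏ k ∈ Icc (j + 1) m, q a b c k (2 * m + 1 - j)) /
      ∏ k ∈ Icc (m + 1) (2 * m - j), (c k - c (2 * m + 1 - j))

/-- `B_{1,m+1+j}` for `1 ≤ j ≤ m`. -/
noncomputable def oddB13 (m : ℕ) (a b c : ℕ → ℂ) (j : ℕ) : ℂ :=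
  (-1) ^ (m - j) * p a b c (m + 1 - j) 3 1 *
    (∏ k ∈ Icc (m + 1 + j) (2 * m), q a b c (m + 1 - j) k) /
      ∏ k ∈ Icc 1 (m - j), (c k - c (m + 1 - j))

/-- `B_{1+i,m+1+j}` for `1 ≤ i ≤ m`, `1 ≤ j ≤ m`. -/
noncomputable def oddB23 (m : ℕ) (a b c : ℕ → ℂ) (i j : ℕ) : ℂ :=
  (-1) ^ (m - j) * p a b c (m + 1 - j) 3 1 *
    ((∏ k ∈ (Icc 1 i).erase (m + 1 - j), q a b c k (2 * m + 1 - i)) *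
      ∏ k ∈ (Icc (m + 1 + j) (2 * m)).erase (2 * m + 1 - i), q a b c (m + 1 - j) k) /
    ((∏ k ∈ Icc (2 * m + 2 - i) (2 * m), (c (2 * m + 1 - i) - c k)) *
      ∏ k ∈ Icc 1 (m - j), (c k - c (m + 1 - j)))

/-- Entries of the block upper triangular matrix `B`. -/
noncomputable def oddB (m : ℕ) (a b c : ℕ → ℂ) (r s : ℕ) : ℂ :=
  if r = s then (if r = 1 then b 1 else if r ≤ m + 1 then b 2 else b 3)
  else if r = 1 ∧ s ≤ m + 1 then oddB12 m a b c (s - 1)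
  else if r = 1 then oddB13 m a b c (s - (m + 1))
  else if r ≤ m + 1 ∧ m + 1 < s then oddB23 m a b c (r - 1) (s - (m + 1))
  else 0

/-- `C_{1+i,1}` for `1 ≤ i ≤ m`. -/
noncomputable def oddC21 (m : ℕ) (a b c : ℕ → ℂ) (i : ℕ) : ℂ :=
  -((∏ k ∈ Icc 1 i, q a b c k (2 * m + 1 - i)) /
    ∏ k ∈ Icc (2 * m + 2 - i) (2 * m), (c (2 * m + 1 - i) - c k))

/-- `C_{m+1+i,1}` for `1 ≤ i ≤ m`. -/
noncomputable def oddC31 (m : ℕ) (a b c : ℕ → ℂ) (i : ℕ) : ℂ :=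
  -((∏ k ∈ Icc (m + 1) (m + i), q a b c (m + 1 - i) k) /
    ∏ k ∈ Icc (m + 2 - i) m, (c (m + 1 - i) - c k))

/-- `C_{m+1+i,1+j}` for `1 ≤ i ≤ m`, `1 ≤ j ≤ m`. -/
noncomputable def oddC32 (m : ℕ) (a b c : ℕ → ℂ) (i j : ℕ) : ℂ :=
  (-1) ^ (m - j) * p a b c (2 * m + 1 - j) 2 1 *
    ((∏ k ∈ (Icc (m + 1) (m + i)).erase (2 * m + 1 - j), q a b c (m + 1 - i) k) *
      ∏ k ∈ (Icc (j + 1) m).erase (m + 1 - i), q a b c k (2 * m + 1 - j)) /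
    ((∏ k ∈ Icc (m + 2 - i) m, (c (m + 1 - i) - c k)) *
      ∏ k ∈ Icc (m + 1) (2 * m - j), (c k - c (2 * m + 1 - j)))

/-- Entries of the block lower triangular matrix `C`. -/
noncomputable def oddC (m : ℕ) (a b c : ℕ → ℂ) (r s : ℕ) : ℂ :=
  if r = s then c (2 * m + 2 - r)
  else if s = 1 ∧ r ≤ m + 1 then oddC21 m a b c (r - 1)
  else if s = 1 then oddC31 m a b c (r - (m + 1))
  else if s ≤ m + 1 ∧ m + 1 < r then oddC32 m a b c (r - (m + 1)) (s - 1)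
  else 0

/-- Numerator of the scalar square of the `i`-th eigenvector of `C`. -/
noncomputable def oddNum (m : ℕ) (a b c : ℕ → ℂ) (i : ℕ) : ℂ :=
  (∏ k ∈ Icc (i + 1) (2 * m + 1), (c i - c k)) *
    (∏ k ∈ (Icc (2 * m + 2 - i) (2 * m + 1)).erase i, q a b c i k) *
    (if i ≤ m then p a b c i 3 1 else p a b c i 3 1 * p a b c i 2 1)

/-- Denominator of the scalar square of the `i`-th eigenvector of `C`. -/
noncomputable def oddDen (m : ℕ) (a b c : ℕ → ℂ) (i : ℕ) : ℂ :=
  (∏ k ∈ Icc 1 (i - 1), (c i - c k)) *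
    (∏ k ∈ (Icc 1 (2 * m + 1 - i)).erase i, q a b c i k) *
    (if i ≤ m then p a b c i 2 1 else 1)

/-! ### The extra case: blocks of sizes `2`, `2`, `2` -/

/-- The linear form `p_{ij} = b_i + c_j - a_1` of the extra case. -/
noncomputable def pE (a b c : ℕ → ℂ) (i j : ℕ) : ℂ := b i + c j - a 1

/-- The linear form `q_{ijk} = c_i + c_j + c_k - (c_1 + ⋯ + c_6) / 2` of the extra case. -/
noncomputable def qE (c : ℕ → ℂ) (i j k : ℕ) : ℂ :=
  c i + c j + c k - (∑ l ∈ Icc 1 6, c l) / 2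

/-- The block upper triangular matrix `B`. -/
noncomputable def extraB (a b c : ℕ → ℂ) : Matrix (Fin 6) (Fin 6) ℂ :=
  let p := pE a b c
  let q := qE c
  let d : ℕ → ℕ → ℂ := fun i j => c i - c j
  !![b 1, 0, -(p 1 6 * q 2 4 5) / d 3 4, p 1 6,
      p 1 6 * q 2 4 5 / d 1 2, p 1 6;
    0, b 1, p 1 5 * q 2 3 5 * q 2 4 6 / (d 3 4 * d 5 6), -(p 1 5 * q 2 3 6) / d 5 6,
      -(p 1 5 * q 2 3 6 * q 2 4 6) / (d 1 2 * d 5 6), -(p 1 5 * q 2 3 5) / d 5 6;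
    0, 0, b 2, 0,
      -(p 2 4 * q 2 3 6) / d 1 2, p 2 4;
    0, 0, 0, b 2,
      -(p 2 3 * q 2 4 5 * q 2 4 6) / (d 1 2 * d 3 4), p 2 3 * q 2 3 5 / d 3 4;
    0, 0, 0, 0, b 3, 0;
    0, 0, 0, 0, 0, b 3]

/-- The block lower triangular matrix `C`. -/
noncomputable def extraC (a b c : ℕ → ℂ) : Matrix (Fin 6) (Fin 6) ℂ :=
  let p := pE a b c
  let q := qE c
  let d : ℕ → ℕ → ℂ := fun i j => c i - c j
  !![c 6, 0, 0, 0, 0, 0;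
    0, c 5, 0, 0, 0, 0;
    -(p 2 4 * q 2 3 6) / d 5 6, -p 2 4, c 4, 0, 0, 0;
    -(p 2 3 * q 2 3 5 * q 2 4 6) / (d 3 4 * d 5 6), -(p 2 3 * q 2 4 5) / d 3 4, 0, c 3, 0, 0;
    -(p 3 2 * q 2 3 5) / d 5 6, -p 3 2,
      p 3 2 * q 2 3 5 / d 3 4, -p 3 2, c 2, 0;
    p 3 1 * q 2 3 6 * q 2 4 6 / (d 1 2 * d 5 6), p 3 1 * q 2 4 5 / d 1 2,
      p 3 1 * q 2 4 5 * q 2 4 6 / (d 1 2 * d 3 4), -(p 3 1 * q 2 3 6) / d 1 2, 0, c 1]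

/-- Numerator of the scalar square of the `i`-th eigenvector of `C`. -/
noncomputable def extraNum (a b c : ℕ → ℂ) (i : ℕ) : ℂ :=
  let p := pE a b c
  let q := qE c
  let d : ℕ → ℕ → ℂ := fun i j => c i - c j
  match i with
  | 1 => -(d 1 2 * d 1 3 * d 1 4 * d 1 5 * d 1 6)
  | 2 => d 2 3 * d 2 4 * d 2 5 * d 2 6 * (q 1 3 4 * q 1 3 5 * q 1 3 6 * q 1 4 5)
  | 3 => d 3 4 * d 3 5 * d 3 6 * p 3 3 * (q 1 2 4 * q 1 2 5 * q 1 2 6 * q 1 4 5)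
  | 4 => d 4 5 * d 4 6 * p 3 4 * (q 1 2 3 * q 1 2 5 * q 1 2 6 * q 1 3 5 * q 1 3 6)
  | 5 => d 5 6 * p 2 5 * p 3 5 * (q 1 2 3 * q 1 2 4 * q 1 2 6 * q 1 3 4 * q 1 3 6)
  | 6 => p 2 6 * p 3 6 * (q 1 2 3 * q 1 2 4 * q 1 2 5 * q 1 3 4 * q 1 3 5 * q 1 4 5)
  | _ => 1

/-- Denominator of the scalar square of the `i`-th eigenvector of `C`. -/
noncomputable def extraDen (a b c : ℕ → ℂ) (i : ℕ) : ℂ :=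
  let p := pE a b c
  let q := qE c
  let d : ℕ → ℕ → ℂ := fun i j => c i - c j
  match i with
  | 1 => p 1 1 * p 2 1 * p 3 1
  | 2 => d 2 1 * p 1 2 * p 2 2 * p 3 2 * (q 1 4 6 * q 1 5 6)
  | 3 => d 3 1 * d 3 2 * p 1 3 * p 2 3 * (q 1 4 6 * q 1 5 6)
  | 4 => d 4 1 * d 4 2 * d 4 3 * p 1 4 * p 2 4 * q 1 5 6
  | 5 => d 5 1 * d 5 2 * d 5 3 * d 5 4 * p 1 5 * q 1 4 6
  | 6 => d 6 1 * d 6 2 * d 6 3 * d 6 4 * d 6 5 * p 1 6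
  | _ => 1

end Simpson

/-- The list of triples of spectral types. -/
inductive SimpsonType where
  /-- `(1, m-1), (1^m), (1^m)` -/
  | hypergeometric (m : ℕ) (hm : 2 ≤ m)
  /-- `(m, m), (1, m-1, m), (1^{2m})` -/
  | even (m : ℕ) (hm : 2 ≤ m)
  /-- `(m+1, m), (1, m, m), (1^{2m+1})` -/
  | odd (m : ℕ) (hm : 2 ≤ m)
  /-- `(4, 2), (2, 2, 2), (1^6)` -/
  | extra

namespace SimpsonType

open Simpson Finset

/-- The dimension of the space. -/
def dim : SimpsonType → ℕ
  | hypergeometric m _ => m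
  | even m _ => 2 * m
  | odd m _ => 2 * m + 1
  | extra => 6

/-- The spectral type of `A`. -/
def alpha : (τ : SimpsonType) → Composition τ.dim
  | hypergeometric m hm => ⟨[1, m - 1], by simp; omega, by simp [dim]; omega⟩
  | even m hm => ⟨[m, m], by simp; omega, by simp [dim]; omega⟩
  | odd m hm => ⟨[m + 1, m], by simp; omega, by simp [dim]; omega⟩
  | extra => ⟨[4, 2], by simp, by simp [dim]⟩

/-- The spectral type of `B`. -/
def beta : (τ : SimpsonType) → Composition τ.dim
  | hypergeometric m _ => Composition.ones m
  | even m hm => ⟨[1, m - 1, m], by simp; omega, by simp [dim]; omega⟩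
  | odd m hm => ⟨[1, m, m], by simp; omega, by simp [dim]; omega⟩
  | extra => ⟨[2, 2, 2], by simp, by simp [dim]⟩

/-- The spectral type of `C`. -/
def gamma (τ : SimpsonType) : Composition τ.dim := Composition.ones τ.dim

/-- The distinct eigenvalues `a_1, a_2` in the vector `x`. -/
noncomputable def eigA (τ : SimpsonType) (x : Fin τ.dim → ℂ) : ℕ → ℂ := blockValue τ.alpha x

/-- The distinct eigenvalues `b_1, b_2, …` in the vector `y`. -/
noncomputable def eigB (τ : SimpsonType) (y : Fin τ.dim → ℂ) : ℕ → ℂ := blockValue τ.beta y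

/-- The distinct eigenvalues `c_1, c_2, …` in the vector `z`. -/
noncomputable def eigC (τ : SimpsonType) (z : Fin τ.dim → ℂ) : ℕ → ℂ := blockValue τ.gamma z

/-- The constructed matrix `B` with the prescribed eigenvalues. -/
noncomputable def matBOf : (τ : SimpsonType) → (a b c : ℕ → ℂ) → Matrix (Fin τ.dim) (Fin τ.dim) ℂ
  | hypergeometric m _, a, b, c => ofEntries m (hgB m a b c)
  | even m _, a, b, c => ofEntries (2 * m) (evenB m a b c)
  | odd m _, a, b, c => ofEntries (2 * m + 1) (oddB m a b c)
  | extra, a, b, c => extraB a b c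

/-- The constructed matrix `C` with the prescribed eigenvalues. -/
noncomputable def matCOf : (τ : SimpsonType) → (a b c : ℕ → ℂ) → Matrix (Fin τ.dim) (Fin τ.dim) ℂ
  | hypergeometric m _, a, b, c => ofEntries m (hgC m a b c)
  | even m _, a, b, c => ofEntries (2 * m) (evenC m a b c)
  | odd m _, a, b, c => ofEntries (2 * m + 1) (oddC m a b c)
  | extra, a, b, c => extraC a b c

/-- Numerator of the scalar square `⟨v_i, v_i⟩` (a product of linear forms in the eigenvalues). -/
noncomputable def formNum : SimpsonType → (a b c : ℕ → ℂ) → ℕ → ℂ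
  | hypergeometric m _ => hgNum m
  | even m _ => evenNum m
  | odd m _ => oddNum m
  | extra => extraNum

/-- Denominator of the scalar square `⟨v_i, v_i⟩` (a product of linear forms in the
eigenvalues). -/
noncomputable def formDen : SimpsonType → (a b c : ℕ → ℂ) → ℕ → ℂ
  | hypergeometric m _ => hgDen m
  | even m _ => evenDen m
  | odd m _ => oddDen m
  | extra => extraDen

/-- `S'`: the zero levels of the linear forms in the denominators of `⟨v_i, v_i⟩` are removed. -/
def SPrime (τ : SimpsonType) : Set ((Fin τ.dim → ℂ) × (Fin τ.dim → ℂ) × (Fin τ.dim → ℂ)) :=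
  {s | s ∈ S τ.alpha τ.beta τ.gamma ∧
    ∀ i ∈ Icc 1 τ.dim, τ.formDen (τ.eigA s.1) (τ.eigB s.2.1) (τ.eigC s.2.2) i ≠ 0}

/-- `S''`: the zero levels of the linear forms in the numerators of `⟨v_i, v_i⟩` are removed
as well. -/
def SDoublePrime (τ : SimpsonType) :
    Set ((Fin τ.dim → ℂ) × (Fin τ.dim → ℂ) × (Fin τ.dim → ℂ)) :=
  {s | s ∈ τ.SPrime ∧
    ∀ i ∈ Icc 1 τ.dim, τ.formNum (τ.eigA s.1) (τ.eigB s.2.1) (τ.eigC s.2.2) i ≠ 0}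

/-- The constructed matrix `B` for the triple of spectra `(x, y, z)`. -/
noncomputable def matB (τ : SimpsonType) (x y z : Fin τ.dim → ℂ) :
    Matrix (Fin τ.dim) (Fin τ.dim) ℂ :=
  τ.matBOf (τ.eigA x) (τ.eigB y) (τ.eigC z)

/-- The constructed matrix `C` for the triple of spectra `(x, y, z)`. -/
noncomputable def matC (τ : SimpsonType) (x y z : Fin τ.dim → ℂ) :
    Matrix (Fin τ.dim) (Fin τ.dim) ℂ :=
  τ.matCOf (τ.eigA x) (τ.eigB y) (τ.eigC z)

/-- The constructed matrix `A = B + C` for the triple of spectra `(x, y, z)`. -/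
noncomputable def matA (τ : SimpsonType) (x y z : Fin τ.dim → ℂ) :
    Matrix (Fin τ.dim) (Fin τ.dim) ℂ :=
  τ.matB x y z + τ.matC x y z

end SimpsonType

/-! Irreducibility is read off from eigenvalue multiplicities alone. If `B` and `C` act irreducibly
on an `n`-dimensional space and `A = B + C`, then the trace form and Schur's lemma bound the sum of
the dimensions of the centralizers of `A`, `B`, `C` by `n² + 2` (`IsIrreducible.finrank_ker_ad`).
For a diagonalizable operator the centralizer has dimension at least the sum of the squared
multiplicities. Hence the multiplicities on an irreducible factor satisfy a quadratic bound as well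
as the trace relation; such vectors are called `Admissible`. Diagonalizability passes to subspaces
and quotients, and multiplicities add up along a composition series, so a reducible triple would
split its spectral type into at least two admissible vectors (`exists_list_admissible`).

Such a splitting is impossible on `S''`. The quadratic bound leaves very few shapes for suitably
chosen summands, and the trace relation of a summand of such a shape says that one of the linear
forms in the numerators or denominators vanishes. In the even and odd families this pins down all
summands except the one that carries `b₁`, and that one then violates the quadratic bound
(`false_of_hypergeometric`, `false_of_even`, `false_of_odd`, `false_of_extra`).

It remains to see that the constructed matrices are diagonalizable with the prescribed
multiplicities. For `B` and `C` this follows from triangularity. For `A` the point is `(A - a₁)(A -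
a₂) = 0`; the trace then fixes the two multiplicities (`mult_of_trace`). In the hypergeometric
family `A - a₂` has equal columns. In the even and odd families `A` becomes, after relabelling, a
bordered matrix with Cauchy off-diagonal blocks, and the quadratic relation reduces to Lagrange
interpolation (`cauchy_quadratic_of_lagrange`). In the extra case it is a polynomial identity in six
independent parameters (`extraA_quadratic`). -/

open Module Polynomial

namespace Simpson

/-! ### Diagonalizable operators: multiplicities, subquotients, centralizers -/

section Spectrum

variable {V : Type*} [AddCommGroup V] [Module ℂ V]

/-- `T` is annihilated by the polynomial with the simple roots `l i`. -/
def KilledBy {ι : Type*} [Fintype ι] (T : End ℂ V) (l : ι → ℂ) : Prop :=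
  aeval T (∏ i, (X - C (l i))) = 0

/-- The dimension of the eigenspace of `T` for the eigenvalue `μ`. -/
noncomputable def mult (T : End ℂ V) (μ : ℂ) : ℕ := finrank ℂ (T.eigenspace μ)

lemma aeval_restrict_apply (T : End ℂ V) {W : Submodule ℂ V} (hW : ∀ w ∈ W, T w ∈ W)
    (P : ℂ[X]) (w : W) : ((aeval (T.restrict hW) P w : W) : V) = aeval T P w := by
  induction P using Polynomial.induction_on' with
  | add P Q hP hQ => simp [hP, hQ]
  | monomial n a =>
    have : ∀ w : W, (((T.restrict hW) ^ n) w : V) = (T ^ n) w := by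
      induction n with
      | zero => simp
      | succ n ih => intro w; simp [pow_succ, ih]
    simp [aeval_monomial, this, Algebra.algebraMap_eq_smul_one]

lemma aeval_mapQ_mk (T : End ℂ V) {W : Submodule ℂ V} (hW : W ≤ W.comap T)
    (P : ℂ[X]) (v : V) : aeval (W.mapQ W T hW) P (W.mkQ v) = W.mkQ (aeval T P v) := by
  induction P using Polynomial.induction_on' with
  | add P Q hP hQ => simp_all
  | monomial n a =>
    have : ∀ v : V, ((W.mapQ W T hW) ^ n) (W.mkQ v) = W.mkQ ((T ^ n) v) := by
      induction n with
      | zero => simp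
      | succ n ih => intro w; simpa [pow_succ] using ih (T w)
    simp only [aeval_monomial, Algebra.algebraMap_eq_smul_one, smul_mul_assoc, one_mul,
      LinearMap.smul_apply, this, map_smul]

variable {ι : Type*} [Fintype ι] {l : ι → ℂ}

lemma KilledBy.restrict {T : End ℂ V} (h : KilledBy T l) {W : Submodule ℂ V}
    (hW : ∀ w ∈ W, T w ∈ W) : KilledBy (T.restrict hW) l := by
  refine LinearMap.ext fun w => Subtype.ext ?_
  rw [aeval_restrict_apply, h]; simp

lemma KilledBy.mapQ {T : End ℂ V} (h : KilledBy T l) {W : Submodule ℂ V}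
    (hW : W ≤ W.comap T) : KilledBy (W.mapQ W T hW) l := by
  refine LinearMap.ext fun v => ?_
  obtain ⟨v, rfl⟩ := W.mkQ_surjective v
  rw [aeval_mapQ_mk, h]; simp

lemma KilledBy.isSemisimple {T : End ℂ V} (h : KilledBy T l) (hl : Function.Injective l) :
    T.IsSemisimple := by
  refine Module.End.isSemisimple_of_squarefree_aeval_eq_zero (Polynomial.Separable.squarefree ?_) h
  exact Polynomial.separable_prod_X_sub_C_iff.mpr hl

lemma KilledBy.eq_of_hasEigenvalue {T : End ℂ V} (h : KilledBy T l) {μ : ℂ}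
    (hμ : T.HasEigenvalue μ) : ∃ i, l i = μ := by
  obtain ⟨v, hv⟩ := hμ.exists_hasEigenvector
  have h1 := Module.End.aeval_apply_of_hasEigenvector (p := ∏ i, (X - C (l i))) hv
  rw [h, eval_prod] at h1
  have h2 := (smul_eq_zero.mp h1.symm).resolve_right hv.2
  obtain ⟨i, -, hi⟩ := Finset.prod_eq_zero_iff.mp h2
  exact ⟨i, by simpa [sub_eq_zero, eq_comm] using hi⟩

/-- Commutation with `T`, as a linear operator. -/
noncomputable def ad (T : End ℂ V) : End ℂ V →ₗ[ℂ] End ℂ V :=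
  LinearMap.mulLeft ℂ T - LinearMap.mulRight ℂ T

lemma ad_apply (T Z : End ℂ V) : ad T Z = T * Z - Z * T := rfl

variable [FiniteDimensional ℂ V]

lemma KilledBy.isInternal [DecidableEq ι] {T : End ℂ V} (h : KilledBy T l)
    (hl : Function.Injective l) : DirectSum.IsInternal fun i => T.eigenspace (l i) := by
  rw [DirectSum.isInternal_submodule_iff_iSupIndep_and_iSup_eq_top]
  refine ⟨T.eigenspaces_iSupIndep.comp hl, ?_⟩
  rw [eq_top_iff, ← (h.isSemisimple hl).iSup_eigenspace_eq_top]
  refine iSup_le fun μ => ?_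
  by_cases hμ : T.HasEigenvalue μ
  · obtain ⟨i, rfl⟩ := h.eq_of_hasEigenvalue hμ
    exact le_iSup (fun i => T.eigenspace (l i)) i
  · rw [Module.End.hasEigenvalue_iff, not_not] at hμ
    simp [hμ]

lemma KilledBy.sum_mult {T : End ℂ V} (h : KilledBy T l) (hl : Function.Injective l) :
    ∑ i, mult T (l i) = finrank ℂ V := by
  classical
  have e := LinearEquiv.ofBijective (DirectSum.coeLinearMap fun i => T.eigenspace (l i))
    (h.isInternal hl)
  rw [← e.finrank_eq, finrank_directSum]
  rfl

lemma KilledBy.trace_eq {T : End ℂ V} (h : KilledBy T l) (hl : Function.Injective l) :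
    LinearMap.trace ℂ V T = ∑ i, mult T (l i) * l i := by
  classical
  have hm : ∀ i, Set.MapsTo T (T.eigenspace (l i)) (T.eigenspace (l i)) := fun i v hv => by
    have := Module.End.mem_eigenspace_iff.mp hv
    rw [this]
    exact Submodule.smul_mem _ _ hv
  rw [LinearMap.trace_eq_sum_trace_restrict (h.isInternal hl) hm]
  refine Finset.sum_congr rfl fun i _ => ?_
  have : T.restrict (hm i) = l i • LinearMap.id := by
    refine LinearMap.ext fun v => Subtype.ext ?_
    exact Module.End.mem_eigenspace_iff.mp v.2
  rw [this, map_smul, LinearMap.trace_id, smul_eq_mul, mul_comm, mult]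

/-- The quotient map sends eigenvectors to eigenvectors or zero, and the kernel of the induced map
on eigenspaces consists of eigenvectors lying in `W`. -/
lemma mult_le (T : End ℂ V) {W : Submodule ℂ V} (hW : ∀ w ∈ W, T w ∈ W) (μ : ℂ) :
    mult T μ ≤ mult (T.restrict hW) μ + mult (W.mapQ W T hW) μ := by
  let f : T.eigenspace μ →ₗ[ℂ] End.eigenspace (W.mapQ W T hW) μ :=
    LinearMap.restrict W.mkQ (p := T.eigenspace μ) (q := End.eigenspace (W.mapQ W T hW) μ) (by
      intro v hv
      rw [Module.End.mem_eigenspace_iff] at hv ⊢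
      rw [← map_smul, ← hv]; rfl)
  let g : LinearMap.ker f →ₗ[ℂ] End.eigenspace (T.restrict hW) μ :=
    { toFun := fun v => ⟨⟨v.1.1, by
        have := congrArg Subtype.val (LinearMap.mem_ker.mp v.2)
        exact (Submodule.Quotient.mk_eq_zero W).mp this⟩, by
          rw [Module.End.mem_eigenspace_iff]
          exact Subtype.ext (Module.End.mem_eigenspace_iff.mp v.1.2)⟩
      map_add' := fun _ _ => rfl
      map_smul' := fun _ _ => rfl }
  have hg : Function.Injective g := fun v w hvw => by
    have := congrArg (fun x => (x.1.1 : V)) hvw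
    exact Subtype.ext (Subtype.ext this)
  have h1 := LinearMap.finrank_le_finrank_of_injective hg
  have h2 := f.finrank_range_add_finrank_ker
  have h3 := Submodule.finrank_le (LinearMap.range f)
  unfold mult
  omega

/-- Termwise there is only an inequality, but both sides have the same total, the dimension of `V`,
so every inequality is an equality. -/
lemma KilledBy.mult_add {T : End ℂ V} (h : KilledBy T l) (hl : Function.Injective l)
    {W : Submodule ℂ V} (hW : ∀ w ∈ W, T w ∈ W) (i : ι) :
    mult (T.restrict hW) (l i) + mult (W.mapQ W T hW) (l i) = mult T (l i) := by
  have h1 := h.sum_mult hl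
  have h2 := (h.restrict hW).sum_mult hl
  have h3 := (h.mapQ (W := W) hW).sum_mult hl
  have h4 := W.finrank_quotient_add_finrank
  have h5 : ∑ i, mult T (l i) =
      ∑ i, (mult (T.restrict hW) (l i) + mult (W.mapQ W T hW) (l i)) := by
    rw [Finset.sum_add_distrib]; omega
  exact ((Finset.sum_eq_sum_iff_of_le fun i _ => mult_le T hW (l i)).mp h5 i
    (Finset.mem_univ i)).symm

/-- In an eigenbasis `T` is scalar on each block, so it commutes with all block diagonal matrices.
-/
lemma sum_sq_le_finrank_ker_ad [DecidableEq ι] {T : End ℂ V} {d : ι → ℕ}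
    (b : Basis ((i : ι) × Fin (d i)) ℂ V) (hb : ∀ k, T (b k) = l k.1 • b k) :
    ∑ i, d i ^ 2 ≤ finrank ℂ (LinearMap.ker (ad T)) := by
  have hT : T = Matrix.toLin b b (Matrix.blockDiagonal' fun i => l i • 1) := by
    refine b.ext fun k => ?_
    rw [hb, Matrix.toLin_self, Finset.sum_eq_single k]
    · simp [Matrix.blockDiagonal'_apply]
    · rintro ⟨i, x⟩ - hik
      obtain ⟨j, y⟩ := k
      by_cases hij : i = j
      · subst hij
        have : x ≠ y := fun hxy => hik (by rw [hxy])
        simp [Matrix.blockDiagonal'_apply, this]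
      · rw [Matrix.blockDiagonal'_apply_ne _ _ _ hij, zero_smul]
    · simp
  let G : ((i : ι) → Matrix (Fin (d i)) (Fin (d i)) ℂ) →ₗ[ℂ] LinearMap.ker (ad T) :=
    { toFun := fun M => ⟨Matrix.toLin b b (Matrix.blockDiagonal' M), by
        rw [LinearMap.mem_ker, ad_apply, sub_eq_zero, hT]
        simp only [Module.End.mul_eq_comp]
        rw [← Matrix.toLin_mul, ← Matrix.toLin_mul, ← Matrix.blockDiagonal'_mul,
          ← Matrix.blockDiagonal'_mul]
        simp⟩
      map_add' := fun M N => Subtype.ext (by simp [Matrix.blockDiagonal'_add])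
      map_smul' := fun r M => Subtype.ext (by simp [Matrix.blockDiagonal'_smul]) }
  have hG : Function.Injective G := fun M N hMN => by
    have := congrArg Subtype.val hMN
    exact Matrix.blockDiagonal'_injective ((Matrix.toLin b b).injective this)
  have := LinearMap.finrank_le_finrank_of_injective hG
  rw [finrank_pi_fintype] at this
  simpa [finrank_matrix, sq] using this

lemma KilledBy.sum_mult_sq_le {T : End ℂ V} (h : KilledBy T l) (hl : Function.Injective l) :
    ∑ i, mult T (l i) ^ 2 ≤ finrank ℂ (LinearMap.ker (ad T)) := by
  classical
  have hint := h.isInternal hl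
  exact sum_sq_le_finrank_ker_ad (hint.collectedBasis fun i => finBasis ℂ (T.eigenspace (l i)))
    fun k => Module.End.mem_eigenspace_iff.mp (hint.collectedBasis_mem _ k)

end Spectrum

/-! ### The dimension bound for centralizers of an irreducible triple -/

section Scott

variable {V : Type*} [AddCommGroup V] [Module ℂ V]

/-- The only subspaces preserved by both operators are `0` and the whole space. -/
def IsIrreducible (B C : End ℂ V) : Prop :=
  ∀ W : Submodule ℂ V, (∀ w ∈ W, B w ∈ W) → (∀ w ∈ W, C w ∈ W) → W = ⊥ ∨ W = ⊤

/-- Skewness of `ad T` for the trace form: whatever is orthogonal to the range of `ad T` commutes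
with `T`. -/
lemma trace_mul_ad (T X Z : End ℂ V) :
    LinearMap.trace ℂ V (Z * ad T X) = - LinearMap.trace ℂ V (ad T Z * X) := by
  have := LinearMap.trace_mul_cycle ℂ Z X T
  simp only [ad_apply, mul_sub, sub_mul, map_sub, ← mul_assoc]
  rw [this]
  ring

variable [FiniteDimensional ℂ V]

/-- Schur's lemma: an eigenspace of `Z` is stable under `B` and `C`. -/
lemma IsIrreducible.eq_smul_one [Nontrivial V] {B C Z : End ℂ V} (h : IsIrreducible B C)
    (hB : ad B Z = 0) (hC : ad C Z = 0) : ∃ μ : ℂ, Z = μ • 1 := by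
  obtain ⟨μ, hμ⟩ := Module.End.exists_eigenvalue Z
  have key : ∀ T : End ℂ V, ad T Z = 0 → ∀ w ∈ Z.eigenspace μ, T w ∈ Z.eigenspace μ := by
    intro T hT w hw
    rw [ad_apply, sub_eq_zero] at hT
    rw [Module.End.mem_eigenspace_iff] at hw ⊢
    rw [← Module.End.mul_apply, ← hT, Module.End.mul_apply, hw, map_smul]
  refine ⟨μ, LinearMap.ext fun v => ?_⟩
  have := (h _ (key B hB) (key C hC)).resolve_left hμ
  simpa using Module.End.mem_eigenspace_iff.mp (this ▸ Submodule.mem_top : v ∈ Z.eigenspace μ)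

lemma eq_zero_of_forall_trace_mul {Z : End ℂ V}
    (h : ∀ X : End ℂ V, LinearMap.trace ℂ V (Z * X) = 0) : Z = 0 := by
  refine LinearMap.ext fun v => (Module.forall_dual_apply_eq_zero_iff ℂ (Z v)).mp fun f => ?_
  have h1 : Z * f.smulRight v = f.smulRight (Z v) := LinearMap.ext fun w => by simp
  simpa [h1] using h (f.smulRight v)

/-- By nondegeneracy of the trace form, the annihilator of the sum of the two ranges is the common
centralizer of `B` and `C`, which is at most a line by Schur's lemma. -/
lemma IsIrreducible.finrank_range_ad_sup [Nontrivial V] {B C : End ℂ V}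
    (h : IsIrreducible B C) :
    finrank ℂ (End ℂ V) ≤
      finrank ℂ (LinearMap.range (ad B) ⊔ LinearMap.range (ad C) : Submodule ℂ (End ℂ V)) + 1 := by
  set U : Submodule ℂ (End ℂ V) := LinearMap.range (ad B) ⊔ LinearMap.range (ad C)
  let τ : End ℂ V →ₗ[ℂ] Dual ℂ (End ℂ V) := (LinearMap.mul ℂ (End ℂ V)).compr₂ (LinearMap.trace ℂ V)
  have hτ : ∀ Z X, τ Z X = LinearMap.trace ℂ V (Z * X) := fun _ _ => rfl
  have hinj : Function.Injective τ := by
    rw [← LinearMap.ker_eq_bot, LinearMap.ker_eq_bot']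
    exact fun Z hZ => eq_zero_of_forall_trace_mul fun X => by rw [← hτ, hZ]; rfl
  have hsurj : Function.Surjective τ :=
    (LinearMap.injective_iff_surjective_of_finrank_eq_finrank
      (Subspace.dual_finrank_eq (K := ℂ) (V := End ℂ V)).symm).mp hinj
  have hle : U.dualAnnihilator ≤ Submodule.span ℂ {τ 1} := by
    intro φ hφ
    obtain ⟨Z, rfl⟩ := hsurj φ
    rw [Submodule.mem_dualAnnihilator] at hφ
    have key : ∀ T : End ℂ V, LinearMap.range (ad T) ≤ U → ad T Z = 0 := fun T hT =>
      eq_zero_of_forall_trace_mul fun X => by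
        have := hφ _ (hT ⟨X, rfl⟩)
        rwa [hτ, trace_mul_ad, neg_eq_zero] at this
    obtain ⟨μ, rfl⟩ := h.eq_smul_one (key B le_sup_left) (key C le_sup_right)
    rw [map_smul]
    exact Submodule.smul_mem _ _ (Submodule.mem_span_singleton_self _)
  have h1 := Submodule.finrank_mono hle
  have h2 := finrank_span_le_card (R := ℂ) ({τ 1} : Set (Dual ℂ (End ℂ V)))
  have h3 := Subspace.finrank_add_finrank_dualAnnihilator_eq U
  simp at h2
  omega

/-- An additive form of Scott's inequality. The map `X ↦ (ad B X, ad C X)` has only scalars in its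
kernel, and the two ranges together have codimension at most one; both facts enter a dimension count
inside `End V × End V`, linked by `ad A = ad B + ad C`. -/
lemma IsIrreducible.finrank_ker_ad [Nontrivial V] {A B C : End ℂ V} (hA : A = B + C)
    (h : IsIrreducible B C) :
    finrank ℂ (LinearMap.ker (ad A)) + finrank ℂ (LinearMap.ker (ad B)) +
      finrank ℂ (LinearMap.ker (ad C)) ≤ finrank ℂ V ^ 2 + 2 := by
  have hN : finrank ℂ (End ℂ V) = finrank ℂ V ^ 2 := by rw [finrank_linearMap, sq]
  have hU := h.finrank_range_ad_sup
  have hadd : ∀ X, ad A X = ad B X + ad C X := fun X => by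
    simp only [ad_apply, hA]; noncomm_ring
  let Ψ : End ℂ V →ₗ[ℂ] End ℂ V × End ℂ V := (ad B).prod (ad C)
  have hΨ : finrank ℂ (LinearMap.ker Ψ) ≤ 1 := by
    have hle : LinearMap.ker Ψ ≤ Submodule.span ℂ {1} := by
      intro Z hZ
      rw [LinearMap.mem_ker] at hZ
      obtain ⟨μ, rfl⟩ := h.eq_smul_one (congrArg Prod.fst hZ) (congrArg Prod.snd hZ)
      exact Submodule.smul_mem _ _ (Submodule.mem_span_singleton_self _)
    have h1 := Submodule.finrank_mono hle
    have h2 := finrank_span_le_card (R := ℂ) ({1} : Set (End ℂ V))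
    simp at h2
    omega
  have hΨ' := Ψ.finrank_range_add_finrank_ker
  let P : Submodule ℂ (End ℂ V × End ℂ V) :=
    (LinearMap.range (ad B)).prod (LinearMap.range (ad C))
  let s : End ℂ V × End ℂ V →ₗ[ℂ] End ℂ V := LinearMap.fst ℂ _ _ + LinearMap.snd ℂ _ _
  let Q : Submodule ℂ (End ℂ V × End ℂ V) := (LinearMap.range (ad A)).comap s
  have hs : Function.Surjective s := fun X => ⟨(X, 0), by simp [s]⟩
  have hcomap : ∀ R : Submodule ℂ (End ℂ V),
      finrank ℂ (R.comap s) = finrank ℂ R + finrank ℂ (End ℂ V) := by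
    intro R
    have h1 := (R.mkQ ∘ₗ s).finrank_range_add_finrank_ker
    have h2 : LinearMap.range (R.mkQ ∘ₗ s) = ⊤ :=
      LinearMap.range_eq_top.mpr (R.mkQ_surjective.comp hs)
    rw [LinearMap.ker_comp, Submodule.ker_mkQ, h2, finrank_top, finrank_prod] at h1
    have h3 := R.finrank_quotient_add_finrank
    omega
  have hP : finrank ℂ P =
      finrank ℂ (LinearMap.range (ad B)) + finrank ℂ (LinearMap.range (ad C)) := by
    rw [← finrank_prod]
    exact LinearEquiv.finrank_eq
      { toFun := fun x => (⟨x.1.1, x.2.1⟩, ⟨x.1.2, x.2.2⟩)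
        invFun := fun x => ⟨(x.1.1, x.2.1), x.1.2, x.2.2⟩
        map_add' := fun _ _ => rfl
        map_smul' := fun _ _ => rfl }
  have hinf : LinearMap.range Ψ ≤ P ⊓ Q := by
    rintro _ ⟨X, rfl⟩
    exact ⟨⟨⟨X, rfl⟩, ⟨X, rfl⟩⟩, X, hadd X⟩
  have hsup : (LinearMap.range (ad B) ⊔ LinearMap.range (ad C)).comap s ≤ P ⊔ Q := by
    intro x hx
    obtain ⟨y, hy, z, hz, hyz⟩ := Submodule.mem_sup.mp (Submodule.mem_comap.mp hx)
    have h1 : ((y, z) : End ℂ V × End ℂ V) ∈ P := ⟨hy, hz⟩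
    have h2 : x - (y, z) ∈ Q := by
      rw [Submodule.mem_comap, map_sub, ← hyz]
      simp [s]
    simpa using add_mem (Submodule.mem_sup_left h1 : _ ∈ P ⊔ Q) (Submodule.mem_sup_right h2)
  -- With `N = dim End V` and `rA`, `rB`, `rC` the ranks of `ad A`, `ad B`, `ad C`: `P ⊓ Q` has
  -- dimension at least `N - 1`, `P ⊔ Q` at least `2N - 1`, and `dim P + dim Q = rA + rB + rC + N`.
  -- Hence the three ranks sum to at least `2N - 2` and the three kernels to at most `N + 2`.
  have e1 := Submodule.finrank_sup_add_finrank_inf_eq P Q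
  have e2 := Submodule.finrank_mono hinf
  have e3 := Submodule.finrank_mono hsup
  rw [hcomap] at e3
  have e4 : finrank ℂ Q = _ := hcomap _
  have rA := (ad A).finrank_range_add_finrank_ker
  have rB := (ad B).finrank_range_add_finrank_ker
  have rC := (ad C).finrank_range_add_finrank_ker
  omega

variable {ι κ ν : Type*} [Fintype ι] [Fintype κ] [Fintype ν] {a : ι → ℂ} {b : κ → ℂ} {c : ν → ℂ}

lemma IsIrreducible.sum_mult_sq_le [Nontrivial V] {A B C : End ℂ V} (hA : A = B + C)
    (h : IsIrreducible B C) (ha : Function.Injective a) (hb : Function.Injective b)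
    (hc : Function.Injective c) (kA : KilledBy A a) (kB : KilledBy B b) (kC : KilledBy C c) :
    ∑ i, mult A (a i) ^ 2 + ∑ i, mult B (b i) ^ 2 + ∑ i, mult C (c i) ^ 2 ≤
      finrank ℂ V ^ 2 + 2 := by
  have := h.finrank_ker_ad hA
  have := kA.sum_mult_sq_le ha
  have := kB.sum_mult_sq_le hb
  have := kC.sum_mult_sq_le hc
  omega

end Scott

/-! ### Multiplicity vectors of composition factors -/

section DimensionVectors

variable {ι κ ν : Type*} [Fintype ι] [Fintype κ] [Fintype ν]

/-- Conditions on the multiplicities of the eigenvalues `a`, `b`, `c` of `B + C`, `B`, `C`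
that hold for irreducible pairs of diagonalizable operators on a nonzero space. -/
structure Admissible (a : ι → ℂ) (b : κ → ℂ) (c : ν → ℂ)
    (t : (ι → ℕ) × (κ → ℕ) × (ν → ℕ)) : Prop where
  pos : 0 < ∑ i, t.1 i
  sum_snd : ∑ i, t.2.1 i = ∑ i, t.1 i
  sum_thd : ∑ i, t.2.2 i = ∑ i, t.1 i
  trace : ∑ i, t.1 i * a i = ∑ i, t.2.1 i * b i + ∑ i, t.2.2 i * c i
  norm : ∑ i, t.1 i ^ 2 + ∑ i, t.2.1 i ^ 2 + ∑ i, t.2.2 i ^ 2 ≤ (∑ i, t.1 i) ^ 2 + 2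

variable {a : ι → ℂ} {b : κ → ℂ} {c : ν → ℂ}

/-- The multiplicities of the eigenvalues of `B + C`, `B` and `C`. -/
noncomputable def mults {V : Type*} [AddCommGroup V] [Module ℂ V] (a : ι → ℂ) (b : κ → ℂ)
    (c : ν → ℂ) (B C : End ℂ V) : (ι → ℕ) × (κ → ℕ) × (ν → ℕ) :=
  (fun i => mult (B + C) (a i), fun i => mult B (b i), fun i => mult C (c i))

lemma admissible_mults {V : Type*} [AddCommGroup V] [Module ℂ V] [FiniteDimensional ℂ V]
    [Nontrivial V] {B C : End ℂ V} (h : IsIrreducible B C) (ha : Function.Injective a)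
    (hb : Function.Injective b) (hc : Function.Injective c) (kA : KilledBy (B + C) a)
    (kB : KilledBy B b) (kC : KilledBy C c) : Admissible a b c (mults a b c B C) := by
  have hA := kA.sum_mult ha
  have hB := kB.sum_mult hb
  have hC := kC.sum_mult hc
  refine ⟨?_, ?_, ?_, ?_, ?_⟩
  · simpa [mults, hA] using finrank_pos (R := ℂ) (M := V)
  · simp only [mults, hA, hB]
  · simp only [mults, hA, hC]
  · simp only [mults]
    rw [← kA.trace_eq ha, ← kB.trace_eq hb, ← kC.trace_eq hc, map_add]
  · have := h.sum_mult_sq_le rfl ha hb hc kA kB kC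
    simpa only [mults, hA] using this

lemma mults_restrict_add_mults_mapQ {V : Type*} [AddCommGroup V] [Module ℂ V]
    [FiniteDimensional ℂ V] {B C : End ℂ V} (ha : Function.Injective a)
    (hb : Function.Injective b) (hc : Function.Injective c) (kA : KilledBy (B + C) a)
    (kB : KilledBy B b) (kC : KilledBy C c) {W : Submodule ℂ V} (hBW : ∀ w ∈ W, B w ∈ W)
    (hCW : ∀ w ∈ W, C w ∈ W) :
    mults a b c (B.restrict hBW) (C.restrict hCW) +
      mults a b c (W.mapQ W B hBW) (W.mapQ W C hCW) = mults a b c B C := by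
  have hAW : ∀ w ∈ W, (B + C) w ∈ W := fun w hw => add_mem (hBW w hw) (hCW w hw)
  have e : W.mapQ W B hBW + W.mapQ W C hCW = W.mapQ W (B + C) hAW :=
    LinearMap.ext fun v => by obtain ⟨v, rfl⟩ := W.mkQ_surjective v; rfl
  have e' : B.restrict hBW + C.restrict hCW = (B + C).restrict hAW := rfl
  refine Prod.ext (funext fun i => ?_) (Prod.ext (funext fun i => ?_) (funext fun i => ?_))
  · simp only [mults, Prod.fst_add, Pi.add_apply, e, e']
    exact kA.mult_add ha hAW i
  · exact kB.mult_add hb hBW i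
  · exact kC.mult_add hc hCW i

/-- The multiplicities are sums of the multiplicities on the composition factors, and a reducible
pair has at least two composition factors. -/
lemma exists_list_admissible (ha : Function.Injective a) (hb : Function.Injective b)
    (hc : Function.Injective c) (n : ℕ) : ∀ (V : Type) [AddCommGroup V] [Module ℂ V]
    [FiniteDimensional ℂ V] [Nontrivial V] (B C : End ℂ V), finrank ℂ V = n →
    KilledBy (B + C) a → KilledBy B b → KilledBy C c →
    ∃ L : List ((ι → ℕ) × (κ → ℕ) × (ν → ℕ)), L ≠ [] ∧ (¬ IsIrreducible B C → 2 ≤ L.length) ∧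
      (∀ t ∈ L, Admissible a b c t) ∧ L.sum = mults a b c B C := by
  induction n using Nat.strong_induction_on with
  | _ n ih =>
  intro V _ _ _ _ B C hn kA kB kC
  by_cases h : IsIrreducible B C
  · exact ⟨[mults a b c B C], by simp, fun h' => absurd h h', by
      simpa using admissible_mults h ha hb hc kA kB kC, by simp⟩
  have h' := h
  simp only [IsIrreducible, not_forall, not_or] at h'
  obtain ⟨W, hBW, hCW, hbot, htop⟩ := h'
  have hAW : ∀ w ∈ W, (B + C) w ∈ W := fun w hw => add_mem (hBW w hw) (hCW w hw)
  have e : W.mapQ W B hBW + W.mapQ W C hCW = W.mapQ W (B + C) hAW :=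
    LinearMap.ext fun v => by obtain ⟨v, rfl⟩ := W.mkQ_surjective v; rfl
  have : Nontrivial W := Submodule.nontrivial_iff_ne_bot.mpr hbot
  have : Nontrivial (V ⧸ W) := Submodule.Quotient.nontrivial_iff.mpr htop
  have h1 := W.finrank_quotient_add_finrank
  have h2 := finrank_pos (R := ℂ) (M := W)
  have h3 := finrank_pos (R := ℂ) (M := V ⧸ W)
  obtain ⟨L₁, n₁, -, hL₁, s₁⟩ := ih (finrank ℂ W) (by omega) W (B.restrict hBW) (C.restrict hCW)
    rfl (kA.restrict hAW) (kB.restrict hBW) (kC.restrict hCW)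
  obtain ⟨L₂, n₂, -, hL₂, s₂⟩ := ih (finrank ℂ (V ⧸ W)) (by omega) (V ⧸ W) (W.mapQ W B hBW)
    (W.mapQ W C hCW) rfl (e ▸ kA.mapQ hAW) (kB.mapQ hBW) (kC.mapQ hCW)
  -- Nonemptiness of both lists is what makes the length at least two in the reducible case.
  refine ⟨L₁ ++ L₂, by simp [n₁], fun _ => ?_, ?_, ?_⟩
  · have := List.length_pos_iff.mpr n₁
    have := List.length_pos_iff.mpr n₂
    rw [List.length_append]; omega
  · intro t ht
    exact (List.mem_append.mp ht).elim (hL₁ t) (hL₂ t)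
  · rw [List.sum_append, s₁, s₂, mults_restrict_add_mults_mapQ ha hb hc kA kB kC]

end DimensionVectors

/-! ### Impossibility of splitting the spectral types -/

section Counting

variable {ι κ ν : Type*}

lemma list_sum_induction {M : Type*} [AddMonoid M] {P : M → Prop} (h0 : P 0)
    (hadd : ∀ x y, P x → P y → P (x + y)) (L : List M) (hL : ∀ t ∈ L, P t) : P L.sum := by
  induction L with
  | nil => simpa
  | cons t L ih =>
    rw [List.sum_cons]
    exact hadd _ _ (hL t (by simp)) (ih fun s hs => hL s (by simp [hs]))

lemma le_list_sum {L : List ((ι → ℕ) × (κ → ℕ) × (ν → ℕ))} {t} (ht : t ∈ L) : t ≤ L.sum :=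
  List.le_sum_of_mem ht

/-- Used for the eigenvalue `b₁` of multiplicity one in the even and odd families: it singles out
the one composition factor that carries it. -/
lemma exists_perm_cons_of_sum_eq_one {L : List ((ι → ℕ) × (κ → ℕ) × (ν → ℕ))} {k : κ}
    (h : L.sum.2.1 k = 1) :
    ∃ u L', L.Perm (u :: L') ∧ u.2.1 k = 1 ∧ ∀ t ∈ L', t.2.1 k = 0 := by
  classical
  have : ∃ u ∈ L, u.2.1 k ≠ 0 := by
    by_contra! hcon
    have := list_sum_induction (P := fun t => t.2.1 k = 0) rfl
      (fun x y hx hy => by simp [hx, hy]) L hcon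
    omega
  obtain ⟨u, hu, hk⟩ := this
  have hp := List.perm_cons_erase hu
  refine ⟨u, L.erase u, hp, ?_, fun t ht => ?_⟩
  · have : u.2.1 k ≤ L.sum.2.1 k := (le_list_sum hu).2.1 k
    omega
  · have h1 : t.2.1 k ≤ (L.erase u).sum.2.1 k := (le_list_sum ht).2.1 k
    rw [hp.sum_eq, List.sum_cons] at h
    simp at h
    omega

variable [Fintype κ] [Fintype ν]

/-- Turns multiplicities of a simple spectrum into a subset of indices; for values 0 and 1 the sum
of squares is just the sum. -/
lemma exists_finset_of_le_one (h : ν → ℕ) (h1 : ∀ i, h i ≤ 1) (c : ν → ℂ) :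
    ∃ s : Finset ν, s.card = ∑ i, h i ∧ ∑ i, h i * c i = ∑ i ∈ s, c i ∧
      ∑ i, h i ^ 2 = ∑ i, h i := by
  have h2 : ∀ i, h i = 0 ∨ h i = 1 := fun i => Nat.le_one_iff_eq_zero_or_eq_one.mp (h1 i)
  refine ⟨Finset.univ.filter fun i => h i = 1, ?_, ?_, ?_⟩
  · rw [Finset.card_filter]
    exact Finset.sum_congr rfl fun i _ => by rcases h2 i with h | h <;> simp [h]
  · rw [Finset.sum_filter]
    exact Finset.sum_congr rfl fun i _ => by rcases h2 i with h | h <;> simp [h]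
  · exact Finset.sum_congr rfl fun i _ => by rcases h2 i with h | h <;> simp [h]

variable {c : ν → ℂ}

/-- A factor without `a₁` must be one-dimensional, and its trace relation is then `a₂ = b i + c j`,
which is excluded. So every factor contains `a₁`, whose multiplicity is only one. -/
lemma false_of_hypergeometric {m : ℕ} {a₁ a₂ : ℂ} {b : κ → ℂ}
    (hp : ∀ i j, b i + c j - a₂ ≠ 0) (L : List ((Fin 2 → ℕ) × (κ → ℕ) × (ν → ℕ)))
    (hL : ∀ t ∈ L, Admissible ![a₁, a₂] b c t) (h2 : 2 ≤ L.length)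
    (hs : L.sum = (![1, m - 1], fun _ => 1, fun _ => 1)) : False := by
  have key : ∀ t ∈ L, t.1 0 ≠ 0 := by
    intro t ht h0
    have hle := le_list_sum ht
    rw [hs] at hle
    obtain ⟨s, hs1, hs2, hs3⟩ := exists_finset_of_le_one t.2.1 (fun i => hle.2.1 i) b
    obtain ⟨r, hr1, hr2, hr3⟩ := exists_finset_of_le_one t.2.2 (fun i => hle.2.2 i) c
    obtain ⟨e1, e2, e3, e4, e5⟩ := hL t ht
    rw [hs2, hr2] at e4
    simp only [Fin.sum_univ_two, h0, Matrix.cons_val_zero, Matrix.cons_val_one] at e1 e2 e3 e4 e5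
    -- For a factor of dimension `N` without `a₁` the quadratic bound reads `N² + 2N ≤ N² + 2`.
    have hk : t.1 1 = 1 := by
      zify at *
      nlinarith
    obtain ⟨i, rfl⟩ := Finset.card_eq_one.mp (show s.card = 1 by omega)
    obtain ⟨j, rfl⟩ := Finset.card_eq_one.mp (show r.card = 1 by omega)
    apply hp i j
    simp [hk] at e4
    rw [e4]; ring
  match L, h2 with
  | t :: u :: L, _ =>
    have h1 := key t (by simp)
    have h2 := key u (by simp)
    have h3 := congrFun (congrArg Prod.fst hs) 0
    simp at h3
    omega

/-- A factor of dimension `N` without `b₁` has two multiplicities for `A` and two for `B`; each pair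
contributes at least `N² / 2` to the quadratic bound and `C` contributes `N`, so `N ≤ 2`. For `N =
2` all four multiplicities are one and the trace relation is the vanishing of some `q_{ij}`. -/
lemma exists_of_mult_eq_zero {a₁ a₂ b₁ b₂ b₃ : ℂ}
    (hq : ∀ i j, i ≠ j → c i + c j + b₂ + b₃ - a₁ - a₂ ≠ 0)
    {t : (Fin 2 → ℕ) × (Fin 3 → ℕ) × (ν → ℕ)} (ht : Admissible ![a₁, a₂] ![b₁, b₂, b₃] c t)
    (hle : ∀ i, t.2.2 i ≤ 1) (h0 : t.2.1 0 = 0) :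
    t.1 0 + t.1 1 = 1 ∧ t.2.1 1 + t.2.1 2 = 1 ∧
      ∃ i, t.1 0 * a₁ + t.1 1 * a₂ = t.2.1 1 * b₂ + t.2.1 2 * b₃ + c i := by
  classical
  obtain ⟨r, hr1, hr2, hr3⟩ := exists_finset_of_le_one t.2.2 hle c
  obtain ⟨e1, e2, e3, e4, e5⟩ := ht
  rw [hr2] at e4
  rw [hr3, e3] at e5
  rw [e3] at hr1
  simp only [Fin.sum_univ_two, Fin.sum_univ_three, h0, Matrix.cons_val_zero, Matrix.cons_val_one,
    Matrix.cons_val] at hr1 e1 e2 e4 e5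
  generalize t.1 0 = k₁ at *
  generalize t.1 1 = k₂ at *
  generalize t.2.1 1 = f at *
  generalize t.2.1 2 = g at *
  have hN : k₁ + k₂ ≤ 2 := by
    zify at *
    nlinarith [sq_nonneg ((k₁ : ℤ) - k₂), sq_nonneg ((f : ℤ) - g)]
  rcases (show k₁ + k₂ = 1 ∨ k₁ + k₂ = 2 by omega) with h | h
  · obtain ⟨i, rfl⟩ := Finset.card_eq_one.mp (hr1.trans h)
    exact ⟨h, by omega, i, by simpa using e4⟩
  · exfalso
    obtain ⟨i, j, hij, rfl⟩ := Finset.card_eq_two.mp (hr1.trans h)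
    -- In dimension two the four squares sum to at most 4, which excludes a multiplicity 2.
    obtain ⟨h1, h2⟩ : k₁ = 1 ∧ f = 1 := by
      clear e4 hr1 hr2 hr3 hq
      obtain rfl : k₂ = 2 - k₁ := by omega
      obtain rfl : g = 2 - f := by omega
      have x1 : k₁ ≤ 2 := by omega
      have x2 : f ≤ 2 := by omega
      interval_cases k₁ <;> interval_cases f <;> simp_all
    have h3 : k₂ = 1 := by omega
    have h4 : g = 1 := by omega
    apply hq i j hij
    rw [Finset.sum_pair hij] at e4
    simp [h1, h2, h3, h4] at e4
    linear_combination -e4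

/-- Factors without `b₁` are one-dimensional, and the nonvanishing of the forms `c i + b₃ - a₁` and
`c i + b₃ - a₂` leaves only `b₂` on them. Therefore the factor `u` that carries `b₁` keeps the full
multiplicity of `b₃`, and its quadratic bound fails as soon as any other factor exists. -/
lemma false_of_even {m : ℕ} (hm : 2 ≤ m) {a₁ a₂ b₁ b₂ b₃ : ℂ}
    (hq : ∀ i j, i ≠ j → c i + c j + b₂ + b₃ - a₁ - a₂ ≠ 0)
    (h₁ : ∀ i, c i + b₃ - a₁ ≠ 0) (h₂ : ∀ i, c i + b₃ - a₂ ≠ 0)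
    (L : List ((Fin 2 → ℕ) × (Fin 3 → ℕ) × (ν → ℕ)))
    (hL : ∀ t ∈ L, Admissible ![a₁, a₂] ![b₁, b₂, b₃] c t) (hlen : 2 ≤ L.length)
    (hs : L.sum = (![m, m], ![1, m - 1, m], fun _ => 1)) : False := by
  have hle : ∀ t ∈ L, ∀ i, t.2.2 i ≤ 1 := fun t ht i => by
    have := (le_list_sum ht).2.2 i
    rwa [hs] at this
  obtain ⟨u, L', hp, hu, hL'⟩ := exists_perm_cons_of_sum_eq_one (k := 0) (L := L) (by simp [hs])
  have hP := list_sum_induction (P := fun t : (Fin 2 → ℕ) × (Fin 3 → ℕ) × (ν → ℕ) =>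
    t.2.1 0 = 0 ∧ t.2.1 2 = 0 ∧ ∑ i, t.2.1 i = ∑ i, t.1 i) (by simp)
    (fun x y hx hy => by simp [Finset.sum_add_distrib, hx, hy]) L' (fun t ht => by
      have htL : t ∈ L := hp.mem_iff.mpr (by simp [ht])
      have ha := hL t htL
      obtain ⟨n1, n2, i, hi⟩ := exists_of_mult_eq_zero hq ha (hle t htL) (hL' t ht)
      refine ⟨hL' t ht, ?_, ha.sum_snd⟩
      by_contra h0
      have hg : t.2.1 2 = 1 := by omega
      have hf : t.2.1 1 = 0 := by omega
      rcases (show t.1 0 = 0 ∧ t.1 1 = 1 ∨ t.1 0 = 1 ∧ t.1 1 = 0 by omega) with ⟨x, y⟩ | ⟨x, y⟩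
      · apply h₂ i; simp [x, y, hg, hf] at hi; rw [hi]; ring
      · apply h₁ i; simp [x, y, hg, hf] at hi; rw [hi]; ring)
  obtain ⟨t, ht⟩ : ∃ t, t ∈ L' := by
    cases L' with
    | nil => have := hp.length_eq; simp at this; omega
    | cons t _ => exact ⟨t, by simp⟩
  have hpos := (hL t (hp.mem_iff.mpr (by simp [ht]))).pos
  have htle := (le_list_sum ht).1
  have t0 := htle 0
  have t1 := htle 1
  obtain ⟨u1, u2, u3, -, u5⟩ := hL u (hp.mem_iff.mpr (by simp))
  obtain ⟨r, -, -, hr⟩ := exists_finset_of_le_one u.2.2 (hle u (hp.mem_iff.mpr (by simp))) c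
  rw [hr, u3] at u5
  rw [hp.sum_eq, List.sum_cons] at hs
  obtain ⟨q0, q2, q⟩ := hP
  have s1 := congrFun (congrArg Prod.fst hs) 0
  have s2 := congrFun (congrArg Prod.fst hs) 1
  have s3 := congrFun (congrArg (fun t => t.2.1) hs) 1
  have s4 := congrFun (congrArg (fun t => t.2.1) hs) 2
  simp only [Fin.sum_univ_two, Fin.sum_univ_three, Prod.fst_add, Prod.snd_add, Pi.add_apply,
    Matrix.cons_val_zero, Matrix.cons_val_one, Matrix.cons_val] at *
  generalize L'.sum = v at *
  obtain ⟨m, rfl⟩ : ∃ n, m = n + 1 := ⟨m - 1, by omega⟩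
  rw [Nat.add_sub_cancel] at s3
  zify at *
  have x1 : (u.1 0 : ℤ) = m + 1 - v.1 0 := by linarith
  have x2 : (u.1 1 : ℤ) = m + 1 - v.1 1 := by linarith
  have x3 : (u.2.1 1 : ℤ) = m - v.2.1 1 := by linarith
  have x4 : (u.2.1 2 : ℤ) = m + 1 := by linarith
  have x5 : (v.2.1 1 : ℤ) = v.1 0 + v.1 1 := by linarith
  rw [x1, x2, x3, x4, x5, hu] at u5
  -- After substituting what the other factors leave for `u`, all terms in `m` cancel; the remaining
  -- nonnegative expression forces `v = 0`, against the positive dimension of `t`.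
  have x6 : (v.1 0 : ℤ) ^ 2 + v.1 1 ^ 2 + (v.1 0 + v.1 1) ≤ 0 := by linear_combination u5
  linarith [sq_nonneg (v.1 0 : ℤ), sq_nonneg (v.1 1 : ℤ)]

/-- Same scheme as `false_of_even`, with the roles of `A` and `B` changed: one-dimensional factors
cannot carry `a₁`, so the factor with `b₁` keeps the full multiplicity `m + 1` of `a₁`. -/
lemma false_of_odd {m : ℕ} {a₁ a₂ b₁ b₂ b₃ : ℂ}
    (hq : ∀ i j, i ≠ j → c i + c j + b₂ + b₃ - a₁ - a₂ ≠ 0)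
    (h₁ : ∀ i, c i + b₂ - a₁ ≠ 0) (h₂ : ∀ i, c i + b₃ - a₁ ≠ 0)
    (L : List ((Fin 2 → ℕ) × (Fin 3 → ℕ) × (ν → ℕ)))
    (hL : ∀ t ∈ L, Admissible ![a₁, a₂] ![b₁, b₂, b₃] c t) (hlen : 2 ≤ L.length)
    (hs : L.sum = (![m + 1, m], ![1, m, m], fun _ => 1)) : False := by
  have hle : ∀ t ∈ L, ∀ i, t.2.2 i ≤ 1 := fun t ht i => by
    have := (le_list_sum ht).2.2 i
    rwa [hs] at this
  obtain ⟨u, L', hp, hu, hL'⟩ := exists_perm_cons_of_sum_eq_one (k := 0) (L := L) (by simp [hs])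
  have hP := list_sum_induction (P := fun t : (Fin 2 → ℕ) × (Fin 3 → ℕ) × (ν → ℕ) =>
    t.2.1 0 = 0 ∧ t.1 0 = 0 ∧ ∑ i, t.2.1 i = ∑ i, t.1 i) (by simp)
    (fun x y hx hy => by simp [Finset.sum_add_distrib, hx, hy]) L' (fun t ht => by
      have htL : t ∈ L := hp.mem_iff.mpr (by simp [ht])
      have ha := hL t htL
      obtain ⟨n1, n2, i, hi⟩ := exists_of_mult_eq_zero hq ha (hle t htL) (hL' t ht)
      refine ⟨hL' t ht, ?_, ha.sum_snd⟩
      by_contra h0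
      have hg : t.1 0 = 1 := by omega
      have hf : t.1 1 = 0 := by omega
      rcases (show t.2.1 1 = 0 ∧ t.2.1 2 = 1 ∨ t.2.1 1 = 1 ∧ t.2.1 2 = 0 by omega)
        with ⟨x, y⟩ | ⟨x, y⟩
      · apply h₂ i; simp [x, y, hg, hf] at hi; rw [hi]; ring
      · apply h₁ i; simp [x, y, hg, hf] at hi; rw [hi]; ring)
  obtain ⟨t, ht⟩ : ∃ t, t ∈ L' := by
    cases L' with
    | nil => have := hp.length_eq; simp at this; omega
    | cons t _ => exact ⟨t, by simp⟩
  have hpos := (hL t (hp.mem_iff.mpr (by simp [ht]))).pos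
  have htle := (le_list_sum ht).1
  have t0 := htle 0
  have t1 := htle 1
  obtain ⟨u1, u2, u3, -, u5⟩ := hL u (hp.mem_iff.mpr (by simp))
  obtain ⟨r, -, -, hr⟩ := exists_finset_of_le_one u.2.2 (hle u (hp.mem_iff.mpr (by simp))) c
  rw [hr, u3] at u5
  rw [hp.sum_eq, List.sum_cons] at hs
  obtain ⟨q0, q2, q⟩ := hP
  have s1 := congrFun (congrArg Prod.fst hs) 0
  have s2 := congrFun (congrArg Prod.fst hs) 1
  have s3 := congrFun (congrArg (fun t => t.2.1) hs) 1
  have s4 := congrFun (congrArg (fun t => t.2.1) hs) 2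
  simp only [Fin.sum_univ_two, Fin.sum_univ_three, Prod.fst_add, Prod.snd_add, Pi.add_apply,
    Matrix.cons_val_zero, Matrix.cons_val_one, Matrix.cons_val] at *
  generalize L'.sum = v at *
  zify at *
  have x1 : (u.1 0 : ℤ) = m + 1 := by linarith
  have x2 : (u.1 1 : ℤ) = m - v.1 1 := by linarith
  have x3 : (u.2.1 1 : ℤ) = m - v.2.1 1 := by linarith
  have x4 : (u.2.1 2 : ℤ) = m - v.2.1 2 := by linarith
  have x5 : (v.1 1 : ℤ) = v.2.1 1 + v.2.1 2 := by linarith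
  rw [x1, x2, x3, x4, x5, hu] at u5
  have x6 : (v.2.1 1 : ℤ) ^ 2 + v.2.1 2 ^ 2 + (v.2.1 1 + v.2.1 2) ≤ 0 := by linear_combination u5
  linarith [sq_nonneg (v.2.1 1 : ℤ), sq_nonneg (v.2.1 2 : ℤ)]

/-- Finite search over possible multiplicities of a proper factor on which `a₁` occurs more often
than `a₂`; the sum `k + k'` on the left of the bound is the contribution of the simple spectrum of
`C`. -/
lemma extra_cases : ∀ (k : Fin 5) (k' f f' f'' : Fin 3), (k' : ℕ) < k →
    (f + f' + f'' : ℕ) = k + k' → (k + k' : ℕ) ≠ 6 →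
    (k ^ 2 + k' ^ 2 + (f ^ 2 + f' ^ 2 + f'' ^ 2) + (k + k') : ℕ) ≤ (k + k') ^ 2 + 2 →
    ((k : ℕ), (k' : ℕ), (f : ℕ), (f' : ℕ), (f'' : ℕ)) ∈ [(1, 0, 1, 0, 0), (1, 0, 0, 1, 0),
      (1, 0, 0, 0, 1), (2, 1, 1, 1, 1), (3, 2, 1, 2, 2), (3, 2, 2, 1, 2), (3, 2, 2, 2, 1)] := by
  decide

/-- Since `4 > 2`, some factor contains `a₁` more often than `a₂`. It has dimension 1, 3 or 5.
Dimension 1 gives a vanishing `p`, dimension 3 a vanishing `q`, and dimension 5 again a vanishing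
`p` after subtraction from the total trace. -/
lemma false_of_extra (hν : Fintype.card ν = 6) {a₁ a₂ b₁ b₂ b₃ : ℂ}
    (htr : 4 * a₁ + 2 * a₂ = 2 * b₁ + 2 * b₂ + 2 * b₃ + ∑ i, c i)
    (hq : ∀ s : Finset ν, s.card = 3 → 2 * ∑ i ∈ s, c i ≠ ∑ i, c i)
    (hp : ∀ j, b₁ + c j - a₁ ≠ 0 ∧ b₂ + c j - a₁ ≠ 0 ∧ b₃ + c j - a₁ ≠ 0)
    (L : List ((Fin 2 → ℕ) × (Fin 3 → ℕ) × (ν → ℕ)))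
    (hL : ∀ t ∈ L, Admissible ![a₁, a₂] ![b₁, b₂, b₃] c t) (hlen : 2 ≤ L.length)
    (hs : L.sum = (![4, 2], ![2, 2, 2], fun _ => 1)) : False := by
  classical
  obtain ⟨t, ht, hlt⟩ : ∃ t ∈ L, t.1 1 < t.1 0 := by
    by_contra! hcon
    have := list_sum_induction (P := fun t : (Fin 2 → ℕ) × (Fin 3 → ℕ) × (ν → ℕ) =>
      t.1 0 ≤ t.1 1) le_rfl (fun x y hx hy => by simpa using add_le_add hx hy) L hcon
    simp [hs] at this
  have hle := le_list_sum ht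
  rw [hs] at hle
  have k0 : t.1 0 ≤ 4 := hle.1 0
  have k1 : t.1 1 ≤ 2 := hle.1 1
  have f0 : t.2.1 0 ≤ 2 := hle.2.1 0
  have f1 : t.2.1 1 ≤ 2 := hle.2.1 1
  have f2 : t.2.1 2 ≤ 2 := hle.2.1 2
  -- A factor of full dimension would leave nothing for the second element of the list.
  have hne : t.1 0 + t.1 1 ≠ 6 := by
    intro h6
    have hp := List.perm_cons_erase ht
    obtain ⟨u, hu⟩ : ∃ u, u ∈ L.erase t := by
      rcases hL' : L.erase t with _ | ⟨u, _⟩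
      · have := hp.length_eq; rw [hL'] at this; simp at this; omega
      · exact ⟨u, by simp⟩
    have hpos := (hL u (hp.mem_iff.mpr (by simp [hu]))).pos
    have h0 : u.1 0 ≤ (L.erase t).sum.1 0 := (le_list_sum hu).1 0
    have h1 : u.1 1 ≤ (L.erase t).sum.1 1 := (le_list_sum hu).1 1
    rw [hp.sum_eq, List.sum_cons] at hs
    have s1 := congrFun (congrArg Prod.fst hs) 0
    have s2 := congrFun (congrArg Prod.fst hs) 1
    simp [Fin.sum_univ_two] at s1 s2 hpos
    omega
  obtain ⟨r, hr1, hr2, hr3⟩ := exists_finset_of_le_one t.2.2 (fun i => hle.2.2 i) c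
  obtain ⟨e1, e2, e3, e4, e5⟩ := hL t ht
  rw [hr2] at e4
  rw [hr3, e3] at e5
  rw [e3] at hr1
  simp only [Fin.sum_univ_two, Fin.sum_univ_three, Matrix.cons_val_zero, Matrix.cons_val_one,
    Matrix.cons_val] at hr1 e1 e2 e4 e5
  generalize t.1 0 = k at *
  generalize t.1 1 = k' at *
  generalize t.2.1 0 = f at *
  generalize t.2.1 1 = f' at *
  generalize t.2.1 2 = f'' at *
  have hcases := extra_cases ⟨k, by omega⟩ ⟨k', by omega⟩ ⟨f, by omega⟩ ⟨f', by omega⟩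
    ⟨f'', by omega⟩
    hlt e2 hne e5
  simp only [List.mem_cons, Prod.mk.injEq, List.not_mem_nil, or_false] at hcases
  -- In dimension 5 only one eigenvalue of `C` is missing, so the complement is treated as a
  -- one-dimensional piece.
  have h5 : r.card = 5 → ∃ j, ∑ i ∈ r, c i = ∑ i, c i - c j := fun h => by
    obtain ⟨j, hj⟩ := Finset.card_eq_one.mp
      (show rᶜ.card = 1 by rw [Finset.card_compl, hν, h])
    refine ⟨j, ?_⟩
    rw [← Finset.sum_add_sum_compl r, hj]
    simp
  rcases hcases with ⟨rfl, rfl, rfl, rfl, rfl⟩ | ⟨rfl, rfl, rfl, rfl, rfl⟩ |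
    ⟨rfl, rfl, rfl, rfl, rfl⟩ | ⟨rfl, rfl, rfl, rfl, rfl⟩ | ⟨rfl, rfl, rfl, rfl, rfl⟩ |
    ⟨rfl, rfl, rfl, rfl, rfl⟩ | ⟨rfl, rfl, rfl, rfl, rfl⟩
  · obtain ⟨j, rfl⟩ := Finset.card_eq_one.mp hr1
    simp at e4
    exact (hp j).1 (by linear_combination -e4)
  · obtain ⟨j, rfl⟩ := Finset.card_eq_one.mp hr1
    simp at e4
    exact (hp j).2.1 (by linear_combination -e4)
  · obtain ⟨j, rfl⟩ := Finset.card_eq_one.mp hr1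
    simp at e4
    exact (hp j).2.2 (by linear_combination -e4)
  -- The type `(2,1), (1,1,1)` is half of the total type; doubling its trace relation and comparing
  -- with `htr` leaves only the `c i`.
  · norm_num at e4
    exact hq r hr1 (by linear_combination htr - 2 * e4)
  all_goals
    obtain ⟨j, hj⟩ := h5 hr1
    rw [hj] at e4
    norm_num at e4
  · exact (hp j).1 (by linear_combination e4 - htr)
  · exact (hp j).2.1 (by linear_combination e4 - htr)
  · exact (hp j).2.2 (by linear_combination e4 - htr)

end Counting

/-! ### From triangular matrices and a quadratic relation to multiplicities -/

section Triangular

variable {n : ℕ}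

lemma killedBy_toLin' {ι : Type*} [Fintype ι] {M : Matrix (Fin n) (Fin n) ℂ} {l : ι → ℂ}
    (h : aeval M (∏ i, (X - C (l i))) = 0) : KilledBy (Matrix.toLin' M) l := by
  have := Polynomial.aeval_algHom_apply (Matrix.toLinAlgEquiv' (R := ℂ) (n := Fin n)).toAlgHom M
    (∏ i, (X - C (l i)))
  rw [h, map_zero] at this
  exact this

lemma killedBy_two {M : Matrix (Fin n) (Fin n) ℂ} {a₁ a₂ : ℂ}
    (h : (M - a₁ • 1) * (M - a₂ • 1) = 0) : KilledBy (Matrix.toLin' M) ![a₁, a₂] := by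
  apply killedBy_toLin'
  simpa [Fin.prod_univ_two, Algebra.algebraMap_eq_smul_one] using h

lemma killedBy_of_charpoly {M : Matrix (Fin n) (Fin n) ℂ} {d : Fin n → ℂ}
    (h : M.charpoly = ∏ i, (X - C (d i))) : KilledBy (Matrix.toLin' M) d :=
  killedBy_toLin' (by rw [← h, Matrix.aeval_self_charpoly])

/-- A nonzero term in the triple product is a path of indices along which the level never drops. The
factor `M - b k` cannot start at level `k` without raising the level, so after the three factors the
level would exceed 2. -/
lemma killedBy_of_level {M : Matrix (Fin n) (Fin n) ℂ} {b : Fin 3 → ℂ} {ℓ : Fin n → Fin 3}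
    (h0 : ∀ i j, i ≠ j → ¬ ℓ i < ℓ j → M i j = 0) (hd : ∀ i, M i i = b (ℓ i)) :
    KilledBy (Matrix.toLin' M) b := by
  apply killedBy_toLin'
  simp only [Fin.prod_univ_three, map_mul, map_sub, aeval_X, aeval_C,
    Algebra.algebraMap_eq_smul_one]
  have key : ∀ k i j, (M - b k • 1) i j ≠ 0 → ℓ i ≤ ℓ j ∧ (ℓ i = k → k < ℓ j) := by
    intro k i j hij
    by_cases e : i = j
    · subst e
      refine ⟨le_rfl, fun hk => absurd ?_ hij⟩
      simp [hd, hk]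
    · have : ℓ i < ℓ j := by
        by_contra hlt
        exact hij (by simp [h0 i j e hlt, e])
      exact ⟨this.le, fun hk => hk ▸ this⟩
  ext i j
  rw [Matrix.mul_apply]
  refine Finset.sum_eq_zero fun s _ => ?_
  rw [Matrix.mul_apply, Finset.sum_mul]
  refine Finset.sum_eq_zero fun r _ => ?_
  by_contra hne
  obtain ⟨x1, x2⟩ := key 0 i r (left_ne_zero_of_mul (left_ne_zero_of_mul hne))
  obtain ⟨y1, y2⟩ := key 1 r s (right_ne_zero_of_mul (left_ne_zero_of_mul hne))
  obtain ⟨z1, z2⟩ := key 2 s j (right_ne_zero_of_mul hne)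
  omega

/-- Semisimplicity makes generalized eigenspaces equal to eigenspaces, so the multiplicity is that
of a root of the characteristic polynomial. -/
lemma mult_eq_card {ι : Type*} [Fintype ι] {M : Matrix (Fin n) (Fin n) ℂ} {d : Fin n → ℂ}
    {l : ι → ℂ} (h : M.charpoly = ∏ i, (X - C (d i))) (k : KilledBy (Matrix.toLin' M) l)
    (hl : Function.Injective l) (μ : ℂ) :
    mult (Matrix.toLin' M) μ = (Finset.univ.filter fun i => d i = μ).card := by
  have h1 := (k.isSemisimple hl).isFinitelySemisimple.maxGenEigenspace_eq_eigenspace μ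
  have h2 := LinearMap.finrank_maxGenEigenspace_eq (Matrix.toLin' M) μ
  rw [h1, Matrix.charpoly_toLin', h, ← count_roots] at h2
  rw [mult, h2]
  have : (∏ i, (X - C (d i))) = ((Finset.univ.val.map d).map fun a => X - C a).prod := by
    rw [Multiset.map_map]; rfl
  rw [this, roots_multiset_prod_X_sub_C, Multiset.count_map, Finset.card_def, Finset.filter_val]
  simp [eq_comm]

lemma charpoly_of_isLowerTriangular {M : Matrix (Fin n) (Fin n) ℂ}
    (h : ∀ i j, i < j → M i j = 0) : M.charpoly = ∏ i, (X - C (M i i)) := by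
  rw [← Matrix.charpoly_transpose, Matrix.charpoly_of_isUpperTriangular]
  · simp
  · exact fun i j hij => h j i hij

/-- Dimension and trace give two linear equations for the two multiplicities, with determinant `±
(a₁ - a₂)`. -/
lemma mult_of_trace {M : Matrix (Fin n) (Fin n) ℂ} {a₁ a₂ : ℂ} (ha : a₁ ≠ a₂)
    (k : KilledBy (Matrix.toLin' M) ![a₁, a₂]) {k₁ k₂ : ℕ} (hn : k₁ + k₂ = n)
    (ht : M.trace = k₁ * a₁ + k₂ * a₂) :
    mult (Matrix.toLin' M) a₁ = k₁ ∧ mult (Matrix.toLin' M) a₂ = k₂ := by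
  have hinj : Function.Injective ![a₁, a₂] := by
    intro i j hij
    fin_cases i <;> fin_cases j <;> simp_all
  have h1 := k.sum_mult hinj
  have h2 := k.trace_eq hinj
  rw [Matrix.trace_toLin'_eq, ht] at h2
  simp only [Fin.sum_univ_two, Matrix.cons_val_zero, Matrix.cons_val_one, finrank_fin_fun] at h1 h2
  have h3 : (mult (Matrix.toLin' M) a₁ : ℂ) + mult (Matrix.toLin' M) a₂ = k₁ + k₂ := by
    exact_mod_cast h1.trans hn.symm
  have h4 : ((mult (Matrix.toLin' M) a₁ : ℂ) - k₁) * (a₁ - a₂) = 0 := by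
    linear_combination -h2 - a₂ * h3
  have h5 : (mult (Matrix.toLin' M) a₁ : ℂ) = k₁ :=
    sub_eq_zero.mp ((mul_eq_zero.mp h4).resolve_right (sub_ne_zero.mpr ha))
  have h6 : mult (Matrix.toLin' M) a₁ = k₁ := by exact_mod_cast h5
  omega

lemma isIrreducibleTriple_of_forall_list {ι κ ν : Type*} [Fintype ι] [Fintype κ] [Fintype ν]
    {a : ι → ℂ} {b : κ → ℂ} {c : ν → ℂ} (hn : 0 < n) {B C : Matrix (Fin n) (Fin n) ℂ}
    (ha : Function.Injective a) (hb : Function.Injective b) (hc : Function.Injective c)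
    (kA : KilledBy (Matrix.toLin' (B + C)) a) (kB : KilledBy (Matrix.toLin' B) b)
    (kC : KilledBy (Matrix.toLin' C) c)
    (H : ∀ L : List ((ι → ℕ) × (κ → ℕ) × (ν → ℕ)), (∀ t ∈ L, Admissible a b c t) →
      2 ≤ L.length → L.sum ≠ (fun i => mult (Matrix.toLin' (B + C)) (a i),
        fun i => mult (Matrix.toLin' B) (b i), fun i => mult (Matrix.toLin' C) (c i))) :
    IsIrreducibleTriple (B + C) B C := by
  have : NeZero n := ⟨hn.ne'⟩
  obtain ⟨L, -, h1, h2, h3⟩ := exists_list_admissible ha hb hc n (Fin n → ℂ) (Matrix.toLin' B)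
    (Matrix.toLin' C) (by simp) (by rwa [← map_add]) kB kC
  have hirr : IsIrreducible (Matrix.toLin' B) (Matrix.toLin' C) := by
    by_contra hcon
    refine H L h2 (h1 hcon) ?_
    rw [h3, mults, map_add]
  exact fun W _ hB hC => hirr W hB hC

lemma injective_vec_three {b₁ b₂ b₃ : ℂ} (h₁ : b₁ ≠ b₂) (h₂ : b₁ ≠ b₃) (h₃ : b₂ ≠ b₃) :
    Function.Injective ![b₁, b₂, b₃] := by
  intro i j hij
  fin_cases i <;> fin_cases j <;> simp_all

/-- Irreducibility for a block triangular matrix `B` with three scalar diagonal blocks. -/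
lemma isIrreducibleTriple_of_level (hn : 0 < n) {B C : Matrix (Fin n) (Fin n) ℂ}
    {a₁ a₂ b₁ b₂ b₃ : ℂ} (ha : a₁ ≠ a₂) (hb₁ : b₁ ≠ b₂) (hb₂ : b₁ ≠ b₃) (hb₃ : b₂ ≠ b₃)
    {ℓ : Fin n → Fin 3} (hℓ : Monotone ℓ) (h0 : ∀ i j, i ≠ j → ¬ ℓ i < ℓ j → B i j = 0)
    (hd : ∀ i, B i i = ![b₁, b₂, b₃] (ℓ i)) {c : Fin n → ℂ} (hc : Function.Injective c)
    (hC : ∀ i j, i < j → C i j = 0) (hCd : ∀ i, C i i = c i)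
    (kA : (B + C - a₁ • 1) * (B + C - a₂ • 1) = 0) {k₁ k₂ : ℕ} (hk : k₁ + k₂ = n)
    (ht : (B + C).trace = k₁ * a₁ + k₂ * a₂) {f : Fin 3 → ℕ}
    (hf : ∀ j, (Finset.univ.filter fun i => ℓ i = j).card = f j)
    (H : ∀ L : List ((Fin 2 → ℕ) × (Fin 3 → ℕ) × (Fin n → ℕ)),
      (∀ t ∈ L, Admissible ![a₁, a₂] ![b₁, b₂, b₃] c t) → 2 ≤ L.length →
      L.sum = (![k₁, k₂], f, fun _ => 1) → False) :
    IsIrreducibleTriple (B + C) B C := by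
  have hb := injective_vec_three hb₁ hb₂ hb₃
  have kA := killedBy_two kA
  have kB := killedBy_of_level h0 hd
  have pC := charpoly_of_isLowerTriangular hC
  have kC := killedBy_of_charpoly pC
  have pB : B.charpoly = ∏ i, (X - Polynomial.C (B i i)) :=
    Matrix.charpoly_of_isUpperTriangular _ fun i j hij =>
      h0 i j (ne_of_gt hij) (not_lt.mpr (hℓ (le_of_lt hij)))
  simp only [hCd] at pC kC
  refine isIrreducibleTriple_of_forall_list hn (a := ![a₁, a₂]) (b := ![b₁, b₂, b₃]) (c := c) ?_
    hb hc kA kB kC fun L hL h2 hs => H L hL h2 ?_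
  · intro i j hij
    fin_cases i <;> fin_cases j <;> simp_all
  rw [hs]
  obtain ⟨m1, m2⟩ := mult_of_trace ha kA hk ht
  refine Prod.ext (funext fun i => ?_) (Prod.ext (funext fun i => ?_) (funext fun i => ?_))
  · fin_cases i
    · exact m1
    · exact m2
  · refine Eq.trans ?_ (hf i)
    simp only [mult_eq_card pB kB hb, hd, hb.eq_iff]
  · refine (mult_eq_card pC kC hc (c i)).trans ?_
    exact Finset.card_eq_one.mpr ⟨i, by ext j; simp [hc.eq_iff]⟩

end Triangular

/-! ### Lagrange interpolation identities -/

section Lagrange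

variable {τ : Type*} [Fintype τ] [DecidableEq τ]

/-- With `Q = ∏ (X - v t)`, the difference `P - Q` has degree below the number of nodes and agrees
with `P` at them. The sum is the top coefficient of its interpolation formula. -/
lemma sum_eval_div_prod_sub [Nonempty τ] {v : τ → ℂ} (hv : Function.Injective v) {P : ℂ[X]}
    (hP : P.Monic) (hd : P.natDegree = Fintype.card τ) :
    ∑ t, P.eval (v t) / ∏ j ∈ Finset.univ.erase t, (v t - v j) = P.nextCoeff + ∑ t, v t := by
  set Q : ℂ[X] := ∏ t, (X - C (v t)) with hQ
  have hQm : Q.Monic := monic_prod_X_sub_C v _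
  have hQd : Q.natDegree = Fintype.card τ := by simp [hQ]
  have hcard : 0 < Fintype.card τ := Fintype.card_pos
  have hlt : (P - Q).degree < (Finset.univ : Finset τ).card := by
    have h := degree_sub_lt_left (p := P) (q := Q) (by
      rw [degree_eq_natDegree hP.ne_zero, degree_eq_natDegree hQm.ne_zero, hd, hQd]) hP.ne_zero
      (by rw [hP.leadingCoeff, hQm.leadingCoeff])
    rwa [degree_eq_natDegree hP.ne_zero, hd] at h
  have h := Lagrange.coeff_eq_sum (s := Finset.univ) (v := v) hv.injOn hlt
  have hnP : P.nextCoeff = P.coeff (Fintype.card τ - 1) := by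
    rw [nextCoeff_of_natDegree_pos (by omega), hd]
  have hnQ : Q.nextCoeff = Q.coeff (Fintype.card τ - 1) := by
    rw [nextCoeff_of_natDegree_pos (by omega), hQd]
  have hnQ' : Q.nextCoeff = - ∑ t, v t := prod_X_sub_C_nextCoeff v
  rw [Finset.card_univ, coeff_sub, ← hnP, ← hnQ, hnQ'] at h
  rw [sub_neg_eq_add] at h
  rw [h]
  refine Finset.sum_congr rfl fun t _ => ?_
  have : Q.eval (v t) = 0 := by
    rw [hQ, eval_prod]
    exact Finset.prod_eq_zero (Finset.mem_univ t) (by simp)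
  rw [eval_sub, this, sub_zero]

/-- The partial fraction expansion of `P / Q`, again by interpolating `P - Q`; the 1 is the
polynomial part. -/
lemma one_add_sum_eval_div [Nonempty τ] {v : τ → ℂ} (hv : Function.Injective v) {P : ℂ[X]}
    (hP : P.Monic) (hd : P.natDegree = Fintype.card τ) {μ : ℂ} (hμ : ∀ t, μ ≠ v t) :
    1 + ∑ t, P.eval (v t) / (∏ j ∈ Finset.univ.erase t, (v t - v j)) / (μ - v t) =
      P.eval μ / ∏ t, (μ - v t) := by
  set Q : ℂ[X] := ∏ t, (X - C (v t)) with hQ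
  have hQm : Q.Monic := monic_prod_X_sub_C v _
  have hQd : Q.natDegree = Fintype.card τ := by simp [hQ]
  have hlt : (P - Q).degree < (Finset.univ : Finset τ).card := by
    have h := degree_sub_lt_left (p := P) (q := Q) (by
      rw [degree_eq_natDegree hP.ne_zero, degree_eq_natDegree hQm.ne_zero, hd, hQd]) hP.ne_zero
      (by rw [hP.leadingCoeff, hQm.leadingCoeff])
    rwa [degree_eq_natDegree hP.ne_zero, hd] at h
  have h := congrArg (eval μ) (Lagrange.eq_interpolate (s := Finset.univ) (v := v) hv.injOn hlt)
  rw [Lagrange.eval_interpolate_not_at_node _ (fun t _ => hμ t), Lagrange.eval_nodal] at h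
  have hQμ : Q.eval μ = ∏ t, (μ - v t) := by simp [hQ, eval_prod]
  have hne : ∏ t, (μ - v t) ≠ 0 := Finset.prod_ne_zero_iff.mpr fun t _ => sub_ne_zero.mpr (hμ t)
  rw [eval_sub, hQμ, sub_eq_iff_eq_add] at h
  rw [h, add_div, mul_div_cancel_left₀ _ hne, div_self hne, add_comm]
  congr 1
  refine Finset.sum_congr rfl fun t _ => ?_
  have : Q.eval (v t) = 0 := by
    rw [hQ, eval_prod]
    exact Finset.prod_eq_zero (Finset.mem_univ t) (by simp)
  rw [eval_sub, this, sub_zero, Lagrange.nodalWeight, Finset.prod_inv_distrib]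
  field_simp

end Lagrange

/-! ### Bordered Cauchy matrices with a quadratic relation -/

section Cauchy

variable {σ τ : Type*} [Fintype σ] [Fintype τ] [DecidableEq σ] [DecidableEq τ]

/-- A matrix with diagonal blocks of sizes `1`, `σ`, `τ` whose other blocks between `σ` and `τ` are
Cauchy matrices. -/
noncomputable def cauchy (r : ℂ) (β u w : σ → ℂ) (δ v z : τ → ℂ) (q : τ → σ → ℂ) :
    Matrix (Unit ⊕ σ ⊕ τ) (Unit ⊕ σ ⊕ τ) ℂ :=
  Matrix.of fun
    | .inl _, .inl _ => r
    | .inl _, .inr (.inl s) => w s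
    | .inl _, .inr (.inr t) => v t
    | .inr (.inl s), .inl _ => -u s
    | .inr (.inl s), .inr (.inl s') => if s = s' then β s else 0
    | .inr (.inl s), .inr (.inr t) => u s * v t / q t s
    | .inr (.inr t), .inl _ => -z t
    | .inr (.inr t), .inr (.inl s) => z t * w s / q t s
    | .inr (.inr t), .inr (.inr t') => if t = t' then δ t else 0

variable {r a₁ a₂ : ℂ} {β u w : σ → ℂ} {δ v z : τ → ℂ}

/-- Let `K = (A - a₁)(A - a₂)`. The sum rules `h₁`, `h₂` kill all off-diagonal entries of `K`. Since
`K` commutes with `A` and the first row of `A` has no zeros off the diagonal, the diagonal matrix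
`K` is scalar. So a single diagonal entry, supplied by `h₃`, has to be checked. -/
lemma cauchy_quadratic (hq : ∀ t s, β s + δ t - a₁ - a₂ ≠ 0) (hβ : Function.Injective β)
    (hδ : Function.Injective δ) (hw : ∀ s, w s ≠ 0) (hv : ∀ t, v t ≠ 0)
    (h₁ : ∀ s, ∑ t, v t * z t / (β s + δ t - a₁ - a₂) = a₁ + a₂ - r - β s)
    (h₂ : ∀ t, ∑ s, u s * w s / (β s + δ t - a₁ - a₂) = a₁ + a₂ - r - δ t)
    (s₀ : σ) (h₃ : u s₀ * w s₀ * (1 - ∑ t, v t * z t / (β s₀ + δ t - a₁ - a₂) ^ 2) =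
      (β s₀ - a₁) * (β s₀ - a₂)) :
    (cauchy r β u w δ v z (fun t s => β s + δ t - a₁ - a₂) - a₁ • 1) *
      (cauchy r β u w δ v z (fun t s => β s + δ t - a₁ - a₂) - a₂ • 1) = 0 := by
  set A := cauchy r β u w δ v z (fun t s => β s + δ t - a₁ - a₂) with hA
  set K := A * A - (a₁ + a₂) • A + (a₂ * a₁) • 1 with hK
  have hKA : (A - a₁ • 1) * (A - a₂ • 1) = K := by
    simp only [hK, sub_mul, mul_sub, Matrix.smul_mul, Matrix.mul_smul, add_smul, mul_smul, one_mul,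
      mul_one]
    abel
  rw [hKA]
  have hcomm : A * K = K * A := by
    simp only [hK, mul_add, add_mul, mul_sub, sub_mul, Matrix.smul_mul, Matrix.mul_smul, one_mul,
      mul_one, mul_assoc]
  -- Partial fractions: the product of two reciprocals is the difference of the two sums in `h₁`
  -- divided by `β s' - β s`.
  have e₁ : ∀ s s', s ≠ s' →
      ∑ t, v t * z t / ((β s + δ t - a₁ - a₂) * (β s' + δ t - a₁ - a₂)) = 1 := by
    intro s s' hs
    have hne : β s' - β s ≠ 0 := sub_ne_zero.mpr fun h => hs (hβ h).symm
    apply mul_right_cancel₀ hne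
    rw [one_mul, Finset.sum_mul]
    calc _ = ∑ t, (v t * z t / (β s + δ t - a₁ - a₂) - v t * z t / (β s' + δ t - a₁ - a₂)) := by
          refine Finset.sum_congr rfl fun t _ => ?_
          have := hq t s
          have := hq t s'
          field_simp
          ring
      _ = _ := by rw [Finset.sum_sub_distrib, h₁, h₁]; ring
  have e₂ : ∀ t t', t ≠ t' →
      ∑ s, u s * w s / ((β s + δ t - a₁ - a₂) * (β s + δ t' - a₁ - a₂)) = 1 := by
    intro t t' ht
    have hne : δ t' - δ t ≠ 0 := sub_ne_zero.mpr fun h => ht (hδ h).symm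
    apply mul_right_cancel₀ hne
    rw [one_mul, Finset.sum_mul]
    calc _ = ∑ s, (u s * w s / (β s + δ t - a₁ - a₂) - u s * w s / (β s + δ t' - a₁ - a₂)) := by
          refine Finset.sum_congr rfl fun s _ => ?_
          have := hq t s
          have := hq t' s
          field_simp
          ring
      _ = _ := by rw [Finset.sum_sub_distrib, h₂, h₂]; ring
  have hoff : ∀ x y, x ≠ y → K x y = 0 := by
    intro x y hxy
    rcases x with x | s | t <;> rcases y with y | s' | t'
    · exact absurd rfl hxy
    · have e : ∑ t, v t * (z t * w s' / (β s' + δ t - a₁ - a₂)) = w s' * (a₁ + a₂ - r - β s') := by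
        rw [← h₁, Finset.mul_sum]
        exact Finset.sum_congr rfl fun t _ => by ring
      simp [hK, hA, cauchy, Matrix.mul_apply, Fintype.sum_sum_type, e]
      ring
    · have e : ∑ s, w s * (u s * v t' / (β s + δ t' - a₁ - a₂)) = v t' * (a₁ + a₂ - r - δ t') := by
        rw [← h₂, Finset.mul_sum]
        exact Finset.sum_congr rfl fun t _ => by ring
      simp [hK, hA, cauchy, Matrix.mul_apply, Fintype.sum_sum_type, e]
      ring
    · have e : ∑ t, u s * v t / (β s + δ t - a₁ - a₂) * z t = u s * (a₁ + a₂ - r - β s) := by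
        rw [← h₁, Finset.mul_sum]
        exact Finset.sum_congr rfl fun t _ => by ring
      simp [hK, hA, cauchy, Matrix.mul_apply, Fintype.sum_sum_type, e]
      ring
    · have hs : s ≠ s' := fun h => hxy (by rw [h])
      have e : ∑ t, u s * v t / (β s + δ t - a₁ - a₂) * (z t * w s' / (β s' + δ t - a₁ - a₂)) =
          u s * w s' := by
        rw [← mul_one (u s * w s'), ← e₁ s s' hs, Finset.mul_sum]
        exact Finset.sum_congr rfl fun t _ => by
          rw [div_mul_div_comm, ← mul_div_assoc]; congr 1; ring
      simp [hK, hA, cauchy, Matrix.mul_apply, Fintype.sum_sum_type, e, hs]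
    · have := hq t' s
      simp [hK, hA, cauchy, Matrix.mul_apply, Fintype.sum_sum_type]
      field_simp
      ring
    · have e : ∑ s, z t * w s / (β s + δ t - a₁ - a₂) * u s = z t * (a₁ + a₂ - r - δ t) := by
        rw [← h₂, Finset.mul_sum]
        exact Finset.sum_congr rfl fun s _ => by ring
      simp [hK, hA, cauchy, Matrix.mul_apply, Fintype.sum_sum_type, e]
      ring
    · have := hq t s'
      simp [hK, hA, cauchy, Matrix.mul_apply, Fintype.sum_sum_type]
      field_simp
      ring
    · have ht : t ≠ t' := fun h => hxy (by rw [h])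
      have e : ∑ s, z t * w s / (β s + δ t - a₁ - a₂) * (u s * v t' / (β s + δ t' - a₁ - a₂)) =
          z t * v t' := by
        rw [← mul_one (z t * v t'), ← e₂ t t' ht, Finset.mul_sum]
        exact Finset.sum_congr rfl fun s _ => by
          rw [div_mul_div_comm, ← mul_div_assoc]; congr 1; ring
      simp [hK, hA, cauchy, Matrix.mul_apply, Fintype.sum_sum_type, e, ht]
  have hdiag : K (.inr (.inl s₀)) (.inr (.inl s₀)) = 0 := by
    have e : ∑ t, u s₀ * v t / (β s₀ + δ t - a₁ - a₂) * (z t * w s₀ / (β s₀ + δ t - a₁ - a₂)) =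
        u s₀ * w s₀ * ∑ t, v t * z t / (β s₀ + δ t - a₁ - a₂) ^ 2 := by
      rw [Finset.mul_sum]
      exact Finset.sum_congr rfl fun t _ => by
        rw [div_mul_div_comm, ← mul_div_assoc, sq]; congr 1; ring
    simp [hK, hA, cauchy, Matrix.mul_apply, Fintype.sum_sum_type, e]
    linear_combination -h₃
  -- As `K` is diagonal, commuting with `A` means that `K x x = K y y` whenever `A x y ≠ 0`.
  have hentry : ∀ x y, A x y * K y y = K x x * A x y := by
    intro x y
    have h := congrFun (congrFun hcomm x) y
    rw [Matrix.mul_apply, Matrix.mul_apply, Finset.sum_eq_single y, Finset.sum_eq_single x] at h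
    · exact h
    · exact fun k _ hk => by rw [hoff x k hk.symm, zero_mul]
    · simp
    · exact fun k _ hk => by rw [hoff k y hk, mul_zero]
    · simp
  have h0 : K (.inl ()) (.inl ()) = 0 := by
    have := hentry (.inl ()) (.inr (.inl s₀))
    rw [hdiag, mul_zero] at this
    exact (mul_eq_zero.mp this.symm).resolve_right (hw s₀)
  ext x y
  by_cases hxy : x = y
  · subst hxy
    rcases x with x | s | t
    · exact h0
    · have := hentry (.inl ()) (.inr (.inl s))
      rw [h0, zero_mul] at this
      exact (mul_eq_zero.mp this).resolve_left (hw s)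
    · have := hentry (.inl ()) (.inr (.inr t))
      rw [h0, zero_mul] at this
      exact (mul_eq_zero.mp this).resolve_left (hv t)
  · exact hoff x y hxy

/-- Dividing `v t * z t` by one factor `β s + δ t - a₁ - a₂` turns its numerator into the value at
`δ t` of a monic polynomial whose degree is the number of nodes; likewise for `u s * w s`. The sum
rules then come from `sum_eval_div_prod_sub`, and the remaining diagonal entry from a partial
fraction expansion. The polynomials `R`, `R'` carry the factors that distinguish the two families.
-/
lemma cauchy_quadratic_of_lagrange [Nonempty σ] [Nonempty τ]
    (hq : ∀ t s, β s + δ t - a₁ - a₂ ≠ 0) (hβ : Function.Injective β)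
    (hδ : Function.Injective δ) (hw : ∀ s, w s ≠ 0) (hv : ∀ t, v t ≠ 0) {R R' : ℂ[X]}
    (hR : R.Monic) (hR' : R'.Monic) (hd : R.natDegree + Fintype.card σ = Fintype.card τ + 1)
    (hd' : R'.natDegree + Fintype.card τ = Fintype.card σ + 1)
    (hc : R.nextCoeff + ∑ s, β s + ∑ t, δ t + r = Fintype.card σ * (a₁ + a₂))
    (hc' : R'.nextCoeff + ∑ s, β s + ∑ t, δ t + r = Fintype.card τ * (a₁ + a₂))
    (hRR' : ∀ x, (-1) ^ (Fintype.card σ - 1 + Fintype.card τ) *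
      (R'.eval x * R.eval (a₁ + a₂ - x)) = (x - a₁) * (x - a₂))
    (hX : ∀ t, v t * z t = R.eval (δ t) * (∏ s, (β s + δ t - a₁ - a₂)) /
      ∏ t' ∈ Finset.univ.erase t, (δ t - δ t'))
    (hY : ∀ s, u s * w s = R'.eval (β s) * (∏ t, (β s + δ t - a₁ - a₂)) /
      ∏ s' ∈ Finset.univ.erase s, (β s - β s')) :
    (cauchy r β u w δ v z (fun t s => β s + δ t - a₁ - a₂) - a₁ • 1) *
      (cauchy r β u w δ v z (fun t s => β s + δ t - a₁ - a₂) - a₂ • 1) = 0 := by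
  have hσ : 0 < Fintype.card σ := Fintype.card_pos
  have hτ : 0 < Fintype.card τ := Fintype.card_pos
  let P : σ → ℂ[X] := fun s => R * ∏ s' ∈ Finset.univ.erase s, (X - C (a₁ + a₂ - β s'))
  let P' : τ → ℂ[X] := fun t => R' * ∏ t' ∈ Finset.univ.erase t, (X - C (a₁ + a₂ - δ t'))
  have hPm : ∀ s, (P s).Monic := fun s => hR.mul (monic_prod_X_sub_C _ _)
  have hPm' : ∀ t, (P' t).Monic := fun t => hR'.mul (monic_prod_X_sub_C _ _)
  have hPd : ∀ s, (P s).natDegree = Fintype.card τ := fun s => by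
    rw [hR.natDegree_mul (monic_prod_X_sub_C _ _), natDegree_finsetProd_X_sub_C_eq_card,
      Finset.card_erase_of_mem (Finset.mem_univ s), Finset.card_univ]
    omega
  have hPd' : ∀ t, (P' t).natDegree = Fintype.card σ := fun t => by
    rw [hR'.natDegree_mul (monic_prod_X_sub_C _ _), natDegree_finsetProd_X_sub_C_eq_card,
      Finset.card_erase_of_mem (Finset.mem_univ t), Finset.card_univ]
    omega
  have hPn : ∀ s, (P s).nextCoeff =
      R.nextCoeff - ((Fintype.card σ - 1) * (a₁ + a₂) - (∑ s', β s' - β s)) := fun s => by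
    rw [hR.nextCoeff_mul (monic_prod_X_sub_C _ _), prod_X_sub_C_nextCoeff, Finset.sum_sub_distrib,
      Finset.sum_const, Finset.card_erase_of_mem (Finset.mem_univ s), Finset.card_univ,
      nsmul_eq_mul, Nat.cast_sub hσ, ← Finset.sum_erase_add _ _ (Finset.mem_univ s)]
    push_cast
    ring
  have hPn' : ∀ t, (P' t).nextCoeff =
      R'.nextCoeff - ((Fintype.card τ - 1) * (a₁ + a₂) - (∑ t', δ t' - δ t)) := fun t => by
    rw [hR'.nextCoeff_mul (monic_prod_X_sub_C _ _), prod_X_sub_C_nextCoeff, Finset.sum_sub_distrib,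
      Finset.sum_const, Finset.card_erase_of_mem (Finset.mem_univ t), Finset.card_univ,
      nsmul_eq_mul, Nat.cast_sub hτ, ← Finset.sum_erase_add _ _ (Finset.mem_univ t)]
    push_cast
    ring
  have hXP : ∀ s t, v t * z t / (β s + δ t - a₁ - a₂) =
      (P s).eval (δ t) / ∏ t' ∈ Finset.univ.erase t, (δ t - δ t') := fun s t => by
    rw [hX, ← Finset.mul_prod_erase _ _ (Finset.mem_univ s), eval_mul, eval_prod]
    have h1 := hq t s
    have h2 : ∀ s', β s' + δ t - a₁ - a₂ = eval (δ t) (X - C (a₁ + a₂ - β s')) := fun s' => by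
      simp; ring
    rw [Finset.prod_congr rfl fun s' _ => h2 s']
    field_simp
  have hYP : ∀ s t, u s * w s / (β s + δ t - a₁ - a₂) =
      (P' t).eval (β s) / ∏ s' ∈ Finset.univ.erase s, (β s - β s') := fun s t => by
    rw [hY, ← Finset.mul_prod_erase _ _ (Finset.mem_univ t), eval_mul, eval_prod]
    have h1 := hq t s
    have h2 : ∀ t', β s + δ t' - a₁ - a₂ = eval (β s) (X - C (a₁ + a₂ - δ t')) := fun t' => by
      simp; ring
    rw [Finset.prod_congr rfl fun t' _ => h2 t']
    field_simp
  obtain ⟨s₀⟩ := ‹Nonempty σ›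
  have : Nonempty σ := ⟨s₀⟩
  refine cauchy_quadratic hq hβ hδ hw hv (fun s => ?_) (fun t => ?_) s₀ ?_
  · rw [Finset.sum_congr rfl fun t _ => hXP s t, sum_eval_div_prod_sub hδ (hPm s) (hPd s), hPn]
    linear_combination hc
  · rw [Finset.sum_congr rfl fun s _ => hYP s t, sum_eval_div_prod_sub hβ (hPm' t) (hPd' t), hPn']
    linear_combination hc'
  -- At `μ = a₁ + a₂ - β s₀` the denominators `μ - δ t` are the negatives of the Cauchy
  -- denominators, so the partial fraction sum becomes the sum of inverse squares in `h₃`.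
  -- Multiplication by `u s₀ * w s₀` cancels both products, leaving `R' · R` up to sign.
  · have hμ : ∀ t, a₁ + a₂ - β s₀ ≠ δ t := fun t h => hq t s₀ (by rw [← h]; ring)
    have h := one_add_sum_eval_div hδ (hPm s₀) (hPd s₀) hμ
    have h' : ∑ t, (P s₀).eval (δ t) / (∏ j ∈ Finset.univ.erase t, (δ t - δ j)) /
        (a₁ + a₂ - β s₀ - δ t) = - ∑ t, v t * z t / (β s₀ + δ t - a₁ - a₂) ^ 2 := by
      rw [← Finset.sum_neg_distrib]
      refine Finset.sum_congr rfl fun t _ => ?_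
      rw [← hXP, sq, ← div_div, ← div_neg]
      congr 1; ring
    rw [h', ← sub_eq_add_neg] at h
    have e1 : ∏ t, (a₁ + a₂ - β s₀ - δ t) =
        (-1) ^ Fintype.card τ * ∏ t, (β s₀ + δ t - a₁ - a₂) := by
      rw [← Finset.card_univ, ← Finset.prod_const, ← Finset.prod_mul_distrib]
      exact Finset.prod_congr rfl fun t _ => by ring
    have e2 : (P s₀).eval (a₁ + a₂ - β s₀) = R.eval (a₁ + a₂ - β s₀) *
        ((-1) ^ (Fintype.card σ - 1) * ∏ s' ∈ Finset.univ.erase s₀, (β s₀ - β s')) := by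
      rw [eval_mul, eval_prod, ← Finset.card_univ,
        ← Finset.card_erase_of_mem (Finset.mem_univ s₀), ← Finset.prod_const,
        ← Finset.prod_mul_distrib]
      congr 1
      exact Finset.prod_congr rfl fun t _ => by simp
    have n1 : ∏ t, (β s₀ + δ t - a₁ - a₂) ≠ 0 :=
      Finset.prod_ne_zero_iff.mpr fun t _ => hq t s₀
    have n2 : ∏ s' ∈ Finset.univ.erase s₀, (β s₀ - β s') ≠ 0 :=
      Finset.prod_ne_zero_iff.mpr fun s' hs' =>
        sub_ne_zero.mpr fun h => (Finset.ne_of_mem_erase hs') (hβ h).symm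
    have n3 : ((-1) ^ Fintype.card τ : ℂ) * (-1) ^ Fintype.card τ = 1 := by
      rw [← mul_pow]; simp
    rw [h, e1, e2, hY, ← hRR', pow_add]
    have n4 : ((-1) ^ Fintype.card τ : ℂ) ≠ 0 := by simp
    field_simp
    linear_combination -(R'.eval (β s₀) * R.eval (a₁ + a₂ - β s₀)) * n3

/-- The case of `σ` with one element less than `τ`. -/
lemma cauchy_quadratic_even [Nonempty σ] (hcard : Fintype.card τ = Fintype.card σ + 1)
    (hq : ∀ t s, β s + δ t - a₁ - a₂ ≠ 0) (hβ : Function.Injective β)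
    (hδ : Function.Injective δ) (hw : ∀ s, w s ≠ 0) (hv : ∀ t, v t ≠ 0)
    (hr : r + ∑ s, β s + ∑ t, δ t = Fintype.card τ * (a₁ + a₂))
    (hX : ∀ t, v t * z t = (δ t - a₁) * (δ t - a₂) * (∏ s, (β s + δ t - a₁ - a₂)) /
      ∏ t' ∈ Finset.univ.erase t, (δ t - δ t'))
    (hY : ∀ s, u s * w s = (∏ t, (β s + δ t - a₁ - a₂)) /
      ∏ s' ∈ Finset.univ.erase s, (β s - β s')) :
    (cauchy r β u w δ v z (fun t s => β s + δ t - a₁ - a₂) - a₁ • 1) *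
      (cauchy r β u w δ v z (fun t s => β s + δ t - a₁ - a₂) - a₂ • 1) = 0 := by
  have hσ : 0 < Fintype.card σ := Fintype.card_pos
  have : Nonempty τ := Fintype.card_pos_iff.mp (by omega)
  have hnc : ((X - C a₁) * (X - C a₂) : ℂ[X]).nextCoeff = -(a₁ + a₂) := by
    rw [(monic_X_sub_C a₁).nextCoeff_mul (monic_X_sub_C a₂), nextCoeff_X_sub_C,
      nextCoeff_X_sub_C]
    ring
  refine cauchy_quadratic_of_lagrange hq hβ hδ hw hv (R := (X - C a₁) * (X - C a₂)) (R' := 1)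
    ((monic_X_sub_C a₁).mul (monic_X_sub_C a₂)) monic_one ?_ ?_ ?_ ?_ ?_ ?_ ?_
  · rw [(monic_X_sub_C a₁).natDegree_mul (monic_X_sub_C a₂), natDegree_X_sub_C,
      natDegree_X_sub_C]
    omega
  · simp [hcard]
  · rw [hcard] at hr
    push_cast at hr
    rw [hnc]; linear_combination hr
  · have : (1 : ℂ[X]).nextCoeff = 0 := nextCoeff_C_eq_zero 1
    rw [this]; linear_combination hr
  · intro x
    have : Even (Fintype.card σ - 1 + Fintype.card τ) := ⟨Fintype.card σ, by omega⟩
    rw [this.neg_one_pow]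
    simp
    ring
  · intro t; rw [hX]; simp
  · intro s; rw [hY]; simp

/-- The case of `σ` and `τ` of the same size. -/
lemma cauchy_quadratic_odd [Nonempty σ] (hcard : Fintype.card τ = Fintype.card σ)
    (hq : ∀ t s, β s + δ t - a₁ - a₂ ≠ 0) (hβ : Function.Injective β)
    (hδ : Function.Injective δ) (hw : ∀ s, w s ≠ 0) (hv : ∀ t, v t ≠ 0)
    (hr : r + ∑ s, β s + ∑ t, δ t = Fintype.card τ * (a₁ + a₂) + a₁)
    (hX : ∀ t, v t * z t = (δ t - a₁) * (∏ s, (β s + δ t - a₁ - a₂)) /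
      ∏ t' ∈ Finset.univ.erase t, (δ t - δ t'))
    (hY : ∀ s, u s * w s = (β s - a₁) * (∏ t, (β s + δ t - a₁ - a₂)) /
      ∏ s' ∈ Finset.univ.erase s, (β s - β s')) :
    (cauchy r β u w δ v z (fun t s => β s + δ t - a₁ - a₂) - a₁ • 1) *
      (cauchy r β u w δ v z (fun t s => β s + δ t - a₁ - a₂) - a₂ • 1) = 0 := by
  have hσ : 0 < Fintype.card σ := Fintype.card_pos
  have : Nonempty τ := Fintype.card_pos_iff.mp (by omega)
  -- The two linear factors of `(x - a₁)(x - a₂)` are now shared: `R` evaluated at `a₁ + a₂ - x`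
  -- gives `a₂ - x`, and the odd sign exponent corrects it.
  refine cauchy_quadratic_of_lagrange hq hβ hδ hw hv (R := X - C a₁) (R' := X - C a₁)
    (monic_X_sub_C a₁) (monic_X_sub_C a₁) ?_ ?_ ?_ ?_ ?_ ?_ ?_
  · rw [natDegree_X_sub_C]; omega
  · rw [natDegree_X_sub_C]; omega
  · rw [nextCoeff_X_sub_C, ← hcard]; linear_combination hr
  · rw [nextCoeff_X_sub_C]; linear_combination hr
  · intro x
    have : Odd (Fintype.card σ - 1 + Fintype.card τ) := ⟨Fintype.card σ - 1, by omega⟩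
    rw [this.neg_one_pow]
    simp
    ring
  · intro t; rw [hX]; simp
  · intro s; rw [hY]; simp

end Cauchy

/-! ### Block values of vectors of a given shape -/

section Shape

variable {n : ℕ} {α : Composition n} {x : Fin n → ℂ}

lemma HasShape.apply_eq (h : HasShape α x) (i : Fin n) :
    x i = blockValue α x (α.index i + 1) := by
  have hlt : α.sizeUpTo (α.index i) < n := lt_of_le_of_lt (α.sizeUpTo_index_le i) i.2
  have h1 : blockValue α x (α.index i + 1) = x ⟨α.sizeUpTo (α.index i), hlt⟩ := by
    simp only [blockValue, coord, Nat.add_sub_cancel]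
    rw [dif_pos ⟨Nat.succ_pos _, hlt⟩]
  have hpos : 0 < α.blocksFun (α.index i) := α.one_le_blocksFun _
  rw [h1, h]
  refine (α.index_embedding (α.index i) ⟨0, hpos⟩).symm.trans ?_
  congr 1

lemma HasShape.blockValue_eq (h : HasShape α x) (k : Fin α.length) (j : Fin (α.blocksFun k)) :
    x (α.embedding k j) = blockValue α x (k + 1) := by
  rw [h.apply_eq, α.index_embedding]

lemma HasShape.blockValue_ne (h : HasShape α x) {k l : Fin α.length} (hkl : k ≠ l) :
    blockValue α x (k + 1) ≠ blockValue α x (l + 1) := by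
  rw [← h.blockValue_eq k ⟨0, α.one_le_blocksFun k⟩, ← h.blockValue_eq l ⟨0, α.one_le_blocksFun l⟩,
    Ne, h, α.index_embedding, α.index_embedding]
  exact hkl

lemma HasShape.sum_eq (h : HasShape α x) :
    ∑ i, x i = ∑ k : Fin α.length, (α.blocksFun k : ℂ) * blockValue α x (k + 1) := by
  rw [← α.blocksFinEquiv.sum_comp, Fintype.sum_sigma]
  refine Finset.sum_congr rfl fun k _ => ?_
  refine (Finset.sum_congr rfl fun j _ => h.blockValue_eq k j).trans ?_
  simp

lemma blockValue_ones (z : Fin n → ℂ) {k : ℕ} (h1 : 1 ≤ k) (hk : k ≤ n) :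
    blockValue (Composition.ones n) z k = z ⟨k - 1, by omega⟩ := by
  have hmin : min (k - 1) n = k - 1 := by omega
  simp only [blockValue, coord, Composition.ones_sizeUpTo, hmin, Nat.add_sub_cancel]
  rw [dif_pos (by omega)]

lemma HasShape.injective {z : Fin n → ℂ} (h : HasShape (Composition.ones n) z) :
    Function.Injective z := by
  intro i j hij
  have h1 := (h i j).mp hij
  have key : ∀ i : Fin n, ((Composition.ones n).index i : ℕ) = i := fun i => by
    have h1 := (Composition.ones n).sizeUpTo_index_le i
    have h2 := (Composition.ones n).lt_sizeUpTo_index_succ i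
    simp only [Composition.ones_sizeUpTo] at h1 h2
    have := i.2
    simp at h2
    omega
  exact Fin.ext (by rw [← key i, ← key j, h1])

lemma HasShape.injOn_blockValue {z : Fin n → ℂ} (h : HasShape (Composition.ones n) z) :
    Set.InjOn (blockValue (Composition.ones n) z) (Finset.Icc 1 n) := by
  intro k hk l hl hkl
  rw [Finset.coe_Icc, Set.mem_Icc] at hk hl
  rw [blockValue_ones z hk.1 hk.2, blockValue_ones z hl.1 hl.2] at hkl
  have := Fin.mk.inj_iff.mp (h.injective hkl)
  omega

lemma sum_blockValue_ones (z : Fin n → ℂ) :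
    ∑ i, z i = ∑ k ∈ Finset.Icc 1 n, blockValue (Composition.ones n) z k := by
  rw [← Finset.sum_bij (s := (Finset.univ : Finset (Fin n))) (f := z) fun i _ => (i : ℕ) + 1]
  · intro i _; have := i.2; simp
  · intro i _ j _ h; exact Fin.ext (by omega)
  · intro k hk
    rw [Finset.mem_Icc] at hk
    exact ⟨⟨k - 1, by omega⟩, Finset.mem_univ _, Nat.sub_add_cancel hk.1⟩
  · intro i _
    rw [blockValue_ones z (by omega) (by have := i.2; omega)]
    rfl

end Shape

end Simpson

/-! ### Distinct eigenvalues and the trace relation for each spectral type -/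

namespace SimpsonType

open Simpson

lemma even_data {m : ℕ} {hm : 2 ≤ m} {x y z : Fin (even m hm).dim → ℂ}
    (h : (x, y, z) ∈ S (even m hm).alpha (even m hm).beta (even m hm).gamma) :
    (even m hm).eigA x 1 ≠ (even m hm).eigA x 2 ∧
    ((even m hm).eigB y 1 ≠ (even m hm).eigB y 2 ∧ (even m hm).eigB y 1 ≠ (even m hm).eigB y 3 ∧
      (even m hm).eigB y 2 ≠ (even m hm).eigB y 3) ∧
    Set.InjOn ((even m hm).eigC z) (Finset.Icc 1 (2 * m)) ∧
    m * (even m hm).eigA x 1 + m * (even m hm).eigA x 2 = (even m hm).eigB y 1 +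
      (m - 1) * (even m hm).eigB y 2 + m * (even m hm).eigB y 3 +
      ∑ k ∈ Finset.Icc 1 (2 * m), (even m hm).eigC z k := by
  obtain ⟨hx, hy, hz, hs⟩ := h
  refine ⟨?_, ⟨?_, ?_, ?_⟩, hz.injOn_blockValue, ?_⟩
  · exact hx.blockValue_ne (k := (0 : Fin 2)) (l := (1 : Fin 2))
      (show (0 : Fin 2) ≠ 1 by decide)
  · exact hy.blockValue_ne (k := (0 : Fin 3)) (l := (1 : Fin 3))
      (show (0 : Fin 3) ≠ 1 by decide)
  · exact hy.blockValue_ne (k := (0 : Fin 3)) (l := (2 : Fin 3))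
      (show (0 : Fin 3) ≠ 2 by decide)
  · exact hy.blockValue_ne (k := (1 : Fin 3)) (l := (2 : Fin 3))
      (show (1 : Fin 3) ≠ 2 by decide)
  · have e1 := hx.sum_eq
    have e2 := hy.sum_eq
    have e3 := sum_blockValue_ones z
    have e1' : ∑ i, x i = m * (even m hm).eigA x 1 + m * (even m hm).eigA x 2 :=
      e1.trans (Fin.sum_univ_two _)
    have e2' : ∑ i, y i = (1 : ℕ) * (even m hm).eigB y 1 + (m - 1 : ℕ) * (even m hm).eigB y 2 +
      m * (even m hm).eigB y 3 := e2.trans (Fin.sum_univ_three _)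
    rw [Finset.sum_add_distrib] at hs
    rw [← e1', hs, e2', e3, Nat.cast_sub (by omega)]
    push_cast
    rw [one_mul]
    rfl

lemma odd_data {m : ℕ} {hm : 2 ≤ m} {x y z : Fin (odd m hm).dim → ℂ}
    (h : (x, y, z) ∈ S (odd m hm).alpha (odd m hm).beta (odd m hm).gamma) :
    (odd m hm).eigA x 1 ≠ (odd m hm).eigA x 2 ∧
    ((odd m hm).eigB y 1 ≠ (odd m hm).eigB y 2 ∧ (odd m hm).eigB y 1 ≠ (odd m hm).eigB y 3 ∧
      (odd m hm).eigB y 2 ≠ (odd m hm).eigB y 3) ∧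
    Set.InjOn ((odd m hm).eigC z) (Finset.Icc 1 (2 * m + 1)) ∧
    (m + 1) * (odd m hm).eigA x 1 + m * (odd m hm).eigA x 2 = (odd m hm).eigB y 1 +
      m * (odd m hm).eigB y 2 + m * (odd m hm).eigB y 3 +
      ∑ k ∈ Finset.Icc 1 (2 * m + 1), (odd m hm).eigC z k := by
  obtain ⟨hx, hy, hz, hs⟩ := h
  refine ⟨?_, ⟨?_, ?_, ?_⟩, hz.injOn_blockValue, ?_⟩
  · exact hx.blockValue_ne (k := (0 : Fin 2)) (l := (1 : Fin 2))
      (show (0 : Fin 2) ≠ 1 by decide)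
  · exact hy.blockValue_ne (k := (0 : Fin 3)) (l := (1 : Fin 3))
      (show (0 : Fin 3) ≠ 1 by decide)
  · exact hy.blockValue_ne (k := (0 : Fin 3)) (l := (2 : Fin 3))
      (show (0 : Fin 3) ≠ 2 by decide)
  · exact hy.blockValue_ne (k := (1 : Fin 3)) (l := (2 : Fin 3))
      (show (1 : Fin 3) ≠ 2 by decide)
  · have e1 := hx.sum_eq
    have e2 := hy.sum_eq
    have e3 := sum_blockValue_ones z
    have e1' : ∑ i, x i = (m + 1 : ℕ) * (odd m hm).eigA x 1 + m * (odd m hm).eigA x 2 :=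
      e1.trans (Fin.sum_univ_two _)
    have e2' : ∑ i, y i = (1 : ℕ) * (odd m hm).eigB y 1 + m * (odd m hm).eigB y 2 +
      m * (odd m hm).eigB y 3 := e2.trans (Fin.sum_univ_three _)
    rw [Finset.sum_add_distrib, e1', e2', e3] at hs
    push_cast at hs
    rw [hs, one_mul]
    rfl

lemma extra_data {x y z : Fin extra.dim → ℂ}
    (h : (x, y, z) ∈ S extra.alpha extra.beta extra.gamma) :
    extra.eigA x 1 ≠ extra.eigA x 2 ∧
    (extra.eigB y 1 ≠ extra.eigB y 2 ∧ extra.eigB y 1 ≠ extra.eigB y 3 ∧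
      extra.eigB y 2 ≠ extra.eigB y 3) ∧
    Set.InjOn (extra.eigC z) (Finset.Icc 1 6) ∧
    4 * extra.eigA x 1 + 2 * extra.eigA x 2 = 2 * extra.eigB y 1 + 2 * extra.eigB y 2 +
      2 * extra.eigB y 3 + ∑ k ∈ Finset.Icc 1 6, extra.eigC z k := by
  obtain ⟨hx, hy, hz, hs⟩ := h
  refine ⟨?_, ⟨?_, ?_, ?_⟩, hz.injOn_blockValue, ?_⟩
  · exact hx.blockValue_ne (k := (0 : Fin 2)) (l := (1 : Fin 2))
      (show (0 : Fin 2) ≠ 1 by decide)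
  · exact hy.blockValue_ne (k := (0 : Fin 3)) (l := (1 : Fin 3))
      (show (0 : Fin 3) ≠ 1 by decide)
  · exact hy.blockValue_ne (k := (0 : Fin 3)) (l := (2 : Fin 3))
      (show (0 : Fin 3) ≠ 2 by decide)
  · exact hy.blockValue_ne (k := (1 : Fin 3)) (l := (2 : Fin 3))
      (show (1 : Fin 3) ≠ 2 by decide)
  · have e1 := hx.sum_eq
    have e2 := hy.sum_eq
    have e3 := sum_blockValue_ones z
    have e1' : ∑ i, x i = (4 : ℕ) * extra.eigA x 1 + (2 : ℕ) * extra.eigA x 2 :=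
      e1.trans (Fin.sum_univ_two _)
    have e2' : ∑ i, y i = (2 : ℕ) * extra.eigB y 1 + (2 : ℕ) * extra.eigB y 2 +
      (2 : ℕ) * extra.eigB y 3 := e2.trans (Fin.sum_univ_three _)
    rw [Finset.sum_add_distrib, e1', e2', e3] at hs
    push_cast at hs
    exact hs

lemma hypergeometric_data {m : ℕ} {hm : 2 ≤ m} {x y z : Fin (hypergeometric m hm).dim → ℂ}
    (h : (x, y, z) ∈ S (hypergeometric m hm).alpha (hypergeometric m hm).beta
      (hypergeometric m hm).gamma) :
    (hypergeometric m hm).eigA x 1 ≠ (hypergeometric m hm).eigA x 2 ∧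
    Set.InjOn ((hypergeometric m hm).eigB y) (Finset.Icc 1 m) ∧
    Set.InjOn ((hypergeometric m hm).eigC z) (Finset.Icc 1 m) ∧
    (hypergeometric m hm).eigA x 1 + (m - 1) * (hypergeometric m hm).eigA x 2 =
      ∑ k ∈ Finset.Icc 1 m, (hypergeometric m hm).eigB y k +
      ∑ k ∈ Finset.Icc 1 m, (hypergeometric m hm).eigC z k := by
  obtain ⟨hx, hy, hz, hs⟩ := h
  refine ⟨?_, HasShape.injOn_blockValue hy, hz.injOn_blockValue, ?_⟩
  · exact hx.blockValue_ne (k := (0 : Fin 2)) (l := (1 : Fin 2))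
      (show (0 : Fin 2) ≠ 1 by decide)
  · have e1 := hx.sum_eq
    have e2 := sum_blockValue_ones y
    have e3 := sum_blockValue_ones z
    have e1' : ∑ i, x i = (1 : ℕ) * (hypergeometric m hm).eigA x 1 +
      (m - 1 : ℕ) * (hypergeometric m hm).eigA x 2 := e1.trans (Fin.sum_univ_two _)
    rw [Finset.sum_add_distrib, e1', e2, e3, Nat.cast_sub (by omega)] at hs
    push_cast at hs
    rw [one_mul] at hs
    exact hs

end SimpsonType

namespace Simpson

/-! ### Products of linear forms in the matrix entries -/

section Products

open Finset

lemma sum_fin_rev_eq_sum_Icc (m : ℕ) (f : ℕ → ℂ) :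
    ∑ i : Fin m, f (m - i) = ∑ k ∈ Icc 1 m, f k := by
  refine sum_bij (fun i _ => m - i) ?_ ?_ ?_ ?_
  · intro i _; have := i.2; rw [mem_Icc]; omega
  · intro i _ j _ h; have := i.2; have := j.2; exact Fin.ext (by omega)
  · intro k hk
    rw [mem_Icc] at hk
    exact ⟨⟨m - k, by omega⟩, mem_univ _, Nat.sub_sub_self hk.2⟩
  · exact fun _ _ => rfl

lemma prod_Icc_mul_prod_Icc {f : ℕ → ℂ} {i j k : ℕ} (hij : i ≤ j + 1) (hjk : j ≤ k) :
    (∏ l ∈ Icc i j, f l) * ∏ l ∈ Icc (j + 1) k, f l = ∏ l ∈ Icc i k, f l := by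
  rw [← prod_union]
  · congr 1; ext l; simp only [mem_union, mem_Icc]; omega
  · rw [disjoint_left]; intro l; simp only [mem_Icc]; omega

/-- The first column of `C` in the rows of the second block. -/
noncomputable def famU (M : ℕ) (c : ℕ → ℂ) (q : ℕ → ℕ → ℂ) (s : ℕ) : ℂ :=
  (∏ k ∈ Icc 1 (M - s), q k s) / ∏ k ∈ Icc (s + 1) (M - 1), (c s - c k)

/-- The first row of `B` in the columns of the second block. -/
noncomputable def famW (M m : ℕ) (c : ℕ → ℂ) (q : ℕ → ℕ → ℂ) (s : ℕ) : ℂ :=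
  (-1) ^ (s - (m + 1)) * (∏ k ∈ Icc (M - s + 1) m, q k s) / ∏ k ∈ Icc (m + 1) (s - 1), (c k - c s)

/-- The first row of `B` in the columns of the third block. -/
noncomputable def famV (M : ℕ) (c : ℕ → ℂ) (q : ℕ → ℕ → ℂ) (t : ℕ) : ℂ :=
  (-1) ^ (t - 1) * (∏ k ∈ Icc (M + 1 - t) (M - 1), q t k) / ∏ k ∈ Icc 1 (t - 1), (c k - c t)

/-- The first column of `C` in the rows of the third block. -/
noncomputable def famZ (M m : ℕ) (c : ℕ → ℂ) (q : ℕ → ℕ → ℂ) (t : ℕ) : ℂ :=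
  (∏ k ∈ Icc (m + 1) (M - t), q t k) / ∏ k ∈ Icc (t + 1) m, (c t - c k)

variable {c : ℕ → ℂ} {q : ℕ → ℕ → ℂ} {M m s t : ℕ}

/-- The two products run over labels above and below `s`; orienting all differences as `c s - c k`
costs one sign for each lower label. -/
lemma prod_sub_mul_prod_sub {i j : ℕ} (hi : 1 ≤ i) (his : i ≤ s) (hsj : s ≤ j) :
    (∏ k ∈ Icc (s + 1) j, (c s - c k)) * ∏ k ∈ Icc i (s - 1), (c k - c s) =
      (-1) ^ (s - i) * ∏ k ∈ (Icc i j).erase s, (c s - c k) := by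
  have h1 : ∏ k ∈ Icc i (s - 1), (c k - c s) =
      (-1) ^ (s - i) * ∏ k ∈ Icc i (s - 1), (c s - c k) := by
    have : s - i = (Icc i (s - 1)).card := by rw [Nat.card_Icc]; omega
    rw [this, ← prod_const, ← prod_mul_distrib]
    exact prod_congr rfl fun k _ => by ring
  have h2 : (Icc i j).erase s = Icc (s + 1) j ∪ Icc i (s - 1) := by
    ext l; simp only [mem_union, mem_Icc, mem_erase]; omega
  rw [h1, h2, prod_union]
  · ring
  · rw [disjoint_left]; intro l; simp only [mem_Icc]; omega

lemma neg_one_pow_mul_div (e : ℕ) (x y : ℂ) : (-1) ^ e * x / ((-1) ^ e * y) = x / y :=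
  mul_div_mul_left _ _ (by simp)

/-- The numerators run over complementary ranges, so their product is complete; the signs in `famW`
cancel those from the denominators. -/
lemma famU_mul_famW (hs : s ∈ Icc (m + 1) (M - 1)) (hM : M ≤ 2 * m + 1) :
    famU M c q s * famW M m c q s = (∏ k ∈ Icc 1 m, q k s) /
      ∏ k ∈ (Icc (m + 1) (M - 1)).erase s, (c s - c k) := by
  rw [mem_Icc] at hs
  rw [famU, famW, div_mul_div_comm, prod_sub_mul_prod_sub (by omega) hs.1 hs.2,
    mul_left_comm, neg_one_pow_mul_div, prod_Icc_mul_prod_Icc (by omega) (by omega)]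

lemma famV_mul_famZ (ht : t ∈ Icc 1 m) (hM : 2 * m ≤ M) :
    famV M c q t * famZ M m c q t = (∏ k ∈ Icc (m + 1) (M - 1), q t k) /
      ∏ k ∈ (Icc 1 m).erase t, (c t - c k) := by
  rw [mem_Icc] at ht
  have : M + 1 - t = M - t + 1 := by omega
  rw [famV, famZ, div_mul_div_comm, mul_comm (∏ k ∈ Icc 1 (t - 1), _),
    prod_sub_mul_prod_sub le_rfl ht.1 ht.2, mul_assoc, neg_one_pow_mul_div,
    mul_comm (∏ k ∈ Icc (M + 1 - t) (M - 1), _), this,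
    prod_Icc_mul_prod_Icc (by omega) (by omega)]

/-- The common factor `f t = g s` occurs in exactly one of the two products, so erasing in both
removes it once. -/
lemma prod_erase_mul_prod_erase {F G : Finset ℕ} {f g : ℕ → ℂ} (hfg : f t = g s) (hne : f t ≠ 0)
    (h : t ∈ F ↔ s ∉ G) :
    (∏ k ∈ F.erase t, f k) * ∏ k ∈ G.erase s, g k = (∏ k ∈ F, f k) * (∏ k ∈ G, g k) / f t := by
  rw [eq_div_iff hne]
  by_cases ht : t ∈ F
  · rw [erase_eq_of_notMem (h.mp ht), ← prod_erase_mul F f ht]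
    ring
  · have hs : s ∈ G := not_not.mp fun hs => ht (h.mpr hs)
    rw [erase_eq_of_notMem ht, ← prod_erase_mul G g hs, hfg]
    ring

/-- Explains the erased indices in the second-to-third block: `q t s` occurs in exactly one of the
two ranges, because `t ≤ M - s` fails exactly when `M + 1 - t ≤ s`. The entry is thus a rank-one
product divided by `q t s`, a Cauchy type entry. -/
lemma famU_mul_famV_div (hs : s ∈ Icc (m + 1) (M - 1)) (ht : t ∈ Icc 1 m)
    (hq : q t s ≠ 0) :
    (-1) ^ (t - 1) * ((∏ k ∈ (Icc 1 (M - s)).erase t, q k s) *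
      ∏ k ∈ (Icc (M + 1 - t) (M - 1)).erase s, q t k) /
      ((∏ k ∈ Icc (s + 1) (M - 1), (c s - c k)) * ∏ k ∈ Icc 1 (t - 1), (c k - c t)) =
      famU M c q s * famV M c q t / q t s := by
  rw [mem_Icc] at hs ht
  rw [prod_erase_mul_prod_erase (f := fun k => q k s) (g := fun k => q t k) rfl hq
    (by simp only [mem_Icc]; omega), famU, famV]
  ring

lemma famZ_mul_famW_div (hs : s ∈ Icc (m + 1) (M - 1)) (ht : t ∈ Icc 1 m)
    (hq : q t s ≠ 0) :
    (-1) ^ (s - (m + 1)) * ((∏ k ∈ (Icc (m + 1) (M - t)).erase s, q t k) *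
      ∏ k ∈ (Icc (M - s + 1) m).erase t, q k s) /
      ((∏ k ∈ Icc (t + 1) m, (c t - c k)) * ∏ k ∈ Icc (m + 1) (s - 1), (c k - c s)) =
      famZ M m c q t * famW M m c q s / q t s := by
  rw [mem_Icc] at hs ht
  rw [mul_comm (∏ k ∈ (Icc (m + 1) (M - t)).erase s, _),
    prod_erase_mul_prod_erase (f := fun k => q k s) (g := fun k => q t k) rfl hq
    (by simp only [mem_Icc]; omega), famZ, famW]
  ring

lemma famW_ne_zero (hs : s ∈ Icc (m + 1) (M - 1)) (hc : Set.InjOn c (Icc 1 M))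
    (hq : ∀ t ∈ Icc 1 m, q t s ≠ 0) : famW M m c q s ≠ 0 := by
  rw [mem_Icc] at hs
  refine div_ne_zero (mul_ne_zero (by simp) (prod_ne_zero_iff.mpr fun k hk => hq k ?_))
    (prod_ne_zero_iff.mpr fun k hk => sub_ne_zero.mpr fun h => ?_)
  · simp only [mem_Icc] at *; omega
  · rw [mem_Icc] at hk
    have := hc (by simp; omega) (by simp; omega) h
    omega

lemma famV_ne_zero (ht : t ∈ Icc 1 m) (hM : 2 * m ≤ M) (hc : Set.InjOn c (Icc 1 M))
    (hq : ∀ s ∈ Icc (m + 1) (M - 1), q t s ≠ 0) : famV M c q t ≠ 0 := by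
  rw [mem_Icc] at ht
  refine div_ne_zero (mul_ne_zero (by simp) (prod_ne_zero_iff.mpr fun k hk => hq k ?_))
    (prod_ne_zero_iff.mpr fun k hk => sub_ne_zero.mpr fun h => ?_)
  · simp only [mem_Icc] at *; omega
  · rw [mem_Icc] at hk
    have := hc (by simp; omega) (by simp; omega) h
    omega

end Products

/-! ### Block triangular pairs and their relabelling -/

section Blocks

open Finset

/-- Block upper triangular entries with block sizes `1`, `k - 1` and the rest. -/
noncomputable def blockUpper (k : ℕ) (b f₁₂ f₁₃ : ℕ → ℂ) (f₂₃ : ℕ → ℕ → ℂ) (r s : ℕ) : ℂ :=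
  if r = s then (if r = 1 then b 1 else if r ≤ k then b 2 else b 3)
  else if r = 1 ∧ s ≤ k then f₁₂ (s - 1)
  else if r = 1 then f₁₃ (s - k)
  else if r ≤ k ∧ k < s then f₂₃ (r - 1) (s - k)
  else 0

/-- Block lower triangular entries with block sizes `1`, `k - 1` and the rest. -/
noncomputable def blockLower (M k : ℕ) (c f₂₁ f₃₁ : ℕ → ℂ) (f₃₂ : ℕ → ℕ → ℂ) (r s : ℕ) : ℂ :=
  if r = s then c (M + 1 - r)
  else if s = 1 ∧ r ≤ k then f₂₁ (r - 1)
  else if s = 1 then f₃₁ (r - k)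
  else if s ≤ k ∧ k < r then f₃₂ (r - k) (s - 1)
  else 0

/-- The index of the block that contains a position. -/
def blockLevel (k : ℕ) {M : ℕ} (i : Fin M) : Fin 3 :=
  if (i : ℕ) = 0 then 0 else if (i : ℕ) < k then 1 else 2

/-- Positions are labelled by `1, …, M` in decreasing order. -/
def labelPosition {m M : ℕ} (hm : m < M) : Unit ⊕ Icc (m + 1) (M - 1) ⊕ Icc 1 m → Fin M
  | .inl _ => ⟨0, by omega⟩
  | .inr (.inl s) => ⟨M - s, by have := mem_Icc.mp s.2; omega⟩
  | .inr (.inr t) => ⟨M - t, by have := mem_Icc.mp t.2; omega⟩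

lemma labelPosition_bijective {m M : ℕ} (hm : m < M) : Function.Bijective (labelPosition hm) := by
  rw [Fintype.bijective_iff_surjective_and_card]
  refine ⟨?_, ?_⟩
  · intro i
    have := i.2
    by_cases h0 : (i : ℕ) = 0
    · exact ⟨.inl (), Fin.ext h0.symm⟩
    by_cases h1 : (i : ℕ) < M - m
    · exact ⟨.inr (.inl ⟨M - i, by rw [mem_Icc]; omega⟩), Fin.ext (by simp [labelPosition]; omega)⟩
    · exact ⟨.inr (.inr ⟨M - i, by rw [mem_Icc]; omega⟩), Fin.ext (by simp [labelPosition]; omega)⟩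
  · simp only [Fintype.card_sum, Fintype.card_unit, Fintype.card_coe, Nat.card_Icc,
      Fintype.card_fin]
    omega

/-- The bijection between labels, grouped into blocks, and positions. -/
noncomputable def labelEquiv {m M : ℕ} (hm : m < M) :
    Unit ⊕ Icc (m + 1) (M - 1) ⊕ Icc 1 m ≃ Fin M :=
  Equiv.ofBijective _ (labelPosition_bijective hm)

/-- Each position is labelled by the index of the eigenvalue of `C` standing there on the diagonal,
which runs backwards. In these labels the sum of the two triangular matrices has the Cauchy form. -/
lemma submatrix_labelEquiv {m M : ℕ} (hm : m < M) {b c f₁₂ f₁₃ f₂₁ f₃₁ U W V Z : ℕ → ℂ}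
    {f₂₃ f₃₂ q : ℕ → ℕ → ℂ}
    (h₁₂ : ∀ s ∈ Icc (m + 1) (M - 1), f₁₂ (M - s) = W s)
    (h₁₃ : ∀ t ∈ Icc 1 m, f₁₃ (m + 1 - t) = V t)
    (h₂₁ : ∀ s ∈ Icc (m + 1) (M - 1), f₂₁ (M - s) = -U s)
    (h₃₁ : ∀ t ∈ Icc 1 m, f₃₁ (m + 1 - t) = -Z t)
    (h₂₃ : ∀ s ∈ Icc (m + 1) (M - 1), ∀ t ∈ Icc 1 m,
      f₂₃ (M - s) (m + 1 - t) = U s * V t / q t s)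
    (h₃₂ : ∀ s ∈ Icc (m + 1) (M - 1), ∀ t ∈ Icc 1 m,
      f₃₂ (m + 1 - t) (M - s) = Z t * W s / q t s) :
    (ofEntries M (blockUpper (M - m) b f₁₂ f₁₃ f₂₃) +
      ofEntries M (blockLower M (M - m) c f₂₁ f₃₁ f₃₂)).submatrix (labelEquiv hm) (labelEquiv hm) =
    cauchy (b 1 + c M) (fun s : Icc (m + 1) (M - 1) => b 2 + c s) (fun s => U s) (fun s => W s)
      (fun t : Icc 1 m => b 3 + c t) (fun t => V t) (fun t => Z t) (fun t s => q t s) := by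
  ext x y
  rcases x with ⟨⟩ | ⟨s, hs⟩ | ⟨t, ht⟩ <;> rcases y with ⟨⟩ | ⟨s', hs'⟩ | ⟨t', ht'⟩ <;>
    simp only [Matrix.submatrix_apply, Matrix.add_apply, ofEntries, Matrix.of_apply, labelEquiv,
      Equiv.ofBijective_apply, labelPosition, cauchy, blockUpper, blockLower, Subtype.mk.injEq]
  · simp
  · have := mem_Icc.mp hs'
    split_ifs <;> first | (exfalso; omega) |
      (exfalso; simp only [true_and] at *; omega) |
      rw [Nat.add_sub_cancel, h₁₂ _ hs', add_zero]
  · have := mem_Icc.mp ht'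
    split_ifs <;> first | (exfalso; omega) |
      rw [show M - t' + 1 - (M - m) = m + 1 - t' by omega, h₁₃ _ ht', add_zero]
  · have := mem_Icc.mp hs
    split_ifs <;> first | (exfalso; omega) |
      (exfalso; simp only [true_and] at *; omega) |
      rw [Nat.add_sub_cancel, h₂₁ _ hs, zero_add]
  · have := mem_Icc.mp hs
    have := mem_Icc.mp hs'
    split_ifs <;> first | (exfalso; omega) | rw [show M + 1 - (M - s + 1) = s by omega] |
      rw [add_zero]
  · have := mem_Icc.mp hs
    have := mem_Icc.mp ht'
    split_ifs <;> first | (exfalso; omega) | rw [Nat.add_sub_cancel,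
      show M - t' + 1 - (M - m) = m + 1 - t' by omega, h₂₃ _ hs _ ht', add_zero]
  · have := mem_Icc.mp ht
    split_ifs <;> first | (exfalso; omega) |
      rw [show M - t + 1 - (M - m) = m + 1 - t by omega, h₃₁ _ ht, zero_add]
  · have := mem_Icc.mp ht
    have := mem_Icc.mp hs'
    split_ifs <;> first | (exfalso; omega) | rw [Nat.add_sub_cancel,
      show M - t + 1 - (M - m) = m + 1 - t by omega, h₃₂ _ hs' _ ht, zero_add]
  · have := mem_Icc.mp ht
    have := mem_Icc.mp ht'
    split_ifs <;> first | (exfalso; omega) | rw [show M + 1 - (M - t + 1) = t by omega] |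
      rw [add_zero]

/-- Irreducibility of block triangular pairs with a quadratic sum. -/
lemma isIrreducibleTriple_block {m M : ℕ} (hm : m < M) (hm1 : 1 ≤ m) {a b c f₁₂ f₁₃ f₂₁ f₃₁ : ℕ → ℂ}
    {f₂₃ f₃₂ : ℕ → ℕ → ℂ} {X : Matrix (Unit ⊕ Icc (m + 1) (M - 1) ⊕ Icc 1 m)
      (Unit ⊕ Icc (m + 1) (M - 1) ⊕ Icc 1 m) ℂ}
    (hX : (ofEntries M (blockUpper (M - m) b f₁₂ f₁₃ f₂₃) +
      ofEntries M (blockLower M (M - m) c f₂₁ f₃₁ f₃₂)).submatrix (labelEquiv hm) (labelEquiv hm) =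
        X)
    (hquad : (X - a 1 • 1) * (X - a 2 • 1) = 0)
    (ha : a 1 ≠ a 2) (hb : b 1 ≠ b 2 ∧ b 1 ≠ b 3 ∧ b 2 ≠ b 3) (hc : Set.InjOn c (Icc 1 M))
    {k₁ k₂ : ℕ} (hk : k₁ + k₂ = M)
    (ht : k₁ * a 1 + k₂ * a 2 = b 1 + (M - m - 1 : ℕ) * b 2 + m * b 3 + ∑ k ∈ Icc 1 M, c k)
    (H : ∀ L : List ((Fin 2 → ℕ) × (Fin 3 → ℕ) × (Fin M → ℕ)),
      (∀ t ∈ L, Admissible ![a 1, a 2] ![b 1, b 2, b 3] (fun i : Fin M => c (M - i)) t) →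
      2 ≤ L.length → L.sum = (![k₁, k₂], ![1, M - m - 1, m], fun _ => 1) → False) :
    IsIrreducibleTriple (ofEntries M (blockUpper (M - m) b f₁₂ f₁₃ f₂₃) +
      ofEntries M (blockLower M (M - m) c f₂₁ f₃₁ f₃₂))
      (ofEntries M (blockUpper (M - m) b f₁₂ f₁₃ f₂₃))
      (ofEntries M (blockLower M (M - m) c f₂₁ f₃₁ f₃₂)) := by
  have hcard : ∀ j, (univ.filter fun i : Fin M => blockLevel (M - m) i = j).card =
      ![1, M - m - 1, m] j := by
    have hl : ∀ j, (univ.filter fun i : Fin M => blockLevel (M - m) i = j).card =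
        (univ.filter fun x => blockLevel (M - m) (labelEquiv hm x) = j).card := fun j => by
      rw [← card_map (labelEquiv hm).toEmbedding]
      congr 1
      ext i
      simp only [mem_filter, mem_univ, true_and, mem_map_equiv, Equiv.apply_symm_apply]
    have e1 : blockLevel (M - m) (labelEquiv hm (.inl ())) = 0 := by
      simp [labelEquiv, labelPosition, blockLevel]
    have e2 : ∀ s, blockLevel (M - m) (labelEquiv hm (.inr (.inl s))) = 1 := fun s => by
      have := mem_Icc.mp s.2
      simp only [labelEquiv, labelPosition, blockLevel, Equiv.ofBijective_apply]
      rw [if_neg (by omega), if_pos (by omega)]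
    have e3 : ∀ t, blockLevel (M - m) (labelEquiv hm (.inr (.inr t))) = 2 := fun t => by
      have := mem_Icc.mp t.2
      simp only [labelEquiv, labelPosition, blockLevel, Equiv.ofBijective_apply]
      rw [if_neg (by omega), if_neg (by omega)]
    intro j
    rw [hl, card_filter, Fintype.sum_sum_type, Fintype.sum_sum_type]
    fin_cases j <;> simp [e1, e2, e3]
    omega
  have hdiag : ∀ i, ofEntries M (blockUpper (M - m) b f₁₂ f₁₃ f₂₃) i i =
      ![b 1, b 2, b 3] (blockLevel (M - m) i) := fun i => by
    simp only [ofEntries, Matrix.of_apply, blockUpper, blockLevel, if_true]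
    split_ifs <;> first | rfl | omega
  have hdiag' : ∀ i, ofEntries M (blockLower M (M - m) c f₂₁ f₃₁ f₃₂) i i = c (M - i) := fun i => by
    simp only [ofEntries, Matrix.of_apply, blockLower, if_true]
    congr 1; omega
  refine isIrreducibleTriple_of_level (by omega) ha hb.1 hb.2.1 hb.2.2 (ℓ := blockLevel (M - m))
    ?_ ?_ hdiag (c := fun i : Fin M => c (M - i)) ?_ ?_ hdiag' ?_ hk ?_ hcard H
  · intro i j hij
    have : (i : ℕ) ≤ j := hij
    simp only [blockLevel]
    split_ifs <;> first | decide | omega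
  · intro i j hij hlt
    have hij : (i : ℕ) ≠ j := fun h => hij (Fin.ext h)
    simp only [ofEntries, Matrix.of_apply, blockUpper]
    simp only [blockLevel] at hlt
    rw [if_neg (by omega)]
    split_ifs at hlt ⊢ <;> first | rfl | omega
  · intro i j h
    have := i.2
    have := j.2
    have := hc (by simp; omega) (by simp; omega) h
    exact Fin.ext (by omega)
  · intro i j hij
    have : (i : ℕ) < j := hij
    simp only [ofEntries, Matrix.of_apply, blockLower]
    split_ifs <;> first | rfl | omega
  -- The quadratic relation, known in labels, is carried back to positions through the bijection.
  · have hsub : ∀ (e : ℂ), (ofEntries M (blockUpper (M - m) b f₁₂ f₁₃ f₂₃) +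
        ofEntries M (blockLower M (M - m) c f₂₁ f₃₁ f₃₂) - e • 1).submatrix (labelEquiv hm)
        (labelEquiv hm) = X - e • 1 := fun e => by
      rw [← hX]; ext x y; simp [Matrix.one_apply]
    have h := Matrix.submatrix_mul_equiv
      (ofEntries M (blockUpper (M - m) b f₁₂ f₁₃ f₂₃) +
        ofEntries M (blockLower M (M - m) c f₂₁ f₃₁ f₃₂) - a 1 • 1)
      (ofEntries M (blockUpper (M - m) b f₁₂ f₁₃ f₂₃) +
        ofEntries M (blockLower M (M - m) c f₂₁ f₃₁ f₃₂) - a 2 • 1)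
      (labelEquiv hm) (labelEquiv hm) (labelEquiv hm)
    rw [hsub, hsub, hquad] at h
    ext i j
    have := congrFun (congrFun h ((labelEquiv hm).symm i)) ((labelEquiv hm).symm j)
    simpa using this.symm
  -- The trace of the upper triangular matrix, grouped by diagonal blocks.
  · have e1 : ∑ i : Fin M, ![b 1, b 2, b 3] (blockLevel (M - m) i) =
        b 1 + (M - m - 1 : ℕ) * b 2 + m * b 3 := by
      rw [← sum_fiberwise univ (blockLevel (M - m)),
        sum_congr rfl fun j _ => (sum_congr rfl fun i hi => by rw [(mem_filter.mp hi).2] :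
          _ = ∑ i ∈ univ.filter fun i : Fin M => blockLevel (M - m) i = j, ![b 1, b 2, b 3] j)]
      simp [hcard, Fin.sum_univ_three]
    rw [ht, Matrix.trace_add, Matrix.trace, Matrix.trace]
    simp only [Matrix.diag_apply, hdiag, hdiag']
    rw [e1, sum_fin_rev_eq_sum_Icc]

end Blocks

/-! ### The even and odd families -/

section EvenOdd

open Finset

lemma prod_univ_erase_coe {F : Finset ℕ} (t : F) (g : ℕ → ℂ) :
    ∏ t' ∈ univ.erase t, g t' = ∏ k ∈ F.erase t, g k := by
  refine prod_bij (fun x _ => (x : ℕ)) ?_ ?_ ?_ ?_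
  · intro x hx
    exact mem_erase.mpr ⟨fun h => (mem_erase.mp hx).1 (Subtype.ext h), x.2⟩
  · exact fun x _ y _ h => Subtype.ext h
  · intro k hk
    obtain ⟨h1, h2⟩ := mem_erase.mp hk
    exact ⟨⟨k, h2⟩, mem_erase.mpr ⟨fun h => h1 (congrArg Subtype.val h), mem_univ _⟩, rfl⟩
  · exact fun _ _ => rfl

lemma sum_labels {m M : ℕ} (hm : m < M) (b c : ℕ → ℂ) :
    b 1 + c M + ∑ s : Icc (m + 1) (M - 1), (b 2 + c s) + ∑ t : Icc 1 m, (b 3 + c t) =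
      b 1 + (M - m - 1 : ℕ) * b 2 + m * b 3 + ∑ k ∈ Icc 1 M, c k := by
  have h1 : Icc 1 M = insert M (Icc (m + 1) (M - 1) ∪ Icc 1 m) := by
    ext k; simp only [mem_Icc, mem_insert, mem_union]; omega
  have h2 : M ∉ Icc (m + 1) (M - 1) ∪ Icc 1 m := by
    simp only [mem_Icc, mem_union]; omega
  have h3 : Disjoint (Icc (m + 1) (M - 1)) (Icc 1 m) := by
    rw [disjoint_left]; intro k; simp only [mem_Icc]; omega
  have h4 : M - 1 + 1 - (m + 1) = M - m - 1 := by omega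
  rw [h1, sum_insert h2, sum_union h3, sum_coe_sort (Icc (m + 1) (M - 1)) fun k => b 2 + c k,
    sum_coe_sort (Icc 1 m) fun k => b 3 + c k, sum_add_distrib, sum_add_distrib, sum_const,
    sum_const, Nat.card_Icc, Nat.card_Icc, h4, Nat.add_sub_cancel, nsmul_eq_mul, nsmul_eq_mul]
  ring

lemma q_eq (a b c : ℕ → ℂ) (i j : ℕ) :
    q a b c i j = b 2 + c j + (b 3 + c i) - a 1 - a 2 := by
  simp only [q]; ring

lemma injective_add_coe {c : ℕ → ℂ} {F G : Finset ℕ} (hc : Set.InjOn c G) (h : F ⊆ G) (x : ℂ) :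
    Function.Injective fun s : F => x + c s := fun s t hst =>
  Subtype.ext (hc (h s.2) (h t.2) (add_left_cancel hst))

lemma isIrreducibleTriple_even {m : ℕ} (hm : 2 ≤ m) {a b c : ℕ → ℂ} (ha : a 1 ≠ a 2)
    (hb : b 1 ≠ b 2 ∧ b 1 ≠ b 3 ∧ b 2 ≠ b 3) (hc : Set.InjOn c (Icc 1 (2 * m)))
    (ht : m * a 1 + m * a 2 = b 1 + (m - 1) * b 2 + m * b 3 + ∑ k ∈ Icc 1 (2 * m), c k)
    (hq : ∀ i ∈ Icc 1 (2 * m), ∀ j ∈ Icc 1 (2 * m), i ≠ j → q a b c i j ≠ 0)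
    (h₁ : ∀ i ∈ Icc 1 (2 * m), p a b c i 3 1 ≠ 0)
    (h₂ : ∀ i ∈ Icc 1 (2 * m), p a b c i 3 2 ≠ 0) :
    IsIrreducibleTriple (ofEntries (2 * m) (evenB m a b c) + ofEntries (2 * m) (evenC m a b c))
      (ofEntries (2 * m) (evenB m a b c)) (ofEntries (2 * m) (evenC m a b c)) := by
  have e : 2 * m - m = m := by omega
  have hs : Icc (m + 1) (2 * m - 1) ⊆ Icc 1 (2 * m) := Icc_subset_Icc (by omega) (by omega)
  have ht' : Icc 1 m ⊆ Icc 1 (2 * m) := Icc_subset_Icc le_rfl (by omega)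
  have hq' : ∀ s ∈ Icc (m + 1) (2 * m - 1), ∀ t ∈ Icc 1 m, q a b c t s ≠ 0 := fun s hs' t ht1 =>
    hq t (ht' ht1) s (hs hs') (by rw [mem_Icc] at *; omega)
  have hpos : ∀ i : Fin (2 * m), 2 * m - (i : ℕ) ∈ Icc 1 (2 * m) := fun i => by
    have := i.2
    rw [mem_Icc]; omega
  have ht1 : (m : ℂ) * a 1 + m * a 2 = b 1 + (2 * m - m - 1 : ℕ) * b 2 + m * b 3 +
      ∑ k ∈ Icc 1 (2 * m), c k := by
    rw [ht, e, Nat.cast_sub (by omega), Nat.cast_one]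
  -- Both linear factors sit on the third block: with `δ t = b 3 + c t`, the forms in `V` and `Z`
  -- are `δ t - a 1` and `δ t - a 2`, as `cauchy_quadratic_even` requires.
  have hX := submatrix_labelEquiv (m := m) (M := 2 * m) (by omega) (b := b) (c := c)
    (f₁₂ := evenB12 m a b c) (f₁₃ := evenB13 m a b c) (f₂₃ := evenB23 m a b c)
    (f₂₁ := evenC21 m a b c) (f₃₁ := evenC31 m a b c) (f₃₂ := evenC32 m a b c) (q := q a b c)
    (U := famU (2 * m) c (q a b c)) (W := famW (2 * m) m c (q a b c))
    (V := fun t => p a b c t 3 1 * famV (2 * m) c (q a b c) t)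
    (Z := fun t => p a b c t 3 2 * famZ (2 * m) m c (q a b c) t) ?_ ?_ ?_ ?_ ?_ ?_
  · simp only [q_eq] at hX
    have : Nonempty (Icc (m + 1) (2 * m - 1)) := ⟨⟨m + 1, mem_Icc.mpr ⟨le_rfl, by omega⟩⟩⟩
    have hquad := cauchy_quadratic_even (σ := Icc (m + 1) (2 * m - 1)) (τ := Icc 1 m)
      (r := b 1 + c (2 * m)) (a₁ := a 1) (a₂ := a 2) (β := fun s => b 2 + c s)
      (δ := fun t => b 3 + c t)
      (u := fun s => famU (2 * m) c (q a b c) s) (w := fun s => famW (2 * m) m c (q a b c) s)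
      (v := fun t => p a b c t 3 1 * famV (2 * m) c (q a b c) t)
      (z := fun t => p a b c t 3 2 * famZ (2 * m) m c (q a b c) t)
      (by simp only [Fintype.card_coe, Nat.card_Icc]; omega)
      (fun t s => by rw [← q_eq]; exact hq' s s.2 t t.2) (injective_add_coe hc hs _)
      (injective_add_coe hc ht' _) (fun s => famW_ne_zero s.2 hc fun t ht => hq' s s.2 t ht)
      (fun t => mul_ne_zero (h₁ t (ht' t.2))
        (famV_ne_zero t.2 le_rfl hc fun s hs => hq' s hs t t.2))
      ?_ (fun t => ?_) (fun s => ?_)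
    · have := isIrreducibleTriple_block (a := a) (by omega) (by omega) hX hquad ha hb hc
        (k₁ := m) (k₂ := m) (by omega) ht1 ?_
      · rw [e] at this
        exact this
      · rw [e]
        refine false_of_even hm (fun i j hij => ?_) (fun i => ?_) (fun i => ?_)
        · exact hq _ (hpos i) _ (hpos j) fun h => hij (Fin.ext (by omega))
        · exact h₁ _ (hpos i)
        · exact h₂ _ (hpos i)
    · rw [sum_labels (by omega), ← ht1, Fintype.card_coe, Nat.card_Icc, Nat.add_sub_cancel]
      ring
    · simp only [← q_eq, add_sub_add_left_eq_sub]
      rw [prod_univ_erase_coe t fun k => c t - c k,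
        prod_coe_sort (Icc (m + 1) (2 * m - 1)) fun k => q a b c t k, mul_mul_mul_comm,
        famV_mul_famZ t.2 le_rfl]
      simp only [p]
      ring
    · simp only [← q_eq, add_sub_add_left_eq_sub]
      rw [prod_univ_erase_coe s fun k => c s - c k, prod_coe_sort (Icc 1 m) fun k => q a b c k s,
        famU_mul_famW s.2 (by omega)]
  · intro s hs
    rw [mem_Icc] at hs
    -- The sign exponent exceeds that of `famW` by two.
    rw [evenB12, famW, show 2 * m - (2 * m - s) = s by omega,
      show 2 * m - 1 - (2 * m - s) = s - 1 by omega,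
      show m + 1 - (2 * m - s) = s - (m + 1) + 2 by omega, pow_add]
    ring
  · intro t ht
    rw [mem_Icc] at ht
    rw [evenB13, famV, show m + 1 - (m + 1 - t) = t by omega,
      show m - (m + 1 - t) = t - 1 by omega, show m + (m + 1 - t) = 2 * m + 1 - t by omega]
    ring
  · intro s hs
    rw [mem_Icc] at hs
    rw [evenC21, famU, show 2 * m - (2 * m - s) = s by omega,
      show 2 * m + 1 - (2 * m - s) = s + 1 by omega]
  · intro t ht
    rw [mem_Icc] at ht
    rw [evenC31, famZ, show m + 1 - (m + 1 - t) = t by omega,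
      show m - 1 + (m + 1 - t) = 2 * m - t by omega, show m + 2 - (m + 1 - t) = t + 1 by omega]
    ring
  · intro s hs t ht
    rw [mul_left_comm, mul_div_assoc, ← famU_mul_famV_div hs ht (hq' s hs t ht)]
    rw [mem_Icc] at hs ht
    rw [evenB23, show 2 * m - (2 * m - s) = s by omega, show m + 1 - (m + 1 - t) = t by omega,
      show m - (m + 1 - t) = t - 1 by omega, show m + (m + 1 - t) = 2 * m + 1 - t by omega,
      show 2 * m + 1 - (2 * m - s) = s + 1 by omega]
    ring
  · intro s hs t ht
    rw [mul_assoc, mul_div_assoc, ← famZ_mul_famW_div hs ht (hq' s hs t ht)]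
    rw [mem_Icc] at hs ht
    rw [evenC32, show 2 * m - (2 * m - s) = s by omega, show m + 1 - (m + 1 - t) = t by omega,
      show m - 1 + (m + 1 - t) = 2 * m - t by omega, show m + 2 - (m + 1 - t) = t + 1 by omega,
      show 2 * m - 1 - (2 * m - s) = s - 1 by omega,
      show m + 1 - (2 * m - s) = s - (m + 1) + 2 by omega, pow_add]
    ring

lemma isIrreducibleTriple_odd {m : ℕ} (hm : 2 ≤ m) {a b c : ℕ → ℂ} (ha : a 1 ≠ a 2)
    (hb : b 1 ≠ b 2 ∧ b 1 ≠ b 3 ∧ b 2 ≠ b 3) (hc : Set.InjOn c (Icc 1 (2 * m + 1)))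
    (ht : (m + 1) * a 1 + m * a 2 = b 1 + m * b 2 + m * b 3 + ∑ k ∈ Icc 1 (2 * m + 1), c k)
    (hq : ∀ i ∈ Icc 1 (2 * m + 1), ∀ j ∈ Icc 1 (2 * m + 1), i ≠ j → q a b c i j ≠ 0)
    (h₁ : ∀ i ∈ Icc 1 (2 * m + 1), p a b c i 3 1 ≠ 0)
    (h₂ : ∀ i ∈ Icc 1 (2 * m + 1), p a b c i 2 1 ≠ 0) :
    IsIrreducibleTriple
      (ofEntries (2 * m + 1) (oddB m a b c) + ofEntries (2 * m + 1) (oddC m a b c))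
      (ofEntries (2 * m + 1) (oddB m a b c)) (ofEntries (2 * m + 1) (oddC m a b c)) := by
  have e : 2 * m + 1 - m = m + 1 := by omega
  have hs : Icc (m + 1) (2 * m + 1 - 1) ⊆ Icc 1 (2 * m + 1) := Icc_subset_Icc (by omega) (by omega)
  have ht' : Icc 1 m ⊆ Icc 1 (2 * m + 1) := Icc_subset_Icc le_rfl (by omega)
  have hq' : ∀ s ∈ Icc (m + 1) (2 * m + 1 - 1), ∀ t ∈ Icc 1 m, q a b c t s ≠ 0 := fun s hs' t ht1 =>
    hq t (ht' ht1) s (hs hs') (by rw [mem_Icc] at *; omega)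
  have hpos : ∀ i : Fin (2 * m + 1), 2 * m + 1 - (i : ℕ) ∈ Icc 1 (2 * m + 1) := fun i => by
    have := i.2
    rw [mem_Icc]; omega
  have ht1 : (m + 1 : ℕ) * a 1 + m * a 2 = b 1 + (2 * m + 1 - m - 1 : ℕ) * b 2 + m * b 3 +
      ∑ k ∈ Icc 1 (2 * m + 1), c k := by
    rw [e, Nat.add_sub_cancel, Nat.cast_succ, ht]
  -- Here each block carries one linear factor, `β s - a 1` in `W` and `δ t - a 1` in `V`, matching
  -- `R = R' = X - a 1` in `cauchy_quadratic_odd`.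
  have hX := submatrix_labelEquiv (m := m) (M := 2 * m + 1) (by omega) (b := b) (c := c)
    (f₁₂ := oddB12 m a b c) (f₁₃ := oddB13 m a b c) (f₂₃ := oddB23 m a b c)
    (f₂₁ := oddC21 m a b c) (f₃₁ := oddC31 m a b c) (f₃₂ := oddC32 m a b c) (q := q a b c)
    (U := famU (2 * m + 1) c (q a b c))
    (W := fun s => p a b c s 2 1 * famW (2 * m + 1) m c (q a b c) s)
    (V := fun t => p a b c t 3 1 * famV (2 * m + 1) c (q a b c) t)
    (Z := famZ (2 * m + 1) m c (q a b c)) ?_ ?_ ?_ ?_ ?_ ?_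
  · simp only [q_eq] at hX
    have : Nonempty (Icc (m + 1) (2 * m + 1 - 1)) := ⟨⟨m + 1, mem_Icc.mpr ⟨le_rfl, by omega⟩⟩⟩
    have hquad := cauchy_quadratic_odd (σ := Icc (m + 1) (2 * m + 1 - 1)) (τ := Icc 1 m)
      (r := b 1 + c (2 * m + 1)) (a₁ := a 1) (a₂ := a 2) (β := fun s => b 2 + c s)
      (δ := fun t => b 3 + c t)
      (u := fun s => famU (2 * m + 1) c (q a b c) s)
      (w := fun s => p a b c s 2 1 * famW (2 * m + 1) m c (q a b c) s)
      (v := fun t => p a b c t 3 1 * famV (2 * m + 1) c (q a b c) t)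
      (z := fun t => famZ (2 * m + 1) m c (q a b c) t)
      (by simp only [Fintype.card_coe, Nat.card_Icc]; omega)
      (fun t s => by rw [← q_eq]; exact hq' s s.2 t t.2) (injective_add_coe hc hs _)
      (injective_add_coe hc ht' _) (fun s => mul_ne_zero (h₂ s (hs s.2))
        (famW_ne_zero s.2 hc fun t ht => hq' s s.2 t ht))
      (fun t => mul_ne_zero (h₁ t (ht' t.2))
        (famV_ne_zero t.2 (by omega) hc fun s hs => hq' s hs t t.2))
      ?_ (fun t => ?_) (fun s => ?_)
    · have := isIrreducibleTriple_block (a := a) (by omega) (by omega) hX hquad ha hb hc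
        (k₁ := m + 1) (k₂ := m) (by omega) ht1 ?_
      · rw [e] at this
        exact this
      · rw [e]
        refine false_of_odd (fun i j hij => ?_) (fun i => ?_) (fun i => ?_)
        · exact hq _ (hpos i) _ (hpos j) fun h => hij (Fin.ext (by omega))
        · exact h₂ _ (hpos i)
        · exact h₁ _ (hpos i)
    · rw [sum_labels (by omega), ← ht1, Fintype.card_coe, Nat.card_Icc, Nat.add_sub_cancel,
        Nat.cast_succ]
      ring
    · simp only [← q_eq, add_sub_add_left_eq_sub]
      rw [prod_univ_erase_coe t fun k => c t - c k,
        prod_coe_sort (Icc (m + 1) (2 * m + 1 - 1)) fun k => q a b c t k, mul_assoc,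
        famV_mul_famZ t.2 (by omega)]
      simp only [p]
      ring
    · simp only [← q_eq, add_sub_add_left_eq_sub]
      rw [prod_univ_erase_coe s fun k => c s - c k, prod_coe_sort (Icc 1 m) fun k => q a b c k s,
        mul_left_comm, famU_mul_famW s.2 le_rfl]
      simp only [p]
      ring
  · intro s hs
    rw [mem_Icc] at hs
    rw [oddB12, famW, show 2 * m + 1 - (2 * m + 1 - s) = s by omega,
      show 2 * m - (2 * m + 1 - s) = s - 1 by omega,
      show m - (2 * m + 1 - s) = s - (m + 1) by omega]
    ring
  · intro t ht
    rw [mem_Icc] at ht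
    rw [oddB13, famV, show m + 1 - (m + 1 - t) = t by omega,
      show m - (m + 1 - t) = t - 1 by omega, show m + 1 + (m + 1 - t) = 2 * m + 1 + 1 - t by omega,
      show 2 * m + 1 - 1 = 2 * m by omega]
    ring
  · intro s hs
    rw [mem_Icc] at hs
    rw [oddC21, famU, show 2 * m + 1 - (2 * m + 1 - s) = s by omega,
      show 2 * m + 2 - (2 * m + 1 - s) = s + 1 by omega, show 2 * m + 1 - 1 = 2 * m by omega]
  · intro t ht
    rw [mem_Icc] at ht
    rw [oddC31, famZ, show m + 1 - (m + 1 - t) = t by omega,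
      show m + (m + 1 - t) = 2 * m + 1 - t by omega, show m + 2 - (m + 1 - t) = t + 1 by omega]
  · intro s hs t ht
    rw [mul_left_comm, mul_div_assoc, ← famU_mul_famV_div hs ht (hq' s hs t ht)]
    rw [mem_Icc] at hs ht
    rw [oddB23, show 2 * m + 1 - (2 * m + 1 - s) = s by omega,
      show m + 1 - (m + 1 - t) = t by omega,
      show m - (m + 1 - t) = t - 1 by omega, show m + 1 + (m + 1 - t) = 2 * m + 1 + 1 - t by omega,
      show 2 * m + 2 - (2 * m + 1 - s) = s + 1 by omega, show 2 * m + 1 - 1 = 2 * m by omega]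
    ring
  · intro s hs t ht
    rw [mul_left_comm, mul_div_assoc, ← famZ_mul_famW_div hs ht (hq' s hs t ht)]
    rw [mem_Icc] at hs ht
    rw [oddC32, show 2 * m + 1 - (2 * m + 1 - s) = s by omega,
      show m + 1 - (m + 1 - t) = t by omega,
      show m + (m + 1 - t) = 2 * m + 1 - t by omega, show m + 2 - (m + 1 - t) = t + 1 by omega,
      show 2 * m - (2 * m + 1 - s) = s - 1 by omega,
      show m - (2 * m + 1 - s) = s - (m + 1) by omega]
    ring

/-- For `i + j ≤ 2m` the form `q_{ij}` stands in the denominator of `l_i`, otherwise in its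
numerator; `p_i^{32}` moves from denominator to numerator at `i = m`. -/
lemma even_ne_zero {m : ℕ} {a b c : ℕ → ℂ} (hd : ∀ i ∈ Icc 1 (2 * m), evenDen m a b c i ≠ 0)
    (hn : ∀ i ∈ Icc 1 (2 * m), evenNum m a b c i ≠ 0) :
    (∀ i ∈ Icc 1 (2 * m), ∀ j ∈ Icc 1 (2 * m), i ≠ j → q a b c i j ≠ 0) ∧
    (∀ i ∈ Icc 1 (2 * m), p a b c i 3 1 ≠ 0) ∧ ∀ i ∈ Icc 1 (2 * m), p a b c i 3 2 ≠ 0 := by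
  simp only [evenDen, evenNum, mul_ne_zero_iff, prod_ne_zero_iff] at hd hn
  refine ⟨fun i hi j hj hij => ?_, fun i hi => ?_, fun i hi => ?_⟩
  · by_cases h : i + j ≤ 2 * m
    · exact (hd i hi).1.2 j (by simp only [mem_erase, mem_Icc] at *; omega)
    · exact (hn i hi).1.2 j (by simp only [mem_erase, mem_Icc] at *; omega)
  · have := (hn i hi).2
    split_ifs at this
    · exact this
    · exact left_ne_zero_of_mul this
  · have h1 := (hn i hi).2
    have h2 := (hd i hi).2
    split_ifs at h1 h2
    · exact h2
    · exact right_ne_zero_of_mul h1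

lemma odd_ne_zero {m : ℕ} {a b c : ℕ → ℂ} (hd : ∀ i ∈ Icc 1 (2 * m + 1), oddDen m a b c i ≠ 0)
    (hn : ∀ i ∈ Icc 1 (2 * m + 1), oddNum m a b c i ≠ 0) :
    (∀ i ∈ Icc 1 (2 * m + 1), ∀ j ∈ Icc 1 (2 * m + 1), i ≠ j → q a b c i j ≠ 0) ∧
    (∀ i ∈ Icc 1 (2 * m + 1), p a b c i 3 1 ≠ 0) ∧
    ∀ i ∈ Icc 1 (2 * m + 1), p a b c i 2 1 ≠ 0 := by
  simp only [oddDen, oddNum, mul_ne_zero_iff, prod_ne_zero_iff] at hd hn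
  refine ⟨fun i hi j hj hij => ?_, fun i hi => ?_, fun i hi => ?_⟩
  · by_cases h : i + j ≤ 2 * m + 1
    · exact (hd i hi).1.2 j (by simp only [mem_erase, mem_Icc] at *; omega)
    · exact (hn i hi).1.2 j (by simp only [mem_erase, mem_Icc] at *; omega)
  · have := (hn i hi).2
    split_ifs at this
    · exact this
    · exact left_ne_zero_of_mul this
  · have h1 := (hn i hi).2
    have h2 := (hd i hi).2
    split_ifs at h1 h2
    · exact h2
    · exact right_ne_zero_of_mul h1

end EvenOdd

/-! ### The hypergeometric family -/

section Hypergeometric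

open Finset

lemma sum_fin_succ_eq_sum_Icc (m : ℕ) (f : ℕ → ℂ) :
    ∑ i : Fin m, f (i + 1) = ∑ k ∈ Icc 1 m, f k := by
  refine sum_bij (fun i _ => (i : ℕ) + 1) ?_ ?_ ?_ ?_
  · intro i _; have := i.2; rw [mem_Icc]; omega
  · intro i _ j _ h; exact Fin.ext (by omega)
  · intro k hk
    rw [mem_Icc] at hk
    exact ⟨⟨k - 1, by omega⟩, mem_univ _, Nat.sub_add_cancel hk.1⟩
  · exact fun _ _ => rfl

lemma hg_ne_zero {m : ℕ} {a b c : ℕ → ℂ} (hd : ∀ i ∈ Icc 1 m, hgDen m a b c i ≠ 0)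
    (hn : ∀ i ∈ Icc 1 m, hgNum m a b c i ≠ 0) :
    ∀ i ∈ Icc 1 m, ∀ k ∈ Icc 1 m, b i + c k - a 2 ≠ 0 := by
  simp only [hgDen, hgNum, mul_ne_zero_iff, prod_ne_zero_iff] at hd hn
  intro i hi k hk
  by_cases h : i + k ≤ m + 1
  · exact (hd i hi).2 k (by simp only [mem_Icc] at *; omega)
  · exact (hn i hi).2 k (by simp only [mem_Icc] at *; omega)

lemma isIrreducibleTriple_hypergeometric {m : ℕ} (hm : 2 ≤ m) {a b c : ℕ → ℂ} (ha : a 1 ≠ a 2)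
    (hb : Set.InjOn b (Icc 1 m)) (hc : Set.InjOn c (Icc 1 m))
    (ht : a 1 + (m - 1) * a 2 = ∑ k ∈ Icc 1 m, b k + ∑ k ∈ Icc 1 m, c k)
    (hp : ∀ i ∈ Icc 1 m, ∀ k ∈ Icc 1 m, b i + c k - a 2 ≠ 0) :
    IsIrreducibleTriple (ofEntries m (hgB m a b c) + ofEntries m (hgC m a b c))
      (ofEntries m (hgB m a b c)) (ofEntries m (hgC m a b c)) := by
  have hb' : Function.Injective fun i : Fin m => b (i + 1) := fun i j h => by
    have := i.2
    have := j.2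
    have := hb (by simp) (by simp) h
    exact Fin.ext (by omega)
  have hc' : Function.Injective fun i : Fin m => c (m - i) := fun i j h => by
    have := i.2
    have := j.2
    have := hc (by simp; omega) (by simp; omega) h
    exact Fin.ext (by omega)
  have hsum : ∑ i : Fin m, (b (i + 1) + c (m - i)) = a 1 + (m - 1) * a 2 := by
    rw [sum_add_distrib, sum_fin_succ_eq_sum_Icc, sum_fin_rev_eq_sum_Icc, ht]
  set B := ofEntries m (hgB m a b c) with hB
  set C := ofEntries m (hgC m a b c) with hC
  have hBd : ∀ i, B i i = b (i + 1) := fun i => by simp [hB, ofEntries, hgB]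
  have hCd : ∀ i, C i i = c (m - i) := fun i => by
    simp only [hC, ofEntries, hgC, Matrix.of_apply, lt_irrefl, if_false, if_true]
    congr 1; omega
  -- The entries do not depend on the column, so this matrix times itself is its trace times itself,
  -- and the trace is `a 1 - a 2`.
  have hA : B + C - a 2 • (1 : Matrix (Fin m) (Fin m) ℂ) =
      Matrix.of fun (i _ : Fin m) => b (i + 1) + c (m - i) - a 2 := by
    ext i j
    have e : m + 1 - ((i : ℕ) + 1) = m - i := by omega
    simp only [Matrix.sub_apply, Matrix.add_apply, Matrix.smul_apply, Matrix.one_apply, hB, hC,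
      ofEntries, hgB, hgC, Matrix.of_apply, e, add_lt_add_iff_right, Fin.val_fin_lt,
      add_left_inj, Fin.val_inj]
    rcases lt_trichotomy i j with h | h | h
    · simp [h, h.ne]
    · simp [h]
    · simp [h.not_gt, h.ne']
  have kA : (B + C - a 1 • 1) * (B + C - a 2 • 1) = 0 := by
    have : B + C - a 1 • (1 : Matrix (Fin m) (Fin m) ℂ) =
        (B + C - a 2 • (1 : Matrix (Fin m) (Fin m) ℂ)) + (a 2 - a 1) • 1 := by
      rw [sub_smul]; abel
    rw [this, hA, add_mul, smul_mul_assoc, one_mul]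
    ext i j
    simp only [Matrix.add_apply, Matrix.mul_apply, Matrix.of_apply, Matrix.smul_apply,
      smul_eq_mul, ← mul_sum, Matrix.zero_apply]
    rw [sum_sub_distrib, hsum]
    simp only [sum_const, card_univ, Fintype.card_fin, nsmul_eq_mul]
    ring
  have kA' := killedBy_two kA
  have hBt : B.charpoly = ∏ i, (X - Polynomial.C (B i i)) :=
    Matrix.charpoly_of_isUpperTriangular _ fun i j hij => by
      have hij : (j : ℕ) < i := hij
      simp only [hB, ofEntries, hgB, Matrix.of_apply]
      rw [if_neg (by omega), if_neg (by omega)]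
  have hCt := charpoly_of_isLowerTriangular (M := C) fun i j hij => by
      have hij : (i : ℕ) < j := hij
      simp only [hC, ofEntries, hgC, Matrix.of_apply]
      rw [if_pos (by omega)]
  have kB := killedBy_of_charpoly hBt
  have kC := killedBy_of_charpoly hCt
  simp only [hBd] at hBt kB
  simp only [hCd] at hCt kC
  refine isIrreducibleTriple_of_forall_list (by omega) (a := ![a 1, a 2])
    (b := fun i : Fin m => b (i + 1)) (c := fun i : Fin m => c (m - i)) ?_ hb' hc' kA' kB kC
    fun L hL h2 hs => false_of_hypergeometric (fun i j => ?_) L hL h2 ?_ (m := m)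
  · intro i j hij
    fin_cases i <;> fin_cases j <;> simp_all
  · have := i.2
    have := j.2
    exact hp _ (by rw [mem_Icc]; omega) _ (by rw [mem_Icc]; omega)
  · rw [hs]
    obtain ⟨m1, m2⟩ := mult_of_trace (k₁ := 1) (k₂ := m - 1) ha kA' (by omega) (by
      rw [Matrix.trace_add, Matrix.trace, Matrix.trace, ← sum_add_distrib]
      simp only [Matrix.diag_apply, hBd, hCd]
      rw [hsum, Nat.cast_sub (by omega)]
      simp)
    refine Prod.ext (funext fun i => ?_) (Prod.ext (funext fun i => ?_) (funext fun i => ?_))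
    · fin_cases i
      · exact m1
      · exact m2
    · refine (mult_eq_card hBt kB hb' (b (i + 1))).trans ?_
      exact card_eq_one.mpr ⟨i, by ext j; simp [hb'.eq_iff]⟩
    · refine (mult_eq_card hCt kC hc' (c (m - i))).trans ?_
      exact card_eq_one.mpr ⟨i, by ext j; simp [hc'.eq_iff]⟩

end Hypergeometric

/-! ### The extra case -/

section Extra

open Finset

/-- The matrix `A - a₁` of the extra case in independent coordinates. -/
noncomputable def extraA (u v w x y z : ℂ) : Matrix (Fin 6) (Fin 6) ℂ :=
  let q₁ := (z - x - y) / 2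
  let q₂ := (y - x - z) / 2
  let q₃ := (y + z - x) / 2
  let q₄ := -(x + y + z) / 2
  !![u, 0, -(u * q₁) / y, u, u * q₁ / x, u;
    0, u + z, (u + z) * q₃ * q₄ / (y * z), -((u + z) * q₂) / z, -((u + z) * q₂ * q₄) / (x * z),
      -((u + z) * q₃) / z;
    -(v * q₂) / z, -v, v, 0, -(v * q₂) / x, v;
    -((v + y) * q₃ * q₄) / (y * z), -((v + y) * q₁) / y, 0, v + y,
      -((v + y) * q₁ * q₄) / (x * y), (v + y) * q₃ / y;
    -(w * q₃) / z, -w, w * q₃ / y, -w, w, 0;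
    (w + x) * q₂ * q₄ / (x * z), (w + x) * q₁ / x, (w + x) * q₁ * q₄ / (x * y),
      -((w + x) * q₂) / x, 0, w + x]

/-- The scalar is half the trace, as it must be for a multiple of a projection of rank two. In these
coordinates the identity needs no relation among the parameters. -/
lemma extraA_quadratic {u v w x y z : ℂ} (hx : x ≠ 0) (hy : y ≠ 0) (hz : z ≠ 0) :
    extraA u v w x y z * extraA u v w x y z =
      (u + v + w + (x + y + z) / 2) • extraA u v w x y z := by
  ext i j
  rw [Matrix.mul_apply, Fin.sum_univ_six, Matrix.smul_apply, smul_eq_mul]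
  fin_cases i <;> fin_cases j <;> simp [extraA] <;> field_simp <;> ring

/-- The forms `q` that occur in the matrices depend only on the differences within the pairs
`(1,2)`, `(3,4)`, `(5,6)`. -/
lemma extraB_add_extraC (a b c : ℕ → ℂ) :
    extraB a b c + extraC a b c - a 1 • (1 : Matrix (Fin 6) (Fin 6) ℂ) =
      extraA (b 1 + c 6 - a 1) (b 2 + c 4 - a 1) (b 3 + c 2 - a 1) (c 1 - c 2) (c 3 - c 4)
        (c 5 - c 6) := by
  have hs : ∑ l ∈ Icc 1 6, c l = c 1 + c 2 + c 3 + c 4 + c 5 + c 6 := by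
    simp [sum_Icc_succ_top]
  have e1 : qE c 2 4 5 = (c 5 - c 6 - (c 1 - c 2) - (c 3 - c 4)) / 2 := by simp only [qE, hs]; ring
  have e2 : qE c 2 3 6 = (c 3 - c 4 - (c 1 - c 2) - (c 5 - c 6)) / 2 := by simp only [qE, hs]; ring
  have e3 : qE c 2 3 5 = (c 3 - c 4 + (c 5 - c 6) - (c 1 - c 2)) / 2 := by simp only [qE, hs]; ring
  have e4 : qE c 2 4 6 = -(c 1 - c 2 + (c 3 - c 4) + (c 5 - c 6)) / 2 := by simp only [qE, hs]; ring
  have p1 : pE a b c 1 5 = b 1 + c 6 - a 1 + (c 5 - c 6) := by simp only [pE]; ring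
  have p2 : pE a b c 2 3 = b 2 + c 4 - a 1 + (c 3 - c 4) := by simp only [pE]; ring
  have p3 : pE a b c 3 1 = b 3 + c 2 - a 1 + (c 1 - c 2) := by simp only [pE]; ring
  have p4 : pE a b c 1 6 = b 1 + c 6 - a 1 := rfl
  have p5 : pE a b c 2 4 = b 2 + c 4 - a 1 := rfl
  have p6 : pE a b c 3 2 = b 3 + c 2 - a 1 := rfl
  simp only [extraB, extraC, extraA, e1, e2, e3, e4, p1, p2, p3, p4, p5, p6]
  ext i j
  fin_cases i <;> fin_cases j <;> simp <;> ring

lemma extra_pE_ne_zero {a b c : ℕ → ℂ} (hd : ∀ i ∈ Icc 1 6, extraDen a b c i ≠ 0)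
    (hn : ∀ i ∈ Icc 1 6, extraNum a b c i ≠ 0) :
    ∀ j ∈ Icc 1 6, pE a b c 1 j ≠ 0 ∧ pE a b c 2 j ≠ 0 ∧ pE a b c 3 j ≠ 0 := by
  intro j hj
  have hdj := hd j hj
  have hnj := hn j hj
  rw [mem_Icc] at hj
  obtain ⟨h1, h6⟩ := hj
  interval_cases j <;> simp only [extraDen, extraNum, mul_ne_zero_iff] at hdj hnj <;> tauto

lemma extra_qE_ne_zero {a b c : ℕ → ℂ} (hd : ∀ i ∈ Icc 1 6, extraDen a b c i ≠ 0)
    (hn : ∀ i ∈ Icc 1 6, extraNum a b c i ≠ 0) {i j : ℕ} (hi : 2 ≤ i) (hij : i < j) (hj : j ≤ 6) :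
    qE c 1 i j ≠ 0 := by
  have h1 := hn 2 (by simp)
  have h2 := hd 2 (by simp)
  have h3 := hn 3 (by simp)
  have h4 := hn 4 (by simp)
  simp only [extraDen, extraNum, mul_ne_zero_iff] at h1 h2 h3 h4
  have : i ≤ 5 := by omega
  interval_cases i <;> interval_cases j <;> tauto

/-- The forms `q` of a triple and of its complement are negatives of each other, so triples
containing the index 1 suffice. -/
lemma two_mul_sum_ne_sum {c : ℕ → ℂ}
    (hq : ∀ i j, 2 ≤ i → i < j → j ≤ 6 → qE c 1 i j ≠ 0) (s : Finset (Fin 6)) (hs : s.card = 3) :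
    2 * ∑ i ∈ s, c (6 - i) ≠ ∑ i : Fin 6, c (6 - i) := by
  -- Position 5 is the one with label 1, since labels are `6 - i`.
  have key : ∀ s : Finset (Fin 6), s.card = 3 →
      ∃ i j : Fin 6, i < j ∧ j < 5 ∧ (s = {5, j, i} ∨ sᶜ = {5, j, i}) := by decide
  obtain ⟨i, j, hij, hj, h⟩ := key s hs
  have hij' : (i : ℕ) < j := hij
  have hj' : (j : ℕ) < 5 := hj
  have h1 : ∑ k ∈ ({5, j, i} : Finset (Fin 6)), c (6 - k) = c 1 + (c (6 - j) + c (6 - i)) := by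
    rw [sum_insert, sum_pair hij.ne']
    · rfl
    · simp only [mem_insert, mem_singleton, not_or]
      exact ⟨hj.ne', (hij.trans hj).ne'⟩
  have h2 := hq (6 - j) (6 - i) (by omega) (by omega) (by omega)
  rw [qE, ← sum_fin_rev_eq_sum_Icc] at h2
  have h3 := sum_add_sum_compl s fun k : Fin 6 => c (6 - k)
  intro h4
  apply h2
  rcases h with h | h <;> rw [← h] at h1
  · linear_combination -h1 + h4 / 2
  · linear_combination -h1 + h3 - h4 / 2

lemma isIrreducibleTriple_extra {a b c : ℕ → ℂ} (ha : a 1 ≠ a 2)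
    (hb : b 1 ≠ b 2 ∧ b 1 ≠ b 3 ∧ b 2 ≠ b 3) (hc : Set.InjOn c (Icc 1 6))
    (ht : 4 * a 1 + 2 * a 2 = 2 * b 1 + 2 * b 2 + 2 * b 3 + ∑ k ∈ Icc 1 6, c k)
    (hp : ∀ j ∈ Icc 1 6, pE a b c 1 j ≠ 0 ∧ pE a b c 2 j ≠ 0 ∧ pE a b c 3 j ≠ 0)
    (hq : ∀ i j, 2 ≤ i → i < j → j ≤ 6 → qE c 1 i j ≠ 0) :
    IsIrreducibleTriple (extraB a b c + extraC a b c) (extraB a b c) (extraC a b c) := by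
  have hs : ∑ l ∈ Icc 1 6, c l = c 1 + c 2 + c 3 + c 4 + c 5 + c 6 := by
    simp [sum_Icc_succ_top]
  have hne : ∀ i ∈ Icc 1 6, ∀ j ∈ Icc 1 6, i ≠ j → c i - c j ≠ 0 := fun i hi j hj hij h =>
    hij (hc (by simpa using hi) (by simpa using hj) (sub_eq_zero.mp h))
  refine isIrreducibleTriple_of_level (ℓ := ![0, 0, 1, 1, 2, 2]) (c := fun i : Fin 6 => c (6 - i))
    (f := ![2, 2, 2]) (k₁ := 4) (k₂ := 2) (by norm_num) ha hb.1 hb.2.1 hb.2.2 (by decide) ?_ ?_ ?_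
    ?_ ?_ ?_ rfl ?_ (by decide) fun L hL h2 hs' => false_of_extra rfl ?_ (two_mul_sum_ne_sum hq) ?_
      L hL h2 hs'
  · intro i j
    fin_cases i <;> fin_cases j <;> simp [extraB]
  · intro i
    fin_cases i <;> rfl
  · intro i j h
    have := i.2
    have := j.2
    have := hc (by simp; omega) (by simp; omega) h
    exact Fin.ext (by omega)
  · intro i j hij
    fin_cases i <;> fin_cases j <;> first | exact absurd hij (by decide) | rfl
  · intro i
    fin_cases i <;> rfl
  · have e : extraB a b c + extraC a b c - a 2 • (1 : Matrix (Fin 6) (Fin 6) ℂ) =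
        extraB a b c + extraC a b c - a 1 • (1 : Matrix (Fin 6) (Fin 6) ℂ) - (a 2 - a 1) • 1 := by
      rw [sub_smul]; abel
    rw [e, extraB_add_extraC, mul_sub, extraA_quadratic (hne 1 (by simp) 2 (by simp) (by simp))
      (hne 3 (by simp) 4 (by simp) (by simp)) (hne 5 (by simp) 6 (by simp) (by simp)),
      mul_smul_comm, mul_one, ← sub_smul]
    rw [hs] at ht
    -- By the trace relation the scalar of `extraA_quadratic` equals `a 2 - a 1`, so the coefficient
    -- vanishes.
    convert zero_smul ℂ _
    linear_combination -ht / 2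
  · rw [hs] at ht
    simp [Matrix.trace, Fin.sum_univ_six, extraB, extraC]
    linear_combination -ht
  · rw [sum_fin_rev_eq_sum_Icc, ht]
  · intro j
    have := j.2
    exact hp _ (by rw [mem_Icc]; omega)

end Extra

end Simpson

theorem mainTheorem2 (τ : SimpsonType) (x y z : Fin τ.dim → ℂ)
    (h : (x, y, z) ∈ τ.SDoublePrime) :
    Simpson.IsIrreducibleTriple (τ.matA x y z) (τ.matB x y z) (τ.matC x y z) := by
  obtain ⟨⟨hS, hd⟩, hn⟩ := h
  cases τ with
  | hypergeometric m hm =>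
    obtain ⟨ha, hb, hc, ht⟩ := SimpsonType.hypergeometric_data hS
    exact Simpson.isIrreducibleTriple_hypergeometric hm ha hb hc ht (Simpson.hg_ne_zero hd hn)
  | even m hm =>
    obtain ⟨ha, hb, hc, ht⟩ := SimpsonType.even_data hS
    obtain ⟨hq, h₁, h₂⟩ := Simpson.even_ne_zero hd hn
    exact Simpson.isIrreducibleTriple_even hm ha hb hc ht hq h₁ h₂
  | odd m hm =>
    obtain ⟨ha, hb, hc, ht⟩ := SimpsonType.odd_data hS
    obtain ⟨hq, h₁, h₂⟩ := Simpson.odd_ne_zero hd hn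
    exact Simpson.isIrreducibleTriple_odd hm ha hb hc ht hq h₁ h₂
  | extra =>
    obtain ⟨ha, hb, hc, ht⟩ := SimpsonType.extra_data hS
    exact Simpson.isIrreducibleTriple_extra ha hb hc ht (Simpson.extra_pE_ne_zero hd hn)
      fun i j => Simpson.extra_qE_ne_zero hd hn
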